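/- Let $T>0$, let $W=(W_t)_{0\le t\le T}$ be a standard Brownian motion on a probability space $(\Omega,\mathcal F,P)$, and let $K:[0,T]^2\to\mathbb R$ be square integrable with $K(t,s)=0$ for $t<s$, such that $K$ is continuous on $\{0<s\le t<T\}$, continuously differentiable in $t$ for $0<s<t<T$, and, for some $0<\alpha,\beta<\frac12$ and $c>0$, $|\frac{\partial K}{\partial t}(t,s)|\le c\,(t-s)^{\alpha-1}(t/s)^{\beta}$ for all $0<s<t<T$. Put $$(K_T^*\sigma)_u=\int_u^T\sigma_s\tfrac{\partial K}{\partial s}(s,u)\,ds,\qquad \phi(r,s)=\int_0^{r\wedge s}\tfrac{\partial K}{\partial r}(r,t)\tfrac{\partial K}{\partial s}(s,t)\,dt,\qquad \widetilde\phi(r,s)=\int_0^{r\wedge s}\big|\tfrac{\partial K}{\partial r}(r,t)\big|\big|\tfrac{\partial K}{\partial s}(s,t)\big|\,dt .$$ *Spaces.* $\mathcal H$ is the Hilbert space completion of the span of the functions $1_{[0,t]}$, $t\in[0,T]$, for $\langle\sigma,\tau\rangle_{\mathcal H}=\langle K_T^*\sigma,K_T^*\tau\rangle_{L^2([0,T])}$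 (equivalently, via the isometry $K_T^*$, a closed subspace of $L^2([0,T])$). $|\mathcal H|$ is the space of measurable functions in the closure of the same span for $\|\sigma\|_{|\mathcal H|}^2=\int_0^T\big(\int_t^T|\sigma_r||\frac{\partial K}{\partial r}(r,t)|dr\big)^2dt$; it maps into $\mathcal H$ by $\sigma\mapsto K_T^*\sigma$. For measurable $a:[0,T]^2\to\mathbb R$ let $\|a\|_{|\mathcal H|\otimes|\mathcal H|}^2=\int_{[0,T]^4}|a(s,t)||a(s',t')|\,\widetilde\phi(s,s')\widetilde\phi(t,t')\,ds\,dt\,ds'\,dt'$. *Malliavin calculus.* For $\varphi\in\mathcal H$ let $X(\varphi)=\int_0^T(K_T^*\varphi)_s\,dW_s$ (Wiener integral). $\mathcal S$ is the set of $F=f(X(\varphi_1),\dots,X(\varphi_n))$ with $\varphi_j\in\mathcal H$ and $f$ smooth and bounded together with all its derivatives; $D^XF=\sum_j\partial_jf(X(\varphi_1),\dots,X(\varphi_n))\varphi_j$; $\mathbb D_{1,2}^X$ is the closure of $\mathcal S$ for $(E|F|^2+E\|D^XF\|_{\mathcal H}^2)^{1/2}$, with $D^X$ extended by closure. $\mathrm{Dom}(\delta^X)$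 is the set of $u\in L^2(\Omega;\mathcal H)$ for which there is $c>0$ with $|E\langle D^XF,u\rangle_{\mathcal H}|\le c\sqrt{E[F^2]}$ for all $F\in\mathbb D_{1,2}^X$, and $\delta^X(u)$ is then the element of $L^2(\Omega,\sigma(X),P)$ with $E[F\delta^X(u)]=E\langle D^XF,u\rangle_{\mathcal H}$ for all $F\in\mathbb D^X_{1,2}$, where $\sigma(X)$ is generated by $X(\varphi)$, $\varphi\in\mathcal H$. Let $\mathcal S^{|\mathcal H|}$ be the set of processes $u=\sum_jF_jh_j$ (finite sums) with $h_j\in|\mathcal H|$ and $F_j\in\mathcal S$ built on functions $\varphi_i\in|\mathcal H|$, with $D^X_su_t=\sum_jD^X_sF_j\,h_j(t)$. $\mathbb D_{1,2}^X(|\mathcal H|)$ is the completion of $\mathcal S^{|\mathcal H|}$ for $(E\|u\|_{|\mathcal H|}^2+E\|D^Xu\|_{|\mathcal H|\otimes|\mathcal H|}^2)^{1/2}$: its elements are the jointly measurable processes $f_t(\omega)$, together with a jointly measurable derivative $D^X_sf_t(\omega)$, such that $E\|u^n-f\|_{|\mathcal H|}^2+E\|D^Xu^n-D^Xf\|_{|\mathcal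 H|\otimes|\mathcal H|}^2\to0$ for some $u^n\in\mathcal S^{|\mathcal H|}$. Put $\mathbb D_t^Xf_s=\int_0^T\phi(t,r)D_r^Xf_s\,dr$. **Proposition.** Let $f,g\in\mathbb D_{1,2}^X(|\mathcal H|)$. Then $f$ and $g$ (as $\mathcal H$-valued random variables, through $K_T^*$) are in $L^2(\Omega;\mathcal H)$ and belong to $\mathrm{Dom}(\delta^X)$, so that $\delta^X(f)$ and $\delta^X(g)$ exist in $L^2(\Omega)$ and are uniquely determined, and $$E\big[\delta^X(f)\delta^X(g)\big]=E\langle f,g\rangle_{\mathcal H}+\int_0^Tds\int_0^Tdt\;E\big[\mathbb D_t^Xf_s\,\mathbb D_s^Xg_t\big],$$ where the last integral converges absolutely, in the sense that $\phi(t,r)\,D^X_rf_s\,\phi(s,r')\,D^X_{r'}g_t$ is integrable over $\Omega\times[0,T]^4$ in $(\omega,s,t,r,r')$. -/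

import Mathlib

open MeasureTheory ProbabilityTheory Filter Set
open scoped ENNReal Topology

noncomputable section

namespace GaussianVolterra

/-! ### Brownian motion on `[0,T]` and its Wiener integral -/

/-- A standard Brownian motion on `[0,T]`: a centred Gaussian process with covariance `min s t` and
almost surely continuous paths. -/
structure IsBrownianMotion {Ω : Type*} [MeasurableSpace Ω] (P : Measure Ω) {T : ℝ}
    (W : Icc (0 : ℝ) T → Ω → ℝ) : Prop where
  gaussian : IsGaussianProcess W P
  mean_zero : ∀ t, ∫ ω, W t ω ∂P = 0
  covariance : ∀ s t, ∫ ω, W s ω * W t ω ∂P = min (s : ℝ) (t : ℝ)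
  continuous_paths : ∀ᵐ ω ∂P, Continuous fun t => W t ω

/-- Lebesgue measure on `[0,T]`. -/
abbrev lebesgue (T : ℝ) : Measure ℝ := volume.restrict (Icc 0 T)

/-- The Hilbert space `L²([0,T])`. -/
abbrev L2 (T : ℝ) : Type := Lp ℝ 2 (lebesgue T)

section Wiener

variable {Ω : Type*} [MeasurableSpace Ω] (P : Measure Ω) {T : ℝ} (W : Icc (0 : ℝ) T → Ω → ℝ)

/-- The closure in `L²([0,T]) × L²(Ω)` of the graph of the elementary stochastic integral, that is,
of the linear span of the pairs `(1_{[0,t]}, W_t)`. -/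
def wienerGraph : Submodule ℝ (L2 T × Lp ℝ 2 P) :=
  (Submodule.span ℝ {p : L2 T × Lp ℝ 2 P | ∃ t : Icc (0 : ℝ) T,
    p.1 =ᵐ[lebesgue T] (Icc (0 : ℝ) t).indicator (fun _ => (1 : ℝ)) ∧
    p.2 =ᵐ[P] W t}).topologicalClosure

/-- The Wiener integral `∫₀ᵀ h_s dW_s` of `h ∈ L²([0,T])`: the element `ξ` of `L²(Ω)` such that
elementary functions `hₙ` exist with `hₙ → h` in `L²([0,T])` and `∫ hₙ dW → ξ` in `L²(Ω)`
(for a Brownian motion there is exactly one, by the Itô isometry). -/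
def wienerIntegral (h : L2 T) : Lp ℝ 2 P :=
  Classical.epsilon fun ξ => (h, ξ) ∈ wienerGraph P W

end Wiener

/-! ### The kernel, the operator `K_T^*` and the spaces `𝓗` and `|𝓗|` -/

/-- Square integrable kernels of Volterra type, continuous up to the diagonal and `C¹` in the first
variable off it, with `|∂K/∂t (t,s)| ≤ c (t-s)^(α-1) (t/s)^β`. -/
structure IsRegularVolterraKernel (T : ℝ) (K : ℝ → ℝ → ℝ) : Prop where
  square_integrable : MemLp (fun p : ℝ × ℝ => K p.1 p.2) 2 ((lebesgue T).prod (lebesgue T))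
  volterra : ∀ t ∈ Icc 0 T, ∀ s ∈ Icc 0 T, t < s → K t s = 0
  continuousOn : ContinuousOn (fun p : ℝ × ℝ => K p.1 p.2) {p | 0 < p.2 ∧ p.2 ≤ p.1 ∧ p.1 < T}
  differentiableOn : ∀ s ∈ Ioo 0 T, DifferentiableOn ℝ (fun t => K t s) (Ioo s T)
  continuousOn_deriv : ∀ s ∈ Ioo 0 T, ContinuousOn (deriv fun t => K t s) (Ioo s T)
  deriv_bound : ∃ α β c : ℝ, 0 < α ∧ α < 1 / 2 ∧ 0 < β ∧ β < 1 / 2 ∧ 0 < c ∧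
    ∀ s t, 0 < s → s < t → t < T →
      |deriv (fun t => K t s) t| ≤ c * (t - s) ^ (α - 1) * (t / s) ^ β

variable (T : ℝ) (K : ℝ → ℝ → ℝ)

open Classical in
/-- The partial derivative `∂K/∂t (t,s)` on `0 < s < t < T`, set to zero elsewhere. -/
def dK (t s : ℝ) : ℝ :=
  if 0 < s ∧ s < t ∧ t < T then deriv (fun t => K t s) t else 0

/-- `(K_T^* σ)_u = ∫_u^T σ_s ∂K/∂s (s,u) ds`. -/
def Kstar (σ : ℝ → ℝ) (u : ℝ) : ℝ := ∫ s in Ioc u T, σ s * dK T K s u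

open Classical in
/-- `K_T^* σ` as an element of `L²([0,T])` (zero if it is not square integrable). -/
def KstarL2 (σ : ℝ → ℝ) : L2 T :=
  if h : MemLp (Kstar T K σ) 2 (lebesgue T) then h.toLp _ else 0

/-- `1_{[0,t]}`. -/
def indicatorUpTo (t : ℝ) : ℝ → ℝ := (Icc 0 t).indicator fun _ => 1

/-- The linear span of the indicator functions `1_{[0,t]}`, `t ∈ [0,T]`. -/
def stepFunctions : Submodule ℝ (ℝ → ℝ) :=
  Submodule.span ℝ (indicatorUpTo '' Icc 0 T)

/-- The Hilbert space `𝓗`: the completion of the linear span of the `1_{[0,t]}` for the scalar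
product `⟨1_{[0,t]}, 1_{[0,s]}⟩ = ⟨K_T^* 1_{[0,t]}, K_T^* 1_{[0,s]}⟩_{L²([0,T])}`. It is realised
as its image under the isometry `K_T^*`, which is a closed subspace of `L²([0,T])`; a function `φ`
corresponds to the element `K_T^* φ`. -/
def HSpace : Submodule ℝ (L2 T) :=
  (Submodule.span ℝ ((fun t => KstarL2 T K (indicatorUpTo t)) '' Icc 0 T)).topologicalClosure

/-- `φ(r,s) = ∫_0^{min(r,s)} ∂K/∂r (r,t) ∂K/∂s (s,t) dt`. -/
def phi (r s : ℝ) : ℝ := ∫ t in Ioc 0 (min r s), dK T K r t * dK T K s t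

/-- `φ̃(r,s) = ∫_0^{min(r,s)} |∂K/∂r (r,t)| |∂K/∂s (s,t)| dt`. -/
def phiAbs (r s : ℝ) : ℝ≥0∞ := ∫⁻ t in Ioc 0 (min r s), ‖dK T K r t‖ₑ * ‖dK T K s t‖ₑ

/-- The squared semi-norm of `|𝓗|`: `∫_0^T (∫_t^T |σ_r| |∂K/∂r (r,t)| dr)² dt`. -/
def sqNormAbsH (σ : ℝ → ℝ) : ℝ≥0∞ :=
  ∫⁻ t in Icc 0 T, (∫⁻ r in Ioc t T, ‖σ r‖ₑ * ‖dK T K r t‖ₑ) ^ 2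

/-- The squared semi-norm of `|𝓗| ⊗ |𝓗|`:
`∫_{[0,T]^4} |a(s,t)| |a(s',t')| φ̃(s,s') φ̃(t,t') ds dt ds' dt'`. -/
def sqNormAbsHH (a : ℝ → ℝ → ℝ) : ℝ≥0∞ :=
  ∫⁻ s in Icc 0 T, ∫⁻ t in Icc 0 T, ∫⁻ s' in Icc 0 T, ∫⁻ t' in Icc 0 T,
    ‖a s t‖ₑ * ‖a s' t'‖ₑ * phiAbs T K s s' * phiAbs T K t t'

/-- `|𝓗|`: the (measurable) functions in the closure of the step functions for the semi-norm. -/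
def MemAbsH (σ : ℝ → ℝ) : Prop :=
  Measurable σ ∧ ∀ ε : ℝ≥0∞, 0 < ε → ∃ e ∈ stepFunctions T, sqNormAbsH T K (σ - e) < ε

/-- `C_b^∞(ℝⁿ)`: smooth functions, bounded together with all their derivatives. -/
def IsCbInfty {n : ℕ} (F : (Fin n → ℝ) → ℝ) : Prop :=
  ContDiff ℝ (⊤ : ℕ∞) F ∧ ∀ k : ℕ, ∃ C : ℝ, ∀ x, ‖iteratedFDeriv ℝ k F x‖ ≤ C

/-- The partial derivative `∂F/∂x_j`. -/
def partialDeriv {n : ℕ} (F : (Fin n → ℝ) → ℝ) (j : Fin n) (x : Fin n → ℝ) : ℝ :=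
  fderiv ℝ F x (Pi.single j 1)

variable {Ω : Type*} [MeasurableSpace Ω] (P : Measure Ω) {T} (W : Icc (0 : ℝ) T → Ω → ℝ)

/-! ### The Malliavin derivative and the divergence -/

/-- `X(h) = ∫_0^T (K_T^* h)_s dW_s` for `h ∈ 𝓗` (elements of `𝓗` being given through `K_T^*`). -/
def X (h : HSpace T K) : Lp ℝ 2 P := wienerIntegral P W (h : L2 T)

/-- `X(σ) = ∫_0^T (K_T^* σ)_s dW_s` for a function `σ`. -/
def XFun (σ : ℝ → ℝ) : Lp ℝ 2 P := wienerIntegral P W (KstarL2 T K σ)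

/-- The graph of `D^X` on `𝒮`: the pairs `(F, D^X F)` with `F = f(X(φ₁),…,X(φₙ))` and
`D^X F = ∑ ∂_j f(X(φ₁),…,X(φₙ)) φ_j`, where `f ∈ C_b^∞(ℝⁿ)` and `φ_j ∈ 𝓗`. -/
def smoothGraph : Set (Lp ℝ 2 P × Lp (HSpace T K) 2 P) :=
  {p | ∃ (n : ℕ) (f : (Fin n → ℝ) → ℝ) (φ : Fin n → HSpace T K), IsCbInfty f ∧
    p.1 =ᵐ[P] (fun ω => f fun i => X K P W (φ i) ω) ∧
    p.2 =ᵐ[P] (fun ω => ∑ j, partialDeriv f j (fun i => X K P W (φ i) ω) • φ j)}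

/-- The graph of the closed operator `D^X`: `F ∈ 𝔻_{1,2}^X` with `D^X F = G` iff `(F, G)` lies
in the closure of `smoothGraph`, i.e. in the closure for `E|F|² + E‖D^X F‖²_𝓗`. -/
def malliavinGraph : Set (Lp ℝ 2 P × Lp (HSpace T K) 2 P) := closure (smoothGraph K P W)

/-- `Dom(δ^X)`: those `u ∈ L²(Ω;𝓗)` with `|E⟨D^X F, u⟩_𝓗| ≤ c √(E F²)` for all `F ∈ 𝔻_{1,2}^X`. -/
def InDomDivergence (u : Lp (HSpace T K) 2 P) : Prop :=
  ∃ c : ℝ, 0 < c ∧ ∀ F G, (F, G) ∈ malliavinGraph K P W →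
    |∫ ω, inner ℝ (G ω) (u ω) ∂P| ≤ c * √(∫ ω, (F ω) ^ 2 ∂P)

/-- The σ-algebra generated by the Gaussian family `X(h)`, `h ∈ 𝓗`. -/
@[reducible] def sigmaX : MeasurableSpace Ω :=
  ⨆ h : HSpace T K, MeasurableSpace.comap (fun ω => X K P W h ω) inferInstance

/-- `ξ = δ^X(u)`: the element of `L²(Ω, σ(X), P)` with `E[F ξ] = E⟨D^X F, u⟩_𝓗` for all
`F ∈ 𝔻_{1,2}^X`. (Measurability with respect to `σ(X)`, up to null sets, makes it unique.) -/
def IsDivergence (u : Lp (HSpace T K) 2 P) (ξ : Lp ℝ 2 P) : Prop :=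
  AEStronglyMeasurable[sigmaX K P W] ξ P ∧
  ∀ F G, (F, G) ∈ malliavinGraph K P W →
    ∫ ω, F ω * ξ ω ∂P = ∫ ω, inner ℝ (G ω) (u ω) ∂P

/-! ### The space `𝔻_{1,2}^X(|𝓗|)` -/

/-- `F ∈ 𝒮` with function-valued derivative: `F = f(X(φ₁),…,X(φₙ))` with `φ_j ∈ |𝓗|`, and
`DF ω s = D_s^X F (ω) = ∑ ∂_j f(X(φ₁),…,X(φₙ)) φ_j(s)`. -/
def IsSmoothFun (F : Ω → ℝ) (DF : Ω → ℝ → ℝ) : Prop :=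
  ∃ (n : ℕ) (f : (Fin n → ℝ) → ℝ) (φ : Fin n → ℝ → ℝ), IsCbInfty f ∧ (∀ j, MemAbsH T K (φ j)) ∧
    (F = fun ω => f fun i => XFun K P W (φ i) ω) ∧
    (DF = fun ω s => ∑ j, partialDeriv f j (fun i => XFun K P W (φ i) ω) * φ j s)

/-- `𝒮^{|𝓗|}`: `u = ∑ F_j h_j` with `F_j ∈ 𝒮`, `h_j ∈ |𝓗|`, and its derivative
`Du ω s t = D_s^X u_t (ω) = ∑ D_s^X F_j (ω) h_j(t)`. -/
def IsSmoothProcess (u : Ω → ℝ → ℝ) (Du : Ω → ℝ → ℝ → ℝ) : Prop :=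
  ∃ (m : ℕ) (F : Fin m → Ω → ℝ) (DF : Fin m → Ω → ℝ → ℝ) (h : Fin m → ℝ → ℝ),
    (∀ j, IsSmoothFun K P W (F j) (DF j)) ∧ (∀ j, MemAbsH T K (h j)) ∧
    (u = fun ω t => ∑ j, F j ω * h j t) ∧
    (Du = fun ω s t => ∑ j, DF j ω s * h j t)

/-- `f ∈ 𝔻_{1,2}^X(|𝓗|)` with derivative `Df ω s t = D_s^X f_t (ω)`: the pair `(f, Df)` is a limit of
pairs `(u, D^X u)`, `u ∈ 𝒮^{|𝓗|}`, for the semi-norm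
`(E‖u‖²_{|𝓗|} + E‖D^X u‖²_{|𝓗|⊗|𝓗|})^{1/2}`. -/
def IsD12AbsH (f : Ω → ℝ → ℝ) (Df : Ω → ℝ → ℝ → ℝ) : Prop :=
  Measurable (fun p : Ω × ℝ => f p.1 p.2) ∧
  Measurable (fun p : Ω × ℝ × ℝ => Df p.1 p.2.1 p.2.2) ∧
  ∃ (u : ℕ → Ω → ℝ → ℝ) (Du : ℕ → Ω → ℝ → ℝ → ℝ),
    (∀ n, IsSmoothProcess K P W (u n) (Du n)) ∧
    Tendsto (fun n => (∫⁻ ω, sqNormAbsH T K (u n ω - f ω) ∂P) +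
      ∫⁻ ω, sqNormAbsHH T K (Du n ω - Df ω) ∂P) atTop (𝓝 0)

/-- The element `u` of `L²(Ω;𝓗)` is the process `f`, viewed as an `𝓗`-valued random variable. -/
def Represents (f : Ω → ℝ → ℝ) (u : Lp (HSpace T K) 2 P) : Prop :=
  ∀ᵐ ω ∂P, ((u ω : L2 T) : ℝ → ℝ) =ᵐ[lebesgue T] Kstar T K (f ω)

variable (T) in
/-- `𝔻_t^X f_s = ∫_0^T φ(t,r) D_r^X f_s dr`, where `Df ω r s = D_r^X f_s (ω)`. -/
def smoothedD (Df : Ω → ℝ → ℝ → ℝ) (ω : Ω) (t s : ℝ) : ℝ :=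
  ∫ r in Icc 0 T, phi T K t r * Df ω r s

end GaussianVolterra

end

set_option linter.unusedSectionVars false

noncomputable section

namespace GaussianVolterra

/-! By the Itô isometry and the stability of Gaussian laws under L² limits, X is an isonormal family
on 𝓗 (`isIsonormal_wienerIntegral`). On an elementary process ∑ F_j h_j the divergence is ∑ (F_j
X(h_j) - ⟨DF_j, h_j⟩). Gaussian integration by parts (`IsIsonormal.integral_mul_eq`) yields its
duality with the derivative and the identity E[δ(Fh) δ(Gk)] = ⟨h,k⟩ E[FG] + E[⟨DF,k⟩ ⟨DG,h⟩]
(`IsIsonormal.covariance_single`). Since ⟨σ,τ⟩_𝓗 = ∫∫ φ(t,r) σ_r τ_t dr dt for functions of finite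
|𝓗|-norm, the last term is the trace integral of the theorem, so the formula holds for smooth
processes (`Realizes.inner_div`).

The extension rests on one estimate. The kernel φ̃ is the covariance of |∂K|, so the norm of |𝓗|⊗|𝓗|
is the L² norm of the image of |a| under a nonnegative tensor kernel, and the trace integral is at
most the L² pairing of the images of |Df| and of the transpose of |Dg|. Transposition preserves the
norm, so Cauchy–Schwarz bounds the trace by the product of the norms in L²(Ω;|𝓗|⊗|𝓗|)
(`lintegral_enorm_traceFun_le`). This gives absolute convergence, continuity of the trace, and a
bound of E[δ(u)²] by the squared norm of 𝔻_{1,2}(|𝓗|). The divergences of an approximating sequence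
are therefore Cauchy in L²; the divergence being a closed operator, their limit is the divergence of
f (`IsD12AbsH.exists_limit`), and every term of the formula passes to the limit.

For uniqueness, the difference of two divergences is σ(X)-measurable and orthogonal to all cos X(h)
and sin X(h). Characteristic functions determine finite measures on path space, so the difference
vanishes (`IsIsonormal.eq_zero_of_integral_trig_eq_zero`). -/

/-- An isonormal Gaussian family indexed by a real inner product space. -/
structure IsIsonormal {Ω H : Type*} [MeasurableSpace Ω] (P : Measure Ω) [NormedAddCommGroup H]
    [InnerProductSpace ℝ H] (X : H → Lp ℝ 2 P) : Prop where
  map_add : ∀ h k, X (h + k) = X h + X k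
  map_smul : ∀ (c : ℝ) h, X (c • h) = c • X h
  inner_map : ∀ h k, inner ℝ (X h) (X k) = inner ℝ h k
  law : ∀ h, P.map (X h) = gaussianReal 0 (‖h‖₊ ^ 2)

/-! ### The Wiener integral is an isonormal Gaussian family -/

section Wiener

variable {Ω : Type*} [MeasurableSpace Ω] {P : Measure Ω} [IsProbabilityMeasure P] {T : ℝ}
  {W : Icc (0 : ℝ) T → Ω → ℝ}

lemma IsBrownianMotion.memLp (hW : IsBrownianMotion P W) (t : Icc (0 : ℝ) T) : MemLp (W t) 2 P :=
  (hW.gaussian.hasGaussianLaw_eval t).memLp_two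

/-- The indicator of `[0,t]` in `L²([0,T])`. -/
def stepL2 (t : Icc (0 : ℝ) T) : L2 T :=
  indicatorConstLp 2 (measurableSet_Icc (a := (0 : ℝ)) (b := (t : ℝ))) (measure_ne_top _ _) (1 : ℝ)

lemma stepL2_coe (t : Icc (0 : ℝ) T) :
    stepL2 t =ᵐ[lebesgue T] (Icc (0 : ℝ) t).indicator (fun _ => (1 : ℝ)) :=
  indicatorConstLp_coeFn

lemma inner_stepL2 (s t : Icc (0 : ℝ) T) :
    inner ℝ (stepL2 s) (stepL2 t) = min (s : ℝ) (t : ℝ) := by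
  rw [stepL2, L2.inner_indicatorConstLp_one]
  change ∫ x in Icc (0 : ℝ) s, stepL2 t x ∂(lebesgue T) = _
  rw [setIntegral_congr_ae (g := (Icc (0 : ℝ) t).indicator (fun _ => (1 : ℝ))) measurableSet_Icc
    ((stepL2_coe t).mono fun x hx _ => hx)]
  rw [integral_indicator measurableSet_Icc, integral_const, smul_eq_mul, mul_one]
  simp only [measureReal_def, Measure.restrict_apply_univ, Measure.restrict_apply,
    measurableSet_Icc]
  rw [Measure.restrict_apply (measurableSet_Icc.inter measurableSet_Icc)]
  rw [Icc_inter_Icc, Icc_inter_Icc, Real.volume_Icc]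
  have h1 := s.2.1; have h2 := s.2.2; have h3 := t.2.1; have h4 := t.2.2
  rw [ENNReal.toReal_ofReal]
  · simp only [le_refl, sup_of_le_left, sub_zero]
    rw [min_comm (t : ℝ) s, min_eq_left ((min_le_left _ _).trans h2)]
  · simp [h1, h3, h1.trans h2]

lemma wienerGraph_generators (hW : IsBrownianMotion P W) :
    {p : L2 T × Lp ℝ 2 P | ∃ t : Icc (0 : ℝ) T,
      p.1 =ᵐ[lebesgue T] (Icc (0 : ℝ) t).indicator (fun _ => (1 : ℝ)) ∧ p.2 =ᵐ[P] W t} =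
    range fun t => (stepL2 t, (hW.memLp t).toLp (W t)) := by
  ext ⟨a, b⟩
  simp only [mem_ofPred_eq, mem_range, Prod.mk.injEq]
  refine exists_congr fun t => and_congr ?_ ?_
  · refine ⟨fun h => Lp.ext ((stepL2_coe t).trans h.symm), ?_⟩
    rintro rfl
    exact stepL2_coe t
  · refine ⟨fun h => Lp.ext ((MemLp.coeFn_toLp _).trans h.symm), ?_⟩
    rintro rfl
    exact MemLp.coeFn_toLp _

/-- The span of the pairs `(1_{[0,t]}, W_t)`. -/
def elementaryGraph (hW : IsBrownianMotion P W) : Submodule ℝ (L2 T × Lp ℝ 2 P) :=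
  Submodule.span ℝ (range fun t => (stepL2 t, (hW.memLp t).toLp (W t)))

lemma wienerGraph_eq (hW : IsBrownianMotion P W) :
    wienerGraph P W = (elementaryGraph hW).topologicalClosure := by
  rw [wienerGraph, wienerGraph_generators hW, elementaryGraph]

/-- The Itô isometry in polarised form: both sides are bilinear, and on two generators both equal
min(s,t). -/
lemma inner_eq_of_mem_elementaryGraph (hW : IsBrownianMotion P W) {p q : L2 T × Lp ℝ 2 P}
    (hp : p ∈ elementaryGraph hW) (hq : q ∈ elementaryGraph hW) :
    inner ℝ p.1 q.1 = inner ℝ p.2 q.2 := by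
  unfold elementaryGraph at hp hq
  induction hp using Submodule.span_induction with
  | zero => simp
  | add x y _ _ hx hy => simp [inner_add_left, hx, hy]
  | smul a x _ hx => simp [inner_smul_left, hx]
  | mem x hx =>
    obtain ⟨s, rfl⟩ := hx
    induction hq using Submodule.span_induction with
    | zero => simp
    | add x y _ _ hx hy => simp only [Prod.fst_add, Prod.snd_add, inner_add_right, hx, hy]
    | smul a x _ hx => simp only [Prod.smul_fst, Prod.smul_snd, inner_smul_right, hx]
    | mem x hx =>
      obtain ⟨t, rfl⟩ := hx
      simp only [inner_stepL2]
      rw [L2.inner_def, ← hW.covariance s t]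
      refine integral_congr_ae ?_
      filter_upwards [(hW.memLp s).coeFn_toLp, (hW.memLp t).coeFn_toLp] with ω h1 h2
      simp [h1, h2, mul_comm]

/-- The isometry survives the closure by continuity, applied to one argument at a time with the
other held fixed. -/
lemma inner_eq_of_mem_wienerGraph (hW : IsBrownianMotion P W) {p q : L2 T × Lp ℝ 2 P}
    (hp : p ∈ wienerGraph P W) (hq : q ∈ wienerGraph P W) :
    inner ℝ p.1 q.1 = inner ℝ p.2 q.2 := by
  rw [wienerGraph_eq hW] at hp hq
  have hcl : ∀ r : L2 T × Lp ℝ 2 P, IsClosed {p : L2 T × Lp ℝ 2 P |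
      inner ℝ p.1 r.1 = inner ℝ p.2 r.2} := fun r =>
    isClosed_eq (by fun_prop) (by fun_prop)
  have h1 : ∀ r ∈ elementaryGraph hW, inner ℝ p.1 r.1 = inner ℝ p.2 r.2 := fun r hr =>
    closure_minimal (fun p hp => inner_eq_of_mem_elementaryGraph hW hp hr) (hcl r) hp
  have h2 : inner ℝ q.1 p.1 = inner ℝ q.2 p.2 :=
    closure_minimal (fun r hr => by
      have := h1 r hr
      rw [real_inner_comm r.1, real_inner_comm r.2] at this
      exact this) (hcl p) hq
  rwa [real_inner_comm p.1, real_inner_comm p.2] at h2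

lemma norm_eq_of_mem_wienerGraph (hW : IsBrownianMotion P W) {p : L2 T × Lp ℝ 2 P}
    (hp : p ∈ wienerGraph P W) : ‖p.1‖ = ‖p.2‖ := by
  have := inner_eq_of_mem_wienerGraph hW hp hp
  rw [real_inner_self_eq_norm_sq, real_inner_self_eq_norm_sq] at this
  exact (sq_eq_sq₀ (norm_nonneg _) (norm_nonneg _)).1 this

/-- Totality of the step functions. The half-lines form a π-system generating the Borel sets, and
the sets over which h integrates to zero are stable under complements (the total integral vanishes,
by the case t = T) and countable disjoint unions. -/
lemma eq_zero_of_inner_stepL2_eq_zero (hT : 0 < T) (h : L2 T)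
    (h0 : ∀ t, inner ℝ (stepL2 t) h = 0) : h = 0 := by
  have hint : Integrable h (lebesgue T) := (Lp.memLp h).integrable (by norm_num)
  have hset : ∀ t : Icc (0 : ℝ) T, ∫ x in Icc (0 : ℝ) t, h x ∂(lebesgue T) = 0 := fun t => by
    have := h0 t
    rwa [stepL2, L2.inner_indicatorConstLp_one] at this
  have htot : ∫ x, h x ∂(lebesgue T) = 0 := by
    have := hset ⟨T, hT.le, le_rfl⟩
    rwa [Measure.restrict_restrict measurableSet_Icc, inter_self] at this
  have key : ∀ s, MeasurableSet s → ∫ x in s, h x ∂(lebesgue T) = 0 := by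
    intro s hs
    induction s, hs using MeasurableSpace.induction_on_inter
      ((BorelSpace.measurable_eq (α := ℝ)).trans (borel_eq_generateFrom_Iic ℝ)) isPiSystem_Iic with
    | empty => simp
    | basic t ht =>
      obtain ⟨a, rfl⟩ := ht
      by_cases ha : 0 ≤ a
      · have := hset ⟨min a T, le_min ha hT.le, min_le_right _ _⟩
        rw [Measure.restrict_restrict measurableSet_Icc] at this
        rw [Measure.restrict_restrict measurableSet_Iic]
        convert this using 3
        ext x
        simp only [mem_inter_iff, mem_Iic, mem_Icc, le_min_iff]
        tauto
      · rw [Measure.restrict_restrict measurableSet_Iic]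
        have : Iic a ∩ Icc 0 T = ∅ := by
          ext x
          simp only [mem_inter_iff, mem_Iic, mem_Icc, mem_empty_iff_false, iff_false]
          intro h; linarith [h.1, h.2.1]
        simp [this]
    | compl t ht h =>
      have := integral_add_compl ht hint
      rw [h, htot] at this
      simpa using this
    | iUnion f hd hm h =>
      have := hasSum_integral_iUnion hm hd hint.integrableOn
      simp only [h] at this
      exact this.unique hasSum_zero
  have := hint.ae_eq_zero_of_forall_setIntegral_eq_zero fun s hs _ => key s hs
  exact Lp.ext (this.trans (Lp.coeFn_zero _ _ _).symm)

/-- The first projection of the closed graph is isometric on a complete space, so its range is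
closed; it contains every step function, hence is everything. -/
lemma exists_mem_wienerGraph (hT : 0 < T) (hW : IsBrownianMotion P W) (h : L2 T) :
    ∃ ξ, (h, ξ) ∈ wienerGraph P W := by
  let M : Submodule ℝ (L2 T × Lp ℝ 2 P) := wienerGraph P W
  have hM : IsClosed (M : Set (L2 T × Lp ℝ 2 P)) := Submodule.isClosed_topologicalClosure _
  have hcM : CompleteSpace M := hM.completeSpace_coe
  let π : M →ₗ[ℝ] L2 T := (LinearMap.fst ℝ _ _).comp M.subtype
  have hiso : Isometry π := by
    refine AddMonoidHomClass.isometry_of_norm π fun p => ?_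
    have := norm_eq_of_mem_wienerGraph hW p.2
    -- The product carries the maximum norm, and the two components of a point of the graph have
    -- equal norms.
    change ‖(p : L2 T × Lp ℝ 2 P).1‖ = ‖(p : L2 T × Lp ℝ 2 P)‖
    rw [Prod.norm_def, ← this, max_self]
  have hclosed : IsClosed (LinearMap.range π : Set (L2 T)) := by
    rw [LinearMap.coe_range]
    exact hiso.isClosedEmbedding.isClosed_range
  have htop : LinearMap.range π = ⊤ := by
    rw [← hclosed.submodule_topologicalClosure_eq, Submodule.topologicalClosure_eq_top_iff,
      Submodule.eq_bot_iff]
    intro x hx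
    refine eq_zero_of_inner_stepL2_eq_zero hT x fun t => ?_
    refine (Submodule.mem_orthogonal _ _).1 hx _ ?_
    refine ⟨⟨(stepL2 t, (hW.memLp t).toLp (W t)), ?_⟩, rfl⟩
    change _ ∈ wienerGraph P W
    rw [wienerGraph_eq hW]
    exact Submodule.le_topologicalClosure _ (Submodule.subset_span ⟨t, rfl⟩)
  obtain ⟨p, hp⟩ : h ∈ LinearMap.range π := htop ▸ Submodule.mem_top
  refine ⟨(p : L2 T × Lp ℝ 2 P).2, ?_⟩
  rw [← hp]
  exact p.2

lemma wienerIntegral_mem (hT : 0 < T) (hW : IsBrownianMotion P W) (h : L2 T) :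
    (h, wienerIntegral P W h) ∈ wienerGraph P W :=
  Classical.epsilon_spec (exists_mem_wienerGraph hT hW h)

lemma eq_of_mem_wienerGraph (hW : IsBrownianMotion P W) {h : L2 T} {ξ η : Lp ℝ 2 P}
    (h1 : (h, ξ) ∈ wienerGraph P W) (h2 : (h, η) ∈ wienerGraph P W) : ξ = η := by
  have := norm_eq_of_mem_wienerGraph hW (Submodule.sub_mem _ h1 h2)
  simp only [Prod.mk_sub_mk, sub_self, norm_zero] at this
  exact sub_eq_zero.1 (norm_eq_zero.1 this.symm)

/-- A finite combination of the W_t is Gaussian and centred, and the isometry identifies its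
variance. -/
lemma charFun_of_mem_elementaryGraph (hW : IsBrownianMotion P W) {p : L2 T × Lp ℝ 2 P}
    (hp : p ∈ elementaryGraph hW) (s : ℝ) :
    ∫ ω, Complex.exp (s * (p.2 ω : ℝ) * Complex.I) ∂P =
      Complex.exp (-((‖p.1‖ ^ 2 : ℝ) : ℂ) * s ^ 2 / 2) := by
  obtain ⟨c, hc⟩ := Finsupp.mem_span_range_iff_exists_finsupp.1 hp
  have hp2 : p.2 =ᵐ[P] fun ω => ∑ t ∈ c.support, c t • W t ω := by
    have : p.2 = ∑ t ∈ c.support, c t • (hW.memLp t).toLp (W t) := by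
      rw [← hc, Finsupp.sum, Prod.snd_sum]
      rfl
    rw [this]
    refine (Lp.coeFn_fun_finsetSum _ _).trans ?_
    have : ∀ t, (c t • (hW.memLp t).toLp (W t) : Lp ℝ 2 P) =ᵐ[P] fun ω => c t • W t ω := fun t => by
      filter_upwards [Lp.coeFn_smul (c t) ((hW.memLp t).toLp (W t)), (hW.memLp t).coeFn_toLp]
        with ω h1 h2
      rw [h1, Pi.smul_apply, h2]
    have hall := (ae_ball_iff (c.support.countable_toSet)).2 fun t (_ : t ∈ c.support) => this t
    filter_upwards [hall] with ω hω
    exact Finset.sum_congr rfl fun t ht => hω t ht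
  have hG : HasGaussianLaw p.2 P :=
    ((hW.gaussian.smul fun t => c t).hasGaussianLaw_fun_sum (I := c.support)).congr hp2.symm
  have hmean : ∫ ω, p.2 ω ∂P = 0 := by
    simp only [smul_eq_mul] at hp2
    rw [integral_congr_ae hp2, integral_finsetSum _ fun t _ =>
      ((hW.memLp t).integrable (by norm_num)).const_mul _]
    refine Finset.sum_eq_zero fun t _ => ?_
    rw [integral_const_mul, hW.mean_zero, mul_zero]
  have hvar : Var[p.2; P] = ‖p.1‖ ^ 2 := by
    rw [variance_of_integral_eq_zero hG.aemeasurable hmean]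
    have h1 : ‖p.1‖ ^ 2 = ‖p.2‖ ^ 2 := by
      have := inner_eq_of_mem_elementaryGraph hW hp hp
      rwa [real_inner_self_eq_norm_sq, real_inner_self_eq_norm_sq] at this
    rw [h1, ← real_inner_self_eq_norm_sq, L2.inner_def]
    refine integral_congr_ae (ae_of_all _ fun ω => ?_)
    simp
  have := charFun_apply_real (μ := P.map p.2) s
  rw [integral_map hG.aemeasurable (by fun_prop)] at this
  rw [← this, hG.map_eq_gaussianReal, charFun_gaussianReal, hmean, hvar]
  rw [Real.coe_toNNReal _ (by positivity)]
  congr 1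
  push_cast
  ring

/-- Both sides are continuous along a suitable approximating sequence: a subsequence converges
almost surely and the exponentials have modulus one, so dominated convergence applies. Gaussianity
thus passes to L² limits. -/
lemma charFun_of_mem_wienerGraph (hW : IsBrownianMotion P W) {p : L2 T × Lp ℝ 2 P}
    (hp : p ∈ wienerGraph P W) (s : ℝ) :
    ∫ ω, Complex.exp (s * (p.2 ω : ℝ) * Complex.I) ∂P =
      Complex.exp (-((‖p.1‖ ^ 2 : ℝ) : ℂ) * s ^ 2 / 2) := by
  rw [wienerGraph_eq hW] at hp
  obtain ⟨q, hq, hlim⟩ := mem_closure_iff_seq_limit.1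
    (show p ∈ closure (elementaryGraph hW : Set (L2 T × Lp ℝ 2 P)) from hp)
  have h2 : Tendsto (fun n => (q n).2) atTop (𝓝 p.2) := (continuous_snd.tendsto p).comp hlim
  obtain ⟨ns, hns, hae⟩ := (tendstoInMeasure_of_tendsto_Lp h2).exists_seq_tendsto_ae
  have hL : Tendsto (fun n => ∫ ω, Complex.exp (s * ((q (ns n)).2 ω : ℝ) * Complex.I) ∂P) atTop
      (𝓝 (∫ ω, Complex.exp (s * (p.2 ω : ℝ) * Complex.I) ∂P)) := by
    refine tendsto_integral_of_dominated_convergence (fun _ => 1) (fun n => ?_)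
      (integrable_const _) (fun n => ae_of_all _ fun ω => ?_) ?_
    · have hm := (Lp.stronglyMeasurable (q (ns n)).2).measurable
      exact Measurable.aestronglyMeasurable (by fun_prop)
    · rw [← Complex.ofReal_mul, Complex.norm_exp_ofReal_mul_I]
    · filter_upwards [hae] with ω hω
      have hc : Continuous fun x : ℝ => Complex.exp (s * x * Complex.I) := by fun_prop
      exact (hc.tendsto _).comp hω
  have hR : Tendsto (fun n => Complex.exp (-((‖(q (ns n)).1‖ ^ 2 : ℝ) : ℂ) * s ^ 2 / 2)) atTop
      (𝓝 (Complex.exp (-((‖p.1‖ ^ 2 : ℝ) : ℂ) * s ^ 2 / 2))) := by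
    have hc : Continuous fun x : L2 T × Lp ℝ 2 P =>
      Complex.exp (-((‖x.1‖ ^ 2 : ℝ) : ℂ) * s ^ 2 / 2) := by fun_prop
    exact ((hc.tendsto p).comp hlim).comp hns.tendsto_atTop
  refine tendsto_nhds_unique hL (hR.congr fun n => ?_)
  rw [charFun_of_mem_elementaryGraph hW (hq _)]

theorem isIsonormal_wienerIntegral (hT : 0 < T) (hW : IsBrownianMotion P W) :
    IsIsonormal P (wienerIntegral P W) where
  map_add h k := eq_of_mem_wienerGraph hW (wienerIntegral_mem hT hW _)
    (Submodule.add_mem _ (wienerIntegral_mem hT hW h) (wienerIntegral_mem hT hW k))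
  map_smul c h := eq_of_mem_wienerGraph hW (wienerIntegral_mem hT hW _)
    (Submodule.smul_mem _ c (wienerIntegral_mem hT hW h))
  inner_map h k := (inner_eq_of_mem_wienerGraph hW (wienerIntegral_mem hT hW h)
    (wienerIntegral_mem hT hW k)).symm
  law h := by
    have hm := (Lp.stronglyMeasurable (wienerIntegral P W h)).measurable
    have : IsProbabilityMeasure (P.map (wienerIntegral P W h)) :=
      Measure.isProbabilityMeasure_map hm.aemeasurable
    refine Measure.ext_of_charFun ?_
    ext s
    rw [charFun_apply_real, integral_map hm.aemeasurable (by fun_prop),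
      charFun_of_mem_wienerGraph hW (wienerIntegral_mem hT hW h), charFun_gaussianReal]
    congr 1
    push_cast
    ring

lemma IsIsonormal.comp_subtype {H : Type*} [NormedAddCommGroup H] [InnerProductSpace ℝ H]
    {X : H → Lp ℝ 2 P} (hX : IsIsonormal P X) (V : Submodule ℝ H) :
    IsIsonormal P fun h : V => X h where
  map_add h k := hX.map_add h k
  map_smul c h := hX.map_smul c h
  inner_map h k := hX.inner_map h k
  law h := hX.law h

end Wiener

/-- Stein's lemma: integration by parts for a centred Gaussian law on the line. -/
lemma integral_mul_self_gaussianReal {v : NNReal} (hv : v ≠ 0) {g g' : ℝ → ℝ}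
    (hg : ∀ x, HasDerivAt g (g' x) x) (h0 : Integrable g (gaussianReal 0 v))
    (h1 : Integrable (fun x => g x * x) (gaussianReal 0 v)) (h2 : Integrable g' (gaussianReal 0 v)) :
    ∫ x, g x * x ∂(gaussianReal 0 v) = v * ∫ x, g' x ∂(gaussianReal 0 v) := by
  have hiff : ∀ u : ℝ → ℝ, Integrable u (gaussianReal 0 v) ↔
      Integrable (fun x => gaussianPDFReal 0 v x * u x) := fun u => by
    rw [gaussianReal_of_var_ne_zero 0 hv, integrable_withDensity_iff_integrable_smul'
      (measurable_gaussianPDF 0 v) (ae_of_all _ fun x => gaussianPDF_lt_top)]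
    simp [toReal_gaussianPDF]
  rw [hiff] at h0 h1 h2
  have hv' : (v : ℝ) ≠ 0 := by exact_mod_cast hv
  have hρ : ∀ x, HasDerivAt (gaussianPDFReal 0 v) (-(x / v) * gaussianPDFReal 0 v x) x := fun x => by
    rw [gaussianPDFReal_def]
    have e1 : HasDerivAt (fun y : ℝ => -(y - 0) ^ 2 / (2 * (v : ℝ))) (-(x / v)) x := by
      have := (((hasDerivAt_id x).sub_const 0).pow 2).neg.div_const (2 * (v : ℝ))
      refine this.congr_deriv ?_
      simp
      field_simp
    refine (e1.exp.const_mul (√(2 * Real.pi * v))⁻¹).congr_deriv ?_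
    ring
  -- Integration by parts on the whole line; integrability of gρ and of the two products with
  -- derivatives makes the boundary terms vanish.
  have key := integral_mul_deriv_eq_deriv_mul_of_integrable (u := g) (v := gaussianPDFReal 0 v)
    (u' := g') (v' := fun x => -(x / v) * gaussianPDFReal 0 v x) (fun x _ => hg x) (fun x _ => hρ x)
    ((h1.const_mul (-(1 / (v : ℝ)))).congr (ae_of_all _ fun x => by simp only [Pi.mul_apply]; ring))
    (h2.congr (ae_of_all _ fun x => by simp only [Pi.mul_apply]; ring))
    (h0.congr (ae_of_all _ fun x => by simp only [Pi.mul_apply]; ring))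
  rw [integral_gaussianReal_eq_integral_smul hv, integral_gaussianReal_eq_integral_smul hv]
  simp only [smul_eq_mul]
  have e1 : ∫ x, g x * (-(x / v) * gaussianPDFReal 0 v x) =
      -(1 / (v : ℝ)) * ∫ x, gaussianPDFReal 0 v x * (g x * x) := by
    rw [← integral_const_mul]
    exact integral_congr_ae (ae_of_all _ fun x => by ring)
  have e2 : ∫ x, g' x * gaussianPDFReal 0 v x = ∫ x, gaussianPDFReal 0 v x * g' x :=
    integral_congr_ae (ae_of_all _ fun x => by ring)
  rw [e1, e2] at key
  field_simp at key
  have e3 : ∫ x, gaussianPDFReal 0 v x * (g x * x) = ∫ x, gaussianPDFReal 0 v x * g x * x :=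
    integral_congr_ae (ae_of_all _ fun x => by ring)
  rw [e3]
  linarith

/-! ### Smooth functions with bounded derivatives -/

/-- Smooth functions on a normed space, bounded together with all their derivatives. -/
def IsSmoothBounded {E : Type*} [NormedAddCommGroup E] [NormedSpace ℝ E] (f : E → ℝ) : Prop :=
  ContDiff ℝ (⊤ : ℕ∞) f ∧ ∀ k : ℕ, ∃ C : ℝ, ∀ x, ‖iteratedFDeriv ℝ k f x‖ ≤ C

namespace IsSmoothBounded

variable {E F : Type*} [NormedAddCommGroup E] [NormedSpace ℝ E] [NormedAddCommGroup F]
  [NormedSpace ℝ F] {f g : E → ℝ}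

lemma comp_clm (hf : IsSmoothBounded f) (L : F →L[ℝ] E) : IsSmoothBounded fun x => f (L x) := by
  refine ⟨hf.1.comp L.contDiff, fun k => ?_⟩
  obtain ⟨C, hC⟩ := hf.2 k
  refine ⟨C * ‖L‖ ^ k, fun x => ?_⟩
  have := L.iteratedFDeriv_comp_right hf.1 x (i := k) (by exact_mod_cast le_top)
  rw [show (fun x => f (L x)) = f ∘ L from rfl, this]
  refine (ContinuousMultilinearMap.norm_compContinuousLinearMap_le _ _).trans ?_
  simp only [Finset.prod_const, Finset.card_univ, Fintype.card_fin]
  gcongr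
  exact hC _

lemma fderiv_apply (hf : IsSmoothBounded f) (a : E) : IsSmoothBounded fun x => fderiv ℝ f x a := by
  have h1 : ContDiff ℝ (⊤ : ℕ∞) (fderiv ℝ f) := hf.1.fderiv_right (by simp)
  refine ⟨h1.clm_apply contDiff_const, fun k => ?_⟩
  obtain ⟨C, hC⟩ := hf.2 (k + 1)
  refine ⟨‖a‖ * C, fun x => ?_⟩
  refine (norm_iteratedFDeriv_clm_apply_const (N := (⊤ : ℕ∞)) h1.contDiffAt
    (by exact_mod_cast le_top)).trans ?_
  rw [norm_iteratedFDeriv_fderiv]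
  gcongr
  exact hC x

lemma mul (hf : IsSmoothBounded f) (hg : IsSmoothBounded g) :
    IsSmoothBounded fun x => f x * g x := by
  refine ⟨hf.1.mul hg.1, fun k => ?_⟩
  choose C hC using hf.2
  choose D hD using hg.2
  refine ⟨∑ i ∈ Finset.range (k + 1), (k.choose i) * C i * D (k - i), fun x => ?_⟩
  refine (norm_iteratedFDeriv_mul_le (N := (⊤ : ℕ∞)) hf.1 hg.1 x
    (by exact_mod_cast le_top)).trans ?_
  refine Finset.sum_le_sum fun i _ => ?_
  have h1 := (norm_nonneg _).trans (hC i x)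
  gcongr
  · exact hC i x
  · exact hD _ x

lemma exists_bound (hf : IsSmoothBounded f) : ∃ C, ∀ x, ‖f x‖ ≤ C := by
  obtain ⟨C, hC⟩ := hf.2 0
  exact ⟨C, fun x => by simpa using hC x⟩

lemma differentiable (hf : IsSmoothBounded f) : Differentiable ℝ f :=
  hf.1.differentiable (by simp)

lemma continuous (hf : IsSmoothBounded f) : Continuous f := hf.1.continuous

lemma fderiv_mul_apply (hf : IsSmoothBounded f) (hg : IsSmoothBounded g) (x a : E) :
    fderiv ℝ (fun x => f x * g x) x a = f x * fderiv ℝ g x a + g x * fderiv ℝ f x a := by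
  rw [fderiv_fun_mul (hf.differentiable x) (hg.differentiable x)]
  simp

lemma fderiv_comp_clm (hf : IsSmoothBounded f) (L : F →L[ℝ] E) (x a : F) :
    fderiv ℝ (fun x => f (L x)) x a = fderiv ℝ f (L x) (L a) := by
  have := fderiv_comp x (hf.differentiable (L x)) L.differentiableAt
  rw [show (fun x => f (L x)) = f ∘ L from rfl, this]
  simp

/-- This symmetry makes the second-order terms cancel in `IsIsonormal.covariance_single_aux`. -/
lemma fderiv_fderiv_comm (hf : IsSmoothBounded f) (x a b : E) :
    fderiv ℝ (fun y => fderiv ℝ f y a) x b = fderiv ℝ (fun y => fderiv ℝ f y b) x a := by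
  have h1 : DifferentiableAt ℝ (fderiv ℝ f) x :=
    (hf.1.fderiv_right (m := (⊤ : ℕ∞)) (by simp)).differentiable (by simp) x
  rw [fderiv_clm_apply h1 (differentiableAt_const a), fderiv_clm_apply h1 (differentiableAt_const b)]
  simp only [fderiv_fun_const, Pi.zero_apply, ContinuousLinearMap.comp_zero, zero_add,
    ContinuousLinearMap.flip_apply]
  exact (hf.1.contDiffAt.isSymmSndFDerivAt
    (by
    simp only [minSmoothness_of_isRCLikeNormedField]
    exact WithTop.coe_le_coe.2 (le_top (a := (2 : ℕ∞))))).eq b a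

end IsSmoothBounded

/-! ### Gaussian vectors and integration by parts -/

namespace IsIsonormal

variable {Ω H : Type*} [MeasurableSpace Ω] {P : Measure Ω} [IsProbabilityMeasure P]
  [NormedAddCommGroup H] [InnerProductSpace ℝ H] {X : H → Lp ℝ 2 P} {ι : Type*} [Fintype ι]

lemma measurable (X : H → Lp ℝ 2 P) (h : H) : Measurable (X h) :=
  (Lp.stronglyMeasurable (X h)).measurable

lemma measurable_vec (X : H → Lp ℝ 2 P) (φ : ι → H) : Measurable fun ω i => X (φ i) ω :=
  measurable_pi_lambda _ fun i => measurable X (φ i)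

/-- An isonormal family as a linear map. -/
def toLinearMap (hX : IsIsonormal P X) : H →ₗ[ℝ] Lp ℝ 2 P where
  toFun := X
  map_add' := hX.map_add
  map_smul' := hX.map_smul

lemma map_zero (hX : IsIsonormal P X) : X 0 = 0 := hX.toLinearMap.map_zero

lemma coe_sum_smul (hX : IsIsonormal P X) (c : ι → ℝ) (φ : ι → H) :
    X (∑ i, c i • φ i) =ᵐ[P] fun ω => ∑ i, c i * X (φ i) ω := by
  have h1 : X (∑ i, c i • φ i) = ∑ i, c i • X (φ i) := by
    refine (map_sum hX.toLinearMap (fun i => c i • φ i) Finset.univ).trans ?_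
    exact Finset.sum_congr rfl fun i _ => hX.map_smul _ _
  rw [h1]
  refine (Lp.coeFn_fun_finsetSum _ _).trans ?_
  filter_upwards [ae_all_iff.2 fun i => Lp.coeFn_smul (c i) (X (φ i))] with ω hω
  exact Finset.sum_congr rfl fun i _ => by rw [hω i]; rfl

lemma coe_sub_smul (hX : IsIsonormal P X) (c : ℝ) (φ h : H) :
    X (φ - c • h) =ᵐ[P] fun ω => X φ ω - c * X h ω := by
  have h1 : X (φ - c • h) = X φ - c • X h := by
    have := hX.toLinearMap.map_sub φ (c • h)
    simpa [toLinearMap, hX.map_smul] using this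
  rw [h1]
  filter_upwards [Lp.coeFn_sub (X φ) (c • X h), Lp.coeFn_smul c (X h)] with ω h2 h3
  rw [h2, Pi.sub_apply, h3]
  rfl

/-- By linearity, every linear functional of the vector is X of a single element of H, whose law is
known. -/
lemma hasGaussianLaw (hX : IsIsonormal P X) (φ : ι → H) :
    HasGaussianLaw (fun ω i => X (φ i) ω) P where
  isGaussian_map := by
    classical
    refine isGaussian_of_map_eq_gaussianReal fun L => ⟨0, ‖∑ i, L (Pi.single i 1) • φ i‖₊ ^ 2, ?_⟩
    rw [Measure.map_map L.continuous.measurable (measurable_vec X φ), ← hX.law]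
    refine Measure.map_congr ?_
    filter_upwards [hX.coe_sum_smul (fun i => L (Pi.single i 1)) φ] with ω hω
    rw [hω, Function.comp_apply]
    conv_lhs => rw [← Finset.univ_sum_single (fun i => X (φ i) ω)]
    rw [map_sum]
    refine Finset.sum_congr rfl fun i _ => ?_
    have : (Pi.single i (X (φ i) ω) : ι → ℝ) = X (φ i) ω • Pi.single i 1 := by
      rw [← Pi.single_smul]; simp
    rw [this, _root_.map_smul, smul_eq_mul, mul_comm]

lemma hasGaussianLaw_coe (hX : IsIsonormal P X) (h : H) : HasGaussianLaw (X h) P :=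
  (hX.hasGaussianLaw fun _ : Unit => h).eval ()

lemma memLp (hX : IsIsonormal P X) (h : H) {p : ℝ≥0∞} (hp : p ≠ ∞) : MemLp (X h) p P :=
  (hX.hasGaussianLaw_coe h).memLp hp

lemma integral_eq_zero (hX : IsIsonormal P X) (h : H) : ∫ ω, X h ω ∂P = 0 := by
  have := integral_id_gaussianReal (μ := 0) (v := ‖h‖₊ ^ 2)
  rwa [← hX.law h, integral_map (measurable X h).aemeasurable (by fun_prop)] at this

lemma integral_mul (hX : IsIsonormal P X) (h k : H) :
    ∫ ω, X h ω * X k ω ∂P = inner ℝ h k := by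
  rw [← hX.inner_map, L2.inner_def]
  exact integral_congr_ae (ae_of_all _ fun ω => by simp [mul_comm])

/-- The family φ together with h gives one jointly Gaussian vector, for which vanishing
cross-covariances imply independence. -/
lemma indepFun (hX : IsIsonormal P X) (φ : ι → H) (h : H) (horth : ∀ i, inner ℝ (φ i) h = 0) :
    IndepFun (fun ω i => X (φ i) ω) (X h) P := by
  have hG := hX.hasGaussianLaw (Sum.elim φ fun _ : Unit => h)
  let L : (ι ⊕ Unit → ℝ) →L[ℝ] (ι → ℝ) × (Unit → ℝ) :=
    (ContinuousLinearMap.pi fun i => .proj (Sum.inl i)).prod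
      (ContinuousLinearMap.pi fun i => .proj (Sum.inr i))
  have hG2 : HasGaussianLaw (fun ω => (fun i => X (φ i) ω, fun _ : Unit => X h ω)) P := hG.map L
  have := hG2.indepFun_of_covariance_eval (X := fun i => X (φ i)) (Y := fun _ => X h) fun i _ => by
    rw [covariance_eq_sub (hX.memLp _ (by simp)) (hX.memLp _ (by simp)), hX.integral_eq_zero h]
    simp only [Pi.mul_apply, hX.integral_mul, horth, mul_zero, sub_zero]
  exact this.comp measurable_id (measurable_pi_apply ())

/-- Gaussian integration by parts. -/
theorem integral_mul_eq (hX : IsIsonormal P X) (φ : ι → H) (h : H) {f : (ι → ℝ) → ℝ}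
    (hf : ContDiff ℝ 1 f) (h0 : Integrable (fun ω => f fun i => X (φ i) ω) P)
    (h1 : Integrable (fun ω => (f fun i => X (φ i) ω) * X h ω) P)
    (h2 : Integrable (fun ω => fderiv ℝ f (fun i => X (φ i) ω) fun i => inner ℝ (φ i) h) P) :
    ∫ ω, (f fun i => X (φ i) ω) * X h ω ∂P =
      ∫ ω, fderiv ℝ f (fun i => X (φ i) ω) (fun i => inner ℝ (φ i) h) ∂P := by
  -- The case h = 0 is split off because the law of X h is then a point mass, without density.
  by_cases hh : h = 0
  · subst hh
    have e : (fun i => inner ℝ (φ i) (0 : H)) = 0 := by ext i; simp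
    rw [e]
    simp only [_root_.map_zero, integral_zero]
    refine integral_eq_zero_of_ae ?_
    rw [hX.map_zero]
    filter_upwards [Lp.coeFn_zero ℝ 2 P] with ω hω
    rw [hω]
    simp
  have hn : ‖h‖ ≠ 0 := norm_ne_zero_iff.2 hh
  have hnn : ‖h‖₊ ^ 2 ≠ 0 := pow_ne_zero _ (nnnorm_ne_zero_iff.2 hh)
  -- Regression coefficients on h: the residuals φ_i - a_i h are orthogonal to h, so the vector X(φ)
  -- splits into R, independent of X(h), plus X(h) a.
  set a : ι → ℝ := fun i => inner ℝ (φ i) h / ‖h‖ ^ 2 with ha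
  have hav : (fun i => inner ℝ (φ i) h) = (‖h‖ ^ 2) • a := by
    ext i
    simp only [ha, Pi.smul_apply, smul_eq_mul]
    field_simp
  set R : Ω → ι → ℝ := fun ω i => X (φ i - a i • h) ω
  have hR : Measurable R := measurable_vec X fun i => φ i - a i • h
  have hZ : Measurable (X h) := measurable X h
  have hY : ∀ᵐ ω ∂P, (fun i => X (φ i) ω) = R ω + X h ω • a := by
    filter_upwards [ae_all_iff.2 fun i => hX.coe_sub_smul (a i) (φ i) h] with ω hω
    ext i
    simp only [R, Pi.add_apply, Pi.smul_apply, smul_eq_mul, hω i]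
    ring
  have hind : IndepFun R (X h) P := hX.indepFun (fun i => φ i - a i • h) h fun i => by
    rw [inner_sub_left, inner_smul_left, real_inner_self_eq_norm_sq]
    simp only [ha, conj_trivial]
    field_simp
    ring
  have hlaw := (indepFun_iff_map_prod_eq_prod_map_map hR.aemeasurable hZ.aemeasurable).1 hind
  rw [hX.law h] at hlaw
  have : IsProbabilityMeasure (P.map R) := Measure.isProbabilityMeasure_map hR.aemeasurable
  have hmp : Measurable fun ω => (R ω, X h ω) := hR.prodMk hZ
  have hfc := hf.continuous
  have hf'c : Continuous (fderiv ℝ f) := hf.continuous_fderiv (by simp)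
  -- transfer of integrals to the product space
  have tr : ∀ (g : (ι → ℝ) × ℝ → ℝ) (G : Ω → ℝ), Continuous g →
      (∀ᵐ ω ∂P, G ω = g (R ω, X h ω)) → Integrable G P →
      Integrable g ((P.map R).prod (gaussianReal 0 (‖h‖₊ ^ 2))) ∧ ∫ ω, G ω ∂P =
        ∫ r, ∫ z, g (r, z) ∂(gaussianReal 0 (‖h‖₊ ^ 2)) ∂(P.map R) := by
    intro g G hg hGg hG
    have hi : Integrable g ((P.map R).prod (gaussianReal 0 (‖h‖₊ ^ 2))) := by
      rw [← hlaw, integrable_map_measure hg.aestronglyMeasurable hmp.aemeasurable]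
      exact hG.congr hGg
    refine ⟨hi, ?_⟩
    rw [← integral_prod g hi, ← hlaw, integral_map hmp.aemeasurable hg.aestronglyMeasurable]
    exact integral_congr_ae hGg
  obtain ⟨i0, -⟩ := tr (fun p => f (p.1 + p.2 • a)) _ (by fun_prop)
    (hY.mono fun ω hω => by simp only [hω]) h0
  obtain ⟨i1, e1⟩ := tr (fun p => f (p.1 + p.2 • a) * p.2) _ (by fun_prop)
    (hY.mono fun ω hω => by simp only [hω]) h1
  obtain ⟨i2, e2⟩ := tr (fun p => fderiv ℝ f (p.1 + p.2 • a) fun i => inner ℝ (φ i) h) _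
    (by fun_prop) (hY.mono fun ω hω => by simp only [hω]) h2
  rw [e1, e2]
  refine integral_congr_ae ?_
  -- For almost every frozen value r of the residual, Stein's lemma applies along the line z ↦ r + z
  -- a.
  filter_upwards [i0.prod_right_ae, i1.prod_right_ae, i2.prod_right_ae] with r j0 j1 j2
  simp only [hav, _root_.map_smul, smul_eq_mul] at j2 ⊢
  have hn2 : (‖h‖ ^ 2) ≠ 0 := pow_ne_zero _ hn
  have j2' : Integrable (fun z => fderiv ℝ f (r + z • a) a) (gaussianReal 0 (‖h‖₊ ^ 2)) := by
    refine (j2.const_mul (‖h‖ ^ 2)⁻¹).congr (ae_of_all _ fun z => ?_)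
    field_simp
  rw [integral_const_mul]
  refine (integral_mul_self_gaussianReal hnn (g := fun z => f (r + z • a))
    (g' := fun z => fderiv ℝ f (r + z • a) a) (fun z => ?_) j0 j1 j2').trans ?_
  · have hl : HasDerivAt (fun z : ℝ => r + z • a) a z := by
      simpa using ((hasDerivAt_id z).smul_const a).const_add r
    exact (hf.differentiable (by simp) _).hasFDerivAt.comp_hasDerivAt z hl
  · push_cast
    rfl

end IsIsonormal

/-! ### Duality and covariance for elementary smooth processes -/

namespace IsIsonormal

variable {Ω H : Type*} [MeasurableSpace Ω] {P : Measure Ω} [IsProbabilityMeasure P]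
  [NormedAddCommGroup H] [InnerProductSpace ℝ H] {X : H → Lp ℝ 2 P} {ι κ : Type*} [Fintype ι]
  [Fintype κ] {f p : (ι → ℝ) → ℝ} {g : (κ → ℝ) → ℝ}

lemma measurable_smooth (X : H → Lp ℝ 2 P) (φ : ι → H) (hp : IsSmoothBounded p) :
    Measurable fun ω => p fun i => X (φ i) ω :=
  hp.continuous.measurable.comp (measurable_vec X φ)

lemma memLp_smooth (X : H → Lp ℝ 2 P) (φ : ι → H) (hp : IsSmoothBounded p) (q : ℝ≥0∞) :
    MemLp (fun ω => p fun i => X (φ i) ω) q P := by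
  obtain ⟨C, hC⟩ := hp.exists_bound
  exact MemLp.of_bound (measurable_smooth X φ hp).aestronglyMeasurable C (ae_of_all _ fun ω => hC _)

lemma integrable_smooth (X : H → Lp ℝ 2 P) (φ : ι → H) (hp : IsSmoothBounded p) :
    Integrable (fun ω => p fun i => X (φ i) ω) P :=
  memLp_one_iff_integrable.1 (memLp_smooth X φ hp 1)

lemma integrable_smooth_mul (X : H → Lp ℝ 2 P) (φ : ι → H) (hp : IsSmoothBounded p) {ξ : Ω → ℝ}
    (hξ : Integrable ξ P) : Integrable (fun ω => (p fun i => X (φ i) ω) * ξ ω) P := by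
  obtain ⟨C, hC⟩ := hp.exists_bound
  exact hξ.bdd_mul (measurable_smooth X φ hp).aestronglyMeasurable (ae_of_all _ fun ω => hC _)

lemma integrable_coe (X : H → Lp ℝ 2 P) (h : H) : Integrable (X h) P :=
  (Lp.memLp (X h)).integrable (by norm_num)

lemma integrable_mul (X : H → Lp ℝ 2 P) (h k : H) : Integrable (fun ω => X h ω * X k ω) P :=
  (Lp.memLp (X h)).integrable_mul (Lp.memLp (X k))

lemma integral_smooth_mul (hX : IsIsonormal P X) (φ : ι → H) (k : H) (hp : IsSmoothBounded p) :
    ∫ ω, (p fun i => X (φ i) ω) * X k ω ∂P =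
      ∫ ω, fderiv ℝ p (fun i => X (φ i) ω) (fun i => inner ℝ (φ i) k) ∂P :=
  hX.integral_mul_eq φ k (hp.1.of_le (by exact_mod_cast le_top)) (integrable_smooth X φ hp)
    (integrable_smooth_mul X φ hp (integrable_coe X k)) (integrable_smooth X φ (hp.fderiv_apply _))

/-- Integration by parts against X(k), applied to p(x) x_j. This function is unbounded, so
integrability is supplied by hand from X(φ_j), X(k) ∈ L². -/
lemma integral_smooth_mul_mul (hX : IsIsonormal P X) (φ : ι → H) (j : ι) (k : H)
    (hp : IsSmoothBounded p) :
    ∫ ω, (p fun i => X (φ i) ω) * (X (φ j) ω * X k ω) ∂P =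
      (∫ ω, fderiv ℝ p (fun i => X (φ i) ω) (fun i => inner ℝ (φ i) k) * X (φ j) ω ∂P) +
        inner ℝ (φ j) k * ∫ ω, (p fun i => X (φ i) ω) ∂P := by
  have hd : ∀ x b : ι → ℝ, fderiv ℝ (fun x : ι → ℝ => p x * x j) x b =
      fderiv ℝ p x b * x j + b j * p x := fun x b => by
    have h2 : HasFDerivAt (fun x : ι → ℝ => x j) (ContinuousLinearMap.proj j) x :=
      (ContinuousLinearMap.proj (R := ℝ) (φ := fun _ : ι => ℝ) j).hasFDerivAt
    rw [((hp.differentiable x).hasFDerivAt.fun_mul h2).fderiv]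
    simp only [add_apply, smul_apply, ContinuousLinearMap.proj_apply, smul_eq_mul]
    ring
  have i1 : Integrable (fun ω => fderiv ℝ p (fun i => X (φ i) ω) (fun i => inner ℝ (φ i) k) *
      X (φ j) ω) P := integrable_smooth_mul X φ (hp.fderiv_apply _) (integrable_coe X _)
  have i2 : Integrable (fun ω => inner ℝ (φ j) k * (p fun i => X (φ i) ω)) P :=
    (integrable_smooth X φ hp).const_mul _
  have key := hX.integral_mul_eq φ k (f := fun x => p x * x j)
    ((hp.1.of_le (by exact_mod_cast le_top)).mul (by fun_prop))
    (integrable_smooth_mul X φ hp (integrable_coe X _))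
    ((integrable_smooth_mul X φ hp (integrable_mul X (φ j) k)).congr
      (ae_of_all _ fun ω => by simp only [mul_assoc]))
    (by simp only [hd]; exact i1.add i2)
  simp only [hd, mul_assoc] at key
  rw [key, ← integral_const_mul, ← integral_add i1 i2]

lemma integral_sub_sub_sub {A B C D : Ω → ℝ} (hA : Integrable A P) (hB : Integrable B P)
    (hC : Integrable C P) (hD : Integrable D P) :
    ∫ ω, (A ω - B ω) - (C ω - D ω) ∂P =
      ((∫ ω, A ω ∂P) - ∫ ω, B ω ∂P) - ((∫ ω, C ω ∂P) - ∫ ω, D ω ∂P) := by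
  rw [← integral_sub hA hB, ← integral_sub hC hD]
  exact integral_sub (hA.sub hB) (hC.sub hD)

/-- Expand the product and integrate by parts three times: fg X(φ_j) against X(k), then the
resulting first-order terms against X(φ_j) and X(k). The mixed second derivatives of f occur twice
with opposite signs. Taking one direction among the φ_i makes X(φ_j) a coordinate of the common
Gaussian vector. -/
lemma covariance_single_aux (hX : IsIsonormal P X) (φ : ι → H) (j : ι) (k : H)
    {g : (ι → ℝ) → ℝ} (hf : IsSmoothBounded f) (hg : IsSmoothBounded g) :
    ∫ ω, ((f fun i => X (φ i) ω) * X (φ j) ω -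
        fderiv ℝ f (fun i => X (φ i) ω) fun i => inner ℝ (φ i) (φ j)) *
      ((g fun i => X (φ i) ω) * X k ω -
        fderiv ℝ g (fun i => X (φ i) ω) fun i => inner ℝ (φ i) k) ∂P =
      inner ℝ (φ j) k * (∫ ω, (f fun i => X (φ i) ω) * (g fun i => X (φ i) ω) ∂P) +
      ∫ ω, (fderiv ℝ f (fun i => X (φ i) ω) fun i => inner ℝ (φ i) k) *
        (fderiv ℝ g (fun i => X (φ i) ω) fun i => inner ℝ (φ i) (φ j)) ∂P := by
  set a : ι → ℝ := fun i => inner ℝ (φ i) (φ j)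
  set b : ι → ℝ := fun i => inner ℝ (φ i) k
  set Y : Ω → ι → ℝ := fun ω i => X (φ i) ω
  have sf := hf.fderiv_apply
  have sg := hg.fderiv_apply
  have I0 := fun {p : (ι → ℝ) → ℝ} (hp : IsSmoothBounded p) => integrable_smooth X φ hp
  have I1 := fun {p : (ι → ℝ) → ℝ} (hp : IsSmoothBounded p) (h : H) =>
    integrable_smooth_mul X φ hp (integrable_coe X h)
  have I2 := fun {p : (ι → ℝ) → ℝ} (hp : IsSmoothBounded p) (h k : H) =>
    integrable_smooth_mul X φ hp (integrable_mul X h k)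
  have E1 := hX.integral_smooth_mul_mul φ j k (hf.mul hg)
  have E2 := hX.integral_smooth_mul φ k ((sf a).mul hg)
  have E3 := hX.integral_smooth_mul φ (φ j) ((sf b).mul hg)
  simp only [hf.fderiv_mul_apply hg, (sf a).fderiv_mul_apply hg,
    (sf b).fderiv_mul_apply hg] at E1 E2 E3
  change ∫ ω, f (Y ω) * g (Y ω) * (X (φ j) ω * X k ω) ∂P = (∫ ω, (f (Y ω) * fderiv ℝ g (Y ω) b +
    g (Y ω) * fderiv ℝ f (Y ω) b) * X (φ j) ω ∂P) + inner ℝ (φ j) k * ∫ ω, f (Y ω) * g (Y ω) ∂P at E1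
  change ∫ ω, fderiv ℝ f (Y ω) a * g (Y ω) * X k ω ∂P = ∫ ω, fderiv ℝ f (Y ω) a * fderiv ℝ g (Y ω) b +
    g (Y ω) * fderiv ℝ (fun y => fderiv ℝ f y a) (Y ω) b ∂P at E2
  change ∫ ω, fderiv ℝ f (Y ω) b * g (Y ω) * X (φ j) ω ∂P =
    ∫ ω, fderiv ℝ f (Y ω) b * fderiv ℝ g (Y ω) a +
    g (Y ω) * fderiv ℝ (fun y => fderiv ℝ f y b) (Y ω) a ∂P at E3
  have F1 : ∫ ω, (f (Y ω) * fderiv ℝ g (Y ω) b + g (Y ω) * fderiv ℝ f (Y ω) b) * X (φ j) ω ∂P =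
      (∫ ω, f (Y ω) * fderiv ℝ g (Y ω) b * X (φ j) ω ∂P) +
      ∫ ω, fderiv ℝ f (Y ω) b * g (Y ω) * X (φ j) ω ∂P := by
    rw [← integral_add (I1 (hf.mul (sg b)) _) (I1 ((sf b).mul hg) _)]
    exact integral_congr_ae (ae_of_all _ fun ω => by simp only [Y]; ring)
  rw [integral_add (I0 ((sf a).mul (sg b))) (I0 (hg.mul ((sf a).fderiv_apply b)))] at E2
  rw [integral_add (I0 ((sf b).mul (sg a))) (I0 (hg.mul ((sf b).fderiv_apply a)))] at E3
  simp only [hf.fderiv_fderiv_comm _ a b] at E2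
  have F2 : ∫ ω, (f (Y ω) * X (φ j) ω - fderiv ℝ f (Y ω) a) *
      (g (Y ω) * X k ω - fderiv ℝ g (Y ω) b) ∂P =
      ((∫ ω, f (Y ω) * g (Y ω) * (X (φ j) ω * X k ω) ∂P) -
      ∫ ω, f (Y ω) * fderiv ℝ g (Y ω) b * X (φ j) ω ∂P) -
      ((∫ ω, fderiv ℝ f (Y ω) a * g (Y ω) * X k ω ∂P) -
      ∫ ω, fderiv ℝ f (Y ω) a * fderiv ℝ g (Y ω) b ∂P) := by
    refine Eq.trans ?_ (integral_sub_sub_sub (I2 (hf.mul hg) _ _) (I1 (hf.mul (sg b)) _)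
      (I1 ((sf a).mul hg) _) (I0 ((sf a).mul (sg b))))
    exact integral_congr_ae (ae_of_all _ fun ω => by simp only [Y]; ring)
  rw [F2, E1, F1, E2, E3]
  ring

/-- The covariance of the divergences of two elementary smooth processes `F h` and `G k`. -/
theorem covariance_single (hX : IsIsonormal P X) (φ : ι → H) (ψ : κ → H) (h k : H)
    (hf : IsSmoothBounded f) (hg : IsSmoothBounded g) :
    ∫ ω, ((f fun i => X (φ i) ω) * X h ω -
        fderiv ℝ f (fun i => X (φ i) ω) fun i => inner ℝ (φ i) h) *
      ((g fun i => X (ψ i) ω) * X k ω -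
        fderiv ℝ g (fun i => X (ψ i) ω) fun i => inner ℝ (ψ i) k) ∂P =
      inner ℝ h k * (∫ ω, (f fun i => X (φ i) ω) * (g fun i => X (ψ i) ω) ∂P) +
      ∫ ω, (fderiv ℝ f (fun i => X (φ i) ω) fun i => inner ℝ (φ i) k) *
        (fderiv ℝ g (fun i => X (ψ i) ω) fun i => inner ℝ (ψ i) h) ∂P := by
  -- The families φ, ψ and the vector h are stacked into a single one; f and g then become functions
  -- of the same vector through coordinate projections.
  let L₁ : ((ι ⊕ κ) ⊕ Unit → ℝ) →L[ℝ] (ι → ℝ) := .pi fun i => .proj (Sum.inl (Sum.inl i))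
  let L₂ : ((ι ⊕ κ) ⊕ Unit → ℝ) →L[ℝ] (κ → ℝ) := .pi fun i => .proj (Sum.inl (Sum.inr i))
  have := hX.covariance_single_aux (Sum.elim (Sum.elim φ ψ) fun _ => h) (Sum.inr ()) k
    (hf.comp_clm L₁) (hg.comp_clm L₂)
  simp only [hf.fderiv_comp_clm, hg.fderiv_comp_clm] at this
  exact this

/-- The duality between the derivative and the divergence for elementary smooth processes. -/
theorem duality_single (hX : IsIsonormal P X) (φ : ι → H) (ψ : κ → H) (h : H)
    (hf : IsSmoothBounded f) (hg : IsSmoothBounded g) :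
    ∫ ω, (g fun i => X (ψ i) ω) * ((f fun i => X (φ i) ω) * X h ω -
        fderiv ℝ f (fun i => X (φ i) ω) fun i => inner ℝ (φ i) h) ∂P =
      ∫ ω, (f fun i => X (φ i) ω) *
        (fderiv ℝ g (fun i => X (ψ i) ω) fun i => inner ℝ (ψ i) h) ∂P := by
  let L₁ : (ι ⊕ κ → ℝ) →L[ℝ] (ι → ℝ) := .pi fun i => .proj (Sum.inl i)
  let L₂ : (ι ⊕ κ → ℝ) →L[ℝ] (κ → ℝ) := .pi fun i => .proj (Sum.inr i)
  have hf' := hf.comp_clm L₁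
  have hg' := hg.comp_clm L₂
  set θ := Sum.elim φ ψ
  -- The product rule for gf puts ⟨Df, h⟩ and ⟨Dg, h⟩ on the right; moving the former across leaves
  -- the duality.
  have key := hX.integral_smooth_mul θ h (hg'.mul hf')
  simp only [hg'.fderiv_mul_apply hf', hf.fderiv_comp_clm, hg.fderiv_comp_clm] at key
  have e1 := integrable_smooth X θ (hg'.mul (hf'.fderiv_apply fun i => inner ℝ (θ i) h))
  have e2 := integrable_smooth X θ (hf'.mul (hg'.fderiv_apply fun i => inner ℝ (θ i) h))
  have e3 := integrable_smooth_mul X θ (hg'.mul hf') (integrable_coe X h)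
  simp only [hf.fderiv_comp_clm, hg.fderiv_comp_clm] at e1 e2
  rw [integral_add e1 e2] at key
  have e4 := integral_sub e3 e1
  rw [key, add_sub_cancel_left] at e4
  refine Eq.trans ?_ e4
  refine integral_congr_ae (ae_of_all _ fun ω => ?_)
  change _ = (g fun i => X (ψ i) ω) * (f fun i => X (φ i) ω) * X h ω - (g fun i => X (ψ i) ω) *
    (fderiv ℝ f (fun i => X (φ i) ω) fun i => inner ℝ (φ i) h)
  ring

end IsIsonormal

/-! ### Trigonometric functionals determine elements of L²(σ(X)) -/

lemma isSmoothBounded_cos : IsSmoothBounded Real.cos :=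
  ⟨Real.contDiff_cos, fun k => ⟨1, fun x => by
    rw [norm_iteratedFDeriv_eq_norm_iteratedDeriv]
    exact Real.abs_iteratedDeriv_cos_le_one k x⟩⟩

lemma isSmoothBounded_sin : IsSmoothBounded Real.sin :=
  ⟨Real.contDiff_sin, fun k => ⟨1, fun x => by
    rw [norm_iteratedFDeriv_eq_norm_iteratedDeriv]
    exact Real.abs_iteratedDeriv_sin_le_one k x⟩⟩

namespace IsIsonormal

variable {Ω H : Type*} [MeasurableSpace Ω] {P : Measure Ω} [IsProbabilityMeasure P]
  [NormedAddCommGroup H] [InnerProductSpace ℝ H] {X : H → Lp ℝ 2 P}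

/-- The positive part of `ζ` as a density for `P`, pushed forward to the path space `H → ℝ`. -/
def pathMeasure (X : H → Lp ℝ 2 P) (ζ : Ω → ℝ) : Measure (H → ℝ) :=
  (P.withDensity fun ω => ENNReal.ofReal (ζ ω)).map fun ω h => X h ω

lemma measurable_path (X : H → Lp ℝ 2 P) : Measurable fun ω (h : H) => X h ω :=
  measurable_pi_lambda _ fun h => measurable X h

lemma isFiniteMeasure_withDensity {ζ : Ω → ℝ} (hi : Integrable ζ P) :
    IsFiniteMeasure (P.withDensity fun ω => ENNReal.ofReal (ζ ω)) :=
  isFiniteMeasure_withDensity_ofReal hi.2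

-- A linear functional of finitely many coordinates of the path is again X of one vector, so the
-- characteristic function of each finite-dimensional marginal involves a single variable X(h).
open Classical in
lemma charFunDual_pathMeasure (hX : IsIsonormal P X) {ζ : Ω → ℝ} (hm : Measurable ζ)
    (I : Finset H) (L : StrongDual ℝ (I → ℝ)) :
    charFunDual ((pathMeasure X ζ).map I.restrict) L = ∫ ω, ((max (ζ ω) 0 : ℝ) : ℂ) *
      Complex.exp (X (∑ i, L (Pi.single i 1) • (i : H)) ω * Complex.I) ∂P := by
  rw [charFunDual_apply, pathMeasure, Measure.map_map (Finset.measurable_restrict I)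
    (measurable_path X), integral_map ((Finset.measurable_restrict I).comp
    (measurable_path X)).aemeasurable (by fun_prop),
    integral_withDensity_eq_integral_toReal_smul (by fun_prop) (ae_of_all _ fun _ => by simp)]
  refine integral_congr_ae ?_
  filter_upwards [hX.coe_sum_smul (fun i => L (Pi.single i 1)) fun i : I => (i : H)] with ω hω
  rw [hω, ENNReal.toReal_ofReal', Complex.real_smul]
  congr 4
  conv_lhs => rw [← Finset.univ_sum_single ((I.restrict ∘ fun ω (h : H) => X h ω) ω)]
  rw [map_sum]
  refine Finset.sum_congr rfl fun i _ => ?_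
  have : (Pi.single i ((I.restrict ∘ fun ω (h : H) => X h ω) ω i) : I → ℝ) =
      X i ω • Pi.single i 1 := by
    rw [← Pi.single_smul]; simp
  rw [this, _root_.map_smul, smul_eq_mul, mul_comm]

/-- Finite measures on the path space are determined by their finite-dimensional marginals, and
these by characteristic functions. As ζ⁺ - ζ⁻ = ζ, the difference of the latter is E[ζ exp(i X(h))],
which the cosine and sine conditions annihilate. -/
lemma pathMeasure_eq (hX : IsIsonormal P X) {ζ : Ω → ℝ} (hm : Measurable ζ) (hi : Integrable ζ P)
    (hcos : ∀ h, ∫ ω, Real.cos (X h ω) * ζ ω ∂P = 0)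
    (hsin : ∀ h, ∫ ω, Real.sin (X h ω) * ζ ω ∂P = 0) :
    pathMeasure X ζ = pathMeasure X fun ω => -ζ ω := by
  classical
  have f1 := isFiniteMeasure_withDensity hi
  have f2 := isFiniteMeasure_withDensity hi.neg
  have f3 : IsFiniteMeasure (pathMeasure X ζ) := Measure.isFiniteMeasure_map _ _
  have f4 : IsFiniteMeasure (pathMeasure X fun ω => -ζ ω) := Measure.isFiniteMeasure_map _ _
  have f5 : ∀ I : Finset H, IsFiniteMeasure ((pathMeasure X fun ω => -ζ ω).map I.restrict) :=
    fun I => Measure.isFiniteMeasure_map _ _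
  refine IsProjectiveLimit.unique (P := fun I => (pathMeasure X fun ω => -ζ ω).map I.restrict)
    (fun I => ?_) (fun I => rfl)
  have f6 : IsFiniteMeasure ((pathMeasure X ζ).map I.restrict) := Measure.isFiniteMeasure_map _ _
  refine Measure.ext_of_charFunDual ?_
  ext L
  rw [hX.charFunDual_pathMeasure hm]
  refine Eq.trans ?_ (hX.charFunDual_pathMeasure (ζ := fun ω => -ζ ω) hm.neg I L).symm
  set h := ∑ i, L (Pi.single i 1) • ((i : I) : H)
  have hmX := measurable X h
  have hb : ∀ {ξ : Ω → ℝ}, Integrable ξ P →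
      Integrable (fun ω => (ξ ω : ℂ) * Complex.exp (X h ω * Complex.I)) P := fun {ξ} hξ => by
    refine hξ.ofReal.mul_bdd (c := 1)
      (Measurable.aestronglyMeasurable (by fun_prop)) (ae_of_all _ fun ω => ?_)
    rw [Complex.norm_exp_ofReal_mul_I]
  have hzero : ∫ ω, (ζ ω : ℂ) * Complex.exp (X h ω * Complex.I) ∂P = 0 := by
    have e : ∀ ω, (ζ ω : ℂ) * Complex.exp (X h ω * Complex.I) =
        ((Real.cos (X h ω) * ζ ω : ℝ) : ℂ) + ((Real.sin (X h ω) * ζ ω : ℝ) : ℂ) * Complex.I := by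
      intro ω
      rw [Complex.exp_mul_I]
      push_cast
      ring
    simp only [e]
    have i1 : Integrable (fun ω => Real.cos (X h ω) * ζ ω) P :=
      hi.bdd_mul (c := 1) (Measurable.aestronglyMeasurable (by fun_prop))
        (ae_of_all _ fun ω => Real.abs_cos_le_one _)
    have i2 : Integrable (fun ω => Real.sin (X h ω) * ζ ω) P :=
      hi.bdd_mul (c := 1) (Measurable.aestronglyMeasurable (by fun_prop))
        (ae_of_all _ fun ω => Real.abs_sin_le_one _)
    rw [integral_add i1.ofReal (i2.ofReal.mul_const _), integral_mul_const]
    have c1 : ∫ ω, ((Real.cos (X h ω) * ζ ω : ℝ) : ℂ) ∂P = 0 := by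
      rw [integral_complex_ofReal, hcos, Complex.ofReal_zero]
    have c2 : ∫ ω, ((Real.sin (X h ω) * ζ ω : ℝ) : ℂ) ∂P = 0 := by
      rw [integral_complex_ofReal, hsin, Complex.ofReal_zero]
    rw [c1, c2, zero_mul, add_zero]
  rw [← sub_eq_zero, ← integral_sub (hb hi.pos_part) (hb hi.neg_part), ← hzero]
  refine integral_congr_ae (ae_of_all _ fun ω => ?_)
  simp only [← sub_mul, ← Complex.ofReal_sub]
  rw [max_zero_sub_max_neg_zero_eq_self]

/-- The `σ`-algebra generated by the family. -/
@[reducible] def sigma (X : H → Lp ℝ 2 P) : MeasurableSpace Ω :=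
  ⨆ h : H, MeasurableSpace.comap (fun ω => X h ω) inferInstance

lemma sigma_le (X : H → Lp ℝ 2 P) : sigma X ≤ ‹MeasurableSpace Ω› :=
  iSup_le fun h => (measurable X h).comap_le

lemma sigma_eq (X : H → Lp ℝ 2 P) :
    sigma X = MeasurableSpace.comap (fun ω (h : H) => X h ω) inferInstance := by
  simp only [sigma, MeasurableSpace.pi, MeasurableSpace.comap_iSup, MeasurableSpace.comap_comp]
  rfl

/-- Trigonometric functionals of the family separate the elements of `L²(σ(X))`. -/
theorem eq_zero_of_integral_trig_eq_zero (hX : IsIsonormal P X) (ζ : Lp ℝ 2 P)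
    (hζ : AEStronglyMeasurable[sigma X] ζ P)
    (hcos : ∀ h, ∫ ω, Real.cos (X h ω) * ζ ω ∂P = 0)
    (hsin : ∀ h, ∫ ω, Real.sin (X h ω) * ζ ω ∂P = 0) : ζ = 0 := by
  have hm : Measurable ζ := (Lp.stronglyMeasurable ζ).measurable
  have hi : Integrable ζ P := (Lp.memLp ζ).integrable (by norm_num)
  have hpath := hX.pathMeasure_eq hm hi hcos hsin
  -- An event of σ(X) is the preimage of a set of paths, on which the measures with densities ζ⁺ and
  -- ζ⁻ agree.
  have key : ∀ s, MeasurableSet[sigma X] s → ∫ ω in s, ζ ω ∂P = 0 := by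
    intro s hs
    have hs0 := sigma_le X s hs
    rw [sigma_eq] at hs
    obtain ⟨A, hA, rfl⟩ := hs
    have hs1 := congrArg (fun μ => μ A) hpath
    simp only [pathMeasure] at hs1
    rw [Measure.map_apply (measurable_path X) hA, Measure.map_apply (measurable_path X) hA,
      withDensity_apply _ hs0, withDensity_apply _ hs0] at hs1
    rw [integral_eq_lintegral_pos_part_sub_lintegral_neg_part hi.integrableOn, hs1, sub_self]
  have hae : ζ =ᵐ[P] (0 : Ω → ℝ) := by
    refine ae_eq_of_forall_setIntegral_eq_of_sigmaFinite' (sigma_le X)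
      (fun s _ _ => hi.integrableOn) (fun s _ _ => (integrable_zero _ _ _).integrableOn)
      (fun s hs _ => ?_) hζ aestronglyMeasurable_zero
    rw [key s hs]
    simp
  exact Lp.ext (hae.trans (Lp.coeFn_zero _ _ _).symm)

end IsIsonormal

/-! ### Energies of nonnegative kernels -/

section Energy

variable {Z V : Type*} [MeasurableSpace Z] [MeasurableSpace V] {ν : Measure Z} {lam : Measure V}
  [SFinite ν] [SFinite lam] {κ : Z → V → ℝ≥0∞}

/-- The integral operator with kernel `κ`. -/
def smear (ν : Measure Z) (κ : Z → V → ℝ≥0∞) (a : Z → ℝ≥0∞) (w : V) : ℝ≥0∞ :=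
  ∫⁻ z, a z * κ z w ∂ν

/-- The squared `L²` norm of the image under the integral operator with kernel `κ`. -/
def energy (ν : Measure Z) (lam : Measure V) (κ : Z → V → ℝ≥0∞) (a : Z → ℝ≥0∞) : ℝ≥0∞ :=
  ∫⁻ w, smear ν κ a w ^ 2 ∂lam

lemma measurable_smear (hκ : Measurable (Function.uncurry κ)) {a : Z → ℝ≥0∞} (ha : Measurable a) :
    Measurable (smear ν κ a) := by
  unfold smear
  refine Measurable.lintegral_prod_right' (f := fun p : V × Z => a p.2 * κ p.2 p.1) ?_
  exact (ha.comp measurable_snd).mul (hκ.comp measurable_swap)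

lemma measurable_smear_param {Ω : Type*} [MeasurableSpace Ω] (hκ : Measurable (Function.uncurry κ))
    {a : Ω → Z → ℝ≥0∞} (ha : Measurable (Function.uncurry a)) :
    Measurable fun p : Ω × V => smear ν κ (a p.1) p.2 := by
  unfold smear
  refine Measurable.lintegral_prod_right'
    (f := fun p : (Ω × V) × Z => a p.1.1 p.2 * κ p.2 p.1.2) ?_
  exact (ha.comp (f := fun p : (Ω × V) × Z => (p.1.1, p.2)) (by fun_prop)).mul
    (hκ.comp (f := fun p : (Ω × V) × Z => (p.2, p.1.2)) (by fun_prop))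

lemma measurable_energy {Ω : Type*} [MeasurableSpace Ω] (hκ : Measurable (Function.uncurry κ))
    {a : Ω → Z → ℝ≥0∞} (ha : Measurable (Function.uncurry a)) :
    Measurable fun ω => energy ν lam κ (a ω) := by
  unfold energy
  exact Measurable.lintegral_prod_right'
    (f := fun p : Ω × V => smear ν κ (a p.1) p.2 ^ 2) ((measurable_smear_param hκ ha).pow_const 2)

lemma ennreal_add_sq_le (x y : ℝ≥0∞) : (x + y) ^ 2 ≤ 2 * x ^ 2 + 2 * y ^ 2 := by
  by_cases hx : x = ∞
  · simp [hx]
  by_cases hy : y = ∞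
  · simp [hy]
  lift x to NNReal using hx
  lift y to NNReal using hy
  rw [← mul_add]
  have h : (x + y) ^ 2 ≤ 2 * (x ^ 2 + y ^ 2) := by
    rw [← NNReal.coe_le_coe]
    push_cast
    exact add_sq_le
  exact_mod_cast h

/-- A quasi-triangle inequality for squared norms, from (x+y)² ≤ 2x² + 2y²; the constant 2 is
harmless in the limits taken later. -/
lemma energy_le_add (hκ : Measurable (Function.uncurry κ)) {a b c : Z → ℝ≥0∞} (hb : Measurable b)
    (hc : Measurable c) (h : ∀ z, a z ≤ b z + c z) :
    energy ν lam κ a ≤ 2 * energy ν lam κ b + 2 * energy ν lam κ c := by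
  have hs : ∀ w, smear ν κ a w ≤ smear ν κ b w + smear ν κ c w := fun w => by
    unfold smear
    have hm : Measurable fun z => b z * κ z w :=
      hb.mul (hκ.comp (f := fun z => (z, w)) (by fun_prop))
    rw [← lintegral_add_left hm]
    refine lintegral_mono fun z => ?_
    rw [← add_mul]
    gcongr
    exact h z
  unfold energy
  have hmb : Measurable fun w => 2 * smear ν κ b w ^ 2 :=
    ((measurable_smear hκ hb).pow_const 2).const_mul 2
  rw [← lintegral_const_mul 2 ((measurable_smear hκ hb).pow_const 2),
    ← lintegral_const_mul 2 ((measurable_smear hκ hc).pow_const 2), ← lintegral_add_left hmb]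
  refine lintegral_mono fun w => ?_
  exact (pow_le_pow_left' (hs w) 2).trans (ennreal_add_sq_le _ _)

lemma energy_mono {a b : Z → ℝ≥0∞} (h : ∀ z, a z ≤ b z) :
    energy ν lam κ a ≤ energy ν lam κ b := by
  unfold energy smear
  gcongr with w z
  exact h z

lemma energy_const_mul (hκ : Measurable (Function.uncurry κ)) {a : Z → ℝ≥0∞} (ha : Measurable a)
    (c : ℝ≥0∞) : energy ν lam κ (fun z => c * a z) = c ^ 2 * energy ν lam κ a := by
  unfold energy
  rw [← lintegral_const_mul _ ((measurable_smear hκ ha).pow_const 2)]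
  refine lintegral_congr fun w => ?_
  rw [← mul_pow]
  congr 1
  unfold smear
  have hκw : Measurable fun z => κ z w := hκ.comp (f := fun z => (z, w)) (by fun_prop)
  rw [← lintegral_const_mul _ (ha.fun_mul hκw)]
  simp only [mul_assoc]

/-- By Tonelli, a bilinear form whose kernel is a covariance factors through the kernel that
generates it. -/
lemma lintegral_form (hκ : Measurable (Function.uncurry κ)) {a b : Z → ℝ≥0∞} (ha : Measurable a)
    (hb : Measurable b) :
    ∫⁻ z, ∫⁻ z', a z * b z' * (∫⁻ w, κ z w * κ z' w ∂lam) ∂ν ∂ν =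
      ∫⁻ w, smear ν κ a w * smear ν κ b w ∂lam := by
  have hκc : ∀ z, Measurable (κ z) := fun z => hκ.comp (f := fun w => (z, w)) (by fun_prop)
  have hκr : ∀ w, Measurable fun z => κ z w := fun w =>
    hκ.comp (f := fun z => (z, w)) (by fun_prop)
  have h1 : ∀ z, ∫⁻ z', a z * b z' * (∫⁻ w, κ z w * κ z' w ∂lam) ∂ν =
      ∫⁻ w, (a z * κ z w) * smear ν κ b w ∂lam := fun z => by
    have : ∀ z', a z * b z' * (∫⁻ w, κ z w * κ z' w ∂lam) =
        ∫⁻ w, (a z * κ z w) * (b z' * κ z' w) ∂lam := fun z' => by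
      rw [← lintegral_const_mul _ ((hκc z).fun_mul (hκc z'))]
      exact lintegral_congr fun w => by ring
    simp only [this]
    rw [lintegral_lintegral_swap]
    · refine lintegral_congr fun w => ?_
      rw [lintegral_const_mul _ (hb.fun_mul (hκr w))]
      rfl
    · refine Measurable.aemeasurable ?_
      have e1 : Measurable fun p : Z × V => κ z p.2 := (hκc z).comp measurable_snd
      have e2 : Measurable fun p : Z × V => κ p.1 p.2 := hκ
      have e3 : Measurable fun p : Z × V => b p.1 := hb.comp measurable_fst
      exact (e1.const_mul _).mul (e3.mul e2)
  simp only [h1]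
  rw [lintegral_lintegral_swap]
  · refine lintegral_congr fun w => ?_
    rw [lintegral_mul_const _ (ha.fun_mul (hκr w))]
    rfl
  · refine Measurable.aemeasurable ?_
    exact ((ha.comp measurable_fst).mul hκ).mul ((measurable_smear hκ hb).comp measurable_snd)

lemma lintegral_mul_le_sqrt {Ω : Type*} [MeasurableSpace Ω] {μ : Measure Ω} {f g : Ω → ℝ≥0∞}
    (hf : AEMeasurable f μ) (hg : AEMeasurable g μ) :
    ∫⁻ ω, f ω * g ω ∂μ ≤ (∫⁻ ω, f ω ^ 2 ∂μ) ^ (1 / 2 : ℝ) * (∫⁻ ω, g ω ^ 2 ∂μ) ^ (1 / 2 : ℝ) := by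
  have := ENNReal.lintegral_mul_le_Lp_mul_Lq μ Real.HolderConjugate.two_two hf hg
  simpa using this

/-- The Cauchy–Schwarz inequality for random energies. -/
lemma lintegral_smear_mul_le {Ω : Type*} [MeasurableSpace Ω] {P : Measure Ω} [SFinite P]
    (hκ : Measurable (Function.uncurry κ)) {a b : Ω → Z → ℝ≥0∞}
    (ha : Measurable (Function.uncurry a)) (hb : Measurable (Function.uncurry b)) :
    ∫⁻ ω, ∫⁻ w, smear ν κ (a ω) w * smear ν κ (b ω) w ∂lam ∂P ≤
      (∫⁻ ω, energy ν lam κ (a ω) ∂P) ^ (1 / 2 : ℝ) *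
        (∫⁻ ω, energy ν lam κ (b ω) ∂P) ^ (1 / 2 : ℝ) := by
  have h1 := measurable_smear_param (ν := ν) hκ ha
  have h2 := measurable_smear_param (ν := ν) hκ hb
  have := lintegral_mul_le_sqrt (μ := P.prod lam) h1.aemeasurable h2.aemeasurable
  rwa [lintegral_prod _ (h1.fun_mul h2).aemeasurable, lintegral_prod _ (h1.pow_const 2).aemeasurable,
    lintegral_prod _ (h2.pow_const 2).aemeasurable] at this

end Energy

/-! ### Tensor kernels and the trace pairing -/

section Tensor

variable {S : Type*} [MeasurableSpace S] {μ : Measure S} [SFinite μ] {κ : S → S → ℝ≥0∞}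

/-- The tensor square of a kernel. -/
def tensorKernel (κ : S → S → ℝ≥0∞) (z w : S × S) : ℝ≥0∞ := κ z.1 w.1 * κ z.2 w.2

lemma measurable_tensorKernel (hκ : Measurable (Function.uncurry κ)) :
    Measurable (Function.uncurry (tensorKernel κ)) :=
  (hκ.comp (f := fun p : (S × S) × (S × S) => (p.1.1, p.2.1)) (by fun_prop)).mul
    (hκ.comp (f := fun p : (S × S) × (S × S) => (p.1.2, p.2.2)) (by fun_prop))

/-- The squared norm of `|𝓗| ⊗ |𝓗|` as the energy of the tensor kernel. -/
def tensorEnergy (μ : Measure S) (κ : S → S → ℝ≥0∞) (a : S × S → ℝ≥0∞) : ℝ≥0∞ :=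
  energy (μ.prod μ) (μ.prod μ) (tensorKernel κ) a

lemma tensorEnergy_mul (hκ : Measurable (Function.uncurry κ)) {a b : S → ℝ≥0∞}
    (ha : Measurable a) (hb : Measurable b) :
    tensorEnergy μ κ (fun z => a z.1 * b z.2) = energy μ μ κ a * energy μ μ κ b := by
  have hκr : ∀ w, Measurable fun z => κ z w := fun w =>
    hκ.comp (f := fun z => (z, w)) (by fun_prop)
  have : ∀ w, smear (μ.prod μ) (tensorKernel κ) (fun z => a z.1 * b z.2) w =
      smear μ κ a w.1 * smear μ κ b w.2 := fun w => by
    unfold smear tensorKernel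
    rw [← lintegral_prod_mul (ha.fun_mul (hκr _)).aemeasurable (hb.fun_mul (hκr _)).aemeasurable]
    exact lintegral_congr fun z => by ring
  unfold tensorEnergy energy
  simp only [this, mul_pow]
  exact lintegral_prod_mul ((measurable_smear hκ ha).pow_const 2).aemeasurable
    ((measurable_smear hκ hb).pow_const 2).aemeasurable

/-- Both factors of the tensor kernel are the same, so transposing a merely transposes its image. It
is needed because the trace pairing transposes one of its arguments. -/
lemma tensorEnergy_swap (a : S × S → ℝ≥0∞) :
    tensorEnergy μ κ (fun z => a z.swap) = tensorEnergy μ κ a := by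
  have h : ∀ w, smear (μ.prod μ) (tensorKernel κ) (fun z => a z.swap) w =
      smear (μ.prod μ) (tensorKernel κ) a w.swap := fun w => by
    unfold smear
    rw [← (Measure.measurePreserving_swap (μ := μ) (ν := μ)).lintegral_comp_emb
      MeasurableEquiv.prodComm.measurableEmbedding]
    refine lintegral_congr fun z => ?_
    simp only [tensorKernel, Prod.fst_swap, Prod.snd_swap]
    rw [Prod.swap_swap, mul_comm (κ z.2 w.1)]
  unfold tensorEnergy energy
  simp only [h]
  exact (Measure.measurePreserving_swap (μ := μ) (ν := μ)).lintegral_comp_emb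
    MeasurableEquiv.prodComm.measurableEmbedding
    (fun w => smear (μ.prod μ) (tensorKernel κ) a w ^ 2)

/-- The covariance kernel of `κ`. -/
def absCov (μ : Measure S) (κ : S → S → ℝ≥0∞) (r s : S) : ℝ≥0∞ := ∫⁻ t, κ r t * κ s t ∂μ

lemma absCov_comm (r s : S) : absCov μ κ r s = absCov μ κ s r := by
  unfold absCov
  simp only [mul_comm]

lemma measurable_absCov (hκ : Measurable (Function.uncurry κ)) :
    Measurable (Function.uncurry (absCov μ κ)) := by
  refine Measurable.lintegral_prod_right' (f := fun p : (S × S) × S => κ p.1.1 p.2 * κ p.1.2 p.2) ?_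
  exact (hκ.comp (f := fun p : (S × S) × S => (p.1.1, p.2)) (by fun_prop)).mul
    (hκ.comp (f := fun p : (S × S) × S => (p.1.2, p.2)) (by fun_prop))

lemma lintegral_tensorKernel (hκ : Measurable (Function.uncurry κ)) (z z' : S × S) :
    ∫⁻ w, tensorKernel κ z w * tensorKernel κ z' w ∂(μ.prod μ) =
      absCov μ κ z.1 z'.1 * absCov μ κ z.2 z'.2 := by
  have hκc : ∀ z, Measurable (κ z) := fun z => hκ.comp (f := fun w => (z, w)) (by fun_prop)
  unfold absCov tensorKernel
  rw [← lintegral_prod_mul ((hκc _).fun_mul (hκc _)).aemeasurable ((hκc _).fun_mul (hκc _)).aemeasurable]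
  exact lintegral_congr fun w => by ring

lemma lintegral_tensor_form (hκ : Measurable (Function.uncurry κ)) {a b : S × S → ℝ≥0∞}
    (ha : Measurable a) (hb : Measurable b) :
    ∫⁻ s, ∫⁻ t, ∫⁻ s', ∫⁻ t', a (s, t) * b (s', t') * absCov μ κ s s' * absCov μ κ t t'
        ∂μ ∂μ ∂μ ∂μ =
      ∫⁻ w, smear (μ.prod μ) (tensorKernel κ) a w * smear (μ.prod μ) (tensorKernel κ) b w
        ∂(μ.prod μ) := by
  have hc := measurable_absCov (μ := μ) hκ
  rw [← lintegral_form (measurable_tensorKernel hκ) ha hb]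
  simp only [lintegral_tensorKernel hκ]
  have hm : Measurable fun p : (S × S) × (S × S) => a p.1 * b p.2 *
      (absCov μ κ p.1.1 p.2.1 * absCov μ κ p.1.2 p.2.2) :=
    ((ha.comp measurable_fst).mul (hb.comp measurable_snd)).mul
      ((hc.comp (f := fun p : (S × S) × (S × S) => (p.1.1, p.2.1)) (by fun_prop)).mul
      (hc.comp (f := fun p : (S × S) × (S × S) => (p.1.2, p.2.2)) (by fun_prop)))
  rw [lintegral_prod _ hm.lintegral_prod_right'.aemeasurable]
  refine lintegral_congr fun s => lintegral_congr fun t => ?_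
  refine Eq.trans ?_ (lintegral_prod _
    (hm.comp (f := fun q => ((s, t), q)) (by fun_prop)).aemeasurable).symm
  simp only [mul_assoc, Function.comp_apply]

/-- The trace pairing of two kernels as a pairing of the smeared kernels. -/
lemma lintegral_trace (hκ : Measurable (Function.uncurry κ)) {a b : S × S → ℝ≥0∞}
    (ha : Measurable a) (hb : Measurable b) :
    ∫⁻ s, ∫⁻ t, ∫⁻ r, ∫⁻ r', (absCov μ κ t r * a (r, s)) * (absCov μ κ s r' * b (r', t))
        ∂μ ∂μ ∂μ ∂μ =
      ∫⁻ w, smear (μ.prod μ) (tensorKernel κ) a w *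
        smear (μ.prod μ) (tensorKernel κ) (fun z => b z.swap) w ∂(μ.prod μ) := by
  have hc := measurable_absCov (μ := μ) hκ
  rw [← lintegral_tensor_form hκ ha (b := fun z => b z.swap) (hb.comp measurable_swap)]
  have hm : Measurable fun p : ((S × S) × S) × S =>
      (absCov μ κ p.1.1.2 p.1.2 * a (p.1.2, p.1.1.1)) *
      (absCov μ κ p.1.1.1 p.2 * b (p.2, p.1.1.2)) :=
    ((hc.comp (f := fun p : ((S × S) × S) × S => (p.1.1.2, p.1.2)) (by fun_prop)).mul
      (ha.comp (f := fun p : ((S × S) × S) × S => (p.1.2, p.1.1.1)) (by fun_prop))).mul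
    ((hc.comp (f := fun p : ((S × S) × S) × S => (p.1.1.1, p.2)) (by fun_prop)).mul
      (hb.comp (f := fun p : ((S × S) × S) × S => (p.2, p.1.1.2)) (by fun_prop)))
  have hm1 := hm.lintegral_prod_right' (ν := μ)
  -- The variable r is moved in front of t, then in front of s. In the order (r,s,t,r') the
  -- integrand is the tensor form of a and the transpose of b, up to the symmetry of the covariance.
  have e1 : ∀ s, ∫⁻ t, ∫⁻ r, ∫⁻ r', (absCov μ κ t r * a (r, s)) * (absCov μ κ s r' * b (r', t))
      ∂μ ∂μ ∂μ = ∫⁻ r, ∫⁻ t, ∫⁻ r', (absCov μ κ t r * a (r, s)) * (absCov μ κ s r' * b (r', t))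
      ∂μ ∂μ ∂μ := fun s => lintegral_lintegral_swap
        (hm1.comp (f := fun p : S × S => ((s, p.1), p.2)) (by fun_prop)).aemeasurable
  simp only [e1]
  have hm2 : Measurable fun p : S × S => ∫⁻ t, ∫⁻ r', (absCov μ κ t p.2 * a (p.2, p.1)) *
      (absCov μ κ p.1 r' * b (r', t)) ∂μ ∂μ :=
    (hm1.comp (f := fun p : (S × S) × S => ((p.1.1, p.2), p.1.2)) (by fun_prop)).lintegral_prod_right'
  rw [lintegral_lintegral_swap hm2.aemeasurable]
  refine lintegral_congr fun r => lintegral_congr fun s => lintegral_congr fun t =>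
    lintegral_congr fun r' => ?_
  rw [absCov_comm t r]
  simp only [Prod.swap_prod_mk]
  ring

end Tensor

/-! ### The differentiated kernel: measurability, support and integrability -/

section Kernel

variable {T : ℝ} {K : ℝ → ℝ → ℝ}

lemma dK_eq_zero {t s : ℝ} (h : ¬(0 < s ∧ s < t ∧ t < T)) : dK T K t s = 0 := if_neg h

/-- The absolute value of the differentiated kernel. -/
def absK (T : ℝ) (K : ℝ → ℝ → ℝ) (t s : ℝ) : ℝ≥0∞ := ‖dK T K t s‖ₑ

/-- The derivative is assumed continuous in t only, for each s. Joint measurability comes from the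
joint continuity of K: the derivative is a pointwise limit of forward difference quotients, each
continuous on the open set where the shifted point still satisfies t + δ < T. -/
lemma measurable_dK (hK : IsRegularVolterraKernel T K) :
    Measurable (Function.uncurry (dK T K)) := by
  classical
  let δ : ℕ → ℝ := fun n => 1 / ((n : ℝ) + 1)
  have hδ : ∀ n, 0 < δ n := fun n => Nat.one_div_pos_of_nat
  have hδ0 : Tendsto δ atTop (𝓝 0) := tendsto_one_div_add_atTop_nhds_zero_nat
  let D : ℕ → Set (ℝ × ℝ) := fun n => {p | 0 < p.2 ∧ p.2 < p.1 ∧ p.1 + δ n < T}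
  have hD : ∀ n, IsOpen (D n) := fun n =>
    (isOpen_lt continuous_const continuous_snd).inter ((isOpen_lt continuous_snd continuous_fst).inter
      (isOpen_lt (continuous_fst.add continuous_const) continuous_const))
  let F : ℕ → ℝ × ℝ → ℝ := fun n =>
    (D n).piecewise (fun p => (δ n)⁻¹ * (K (p.1 + δ n) p.2 - K p.1 p.2)) fun _ => 0
  have hF : ∀ n, Measurable (F n) := fun n => by
    refine ContinuousOn.measurable_piecewise ?_ continuousOn_const (hD n).measurableSet
    have c1 : ContinuousOn (fun p : ℝ × ℝ => K p.1 p.2) (D n) :=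
      hK.continuousOn.mono fun p hp => ⟨hp.1, hp.2.1.le, by linarith [hδ n, hp.2.2]⟩
    have c2 : ContinuousOn (fun p : ℝ × ℝ => K (p.1 + δ n) p.2) (D n) := by
      refine hK.continuousOn.comp (f := fun p : ℝ × ℝ => (p.1 + δ n, p.2)) (by fun_prop) fun p hp => ?_
      exact ⟨hp.1, by linarith [hδ n, hp.2.1], hp.2.2⟩
    exact continuousOn_const.mul (c2.sub c1)
  refine measurable_of_tendsto_metrizable hF (tendsto_pi_nhds.2 fun p => ?_)
  by_cases hp : 0 < p.2 ∧ p.2 < p.1 ∧ p.1 < T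
  · have hd : HasDerivAt (fun t => K t p.2) (dK T K p.1 p.2) p.1 := by
      rw [dK, if_pos hp]
      exact ((hK.differentiableOn p.2 ⟨hp.1, hp.2.1.trans hp.2.2⟩).differentiableAt
        (Ioo_mem_nhds hp.2.1 hp.2.2)).hasDerivAt
    have h1 : Tendsto δ atTop (𝓝[≠] 0) :=
      tendsto_nhdsWithin_iff.2 ⟨hδ0, Eventually.of_forall fun n => (hδ n).ne'⟩
    refine ((hasDerivAt_iff_tendsto_slope_zero.1 hd).comp h1).congr' ?_
    have h2 : ∀ᶠ n in atTop, δ n < T - p.1 := hδ0.eventually_lt_const (by linarith [hp.2.2])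
    filter_upwards [h2] with n hn
    have hm : p ∈ D n := ⟨hp.1, hp.2.1, by linarith⟩
    simp [F, hm]
  · rw [show Function.uncurry (dK T K) p = 0 from dK_eq_zero hp]
    refine tendsto_const_nhds.congr fun n => ?_
    have hm : p ∉ D n := fun hm => hp ⟨hm.1, hm.2.1, by linarith [hδ n, hm.2.2]⟩
    simp [F, hm]

lemma measurable_absK (hK : IsRegularVolterraKernel T K) :
    Measurable (Function.uncurry (absK T K)) :=
  (measurable_dK hK).enorm

lemma setLIntegral_eq_of_eq_zero {f : ℝ → ℝ≥0∞} {A B : Set ℝ} (hA : MeasurableSet A)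
    (hB : MeasurableSet B) (h1 : ∀ x ∈ A, x ∉ B → f x = 0) (h2 : ∀ x ∈ B, x ∉ A → f x = 0) :
    ∫⁻ x in A, f x = ∫⁻ x in B, f x := by
  rw [← lintegral_indicator hA, ← lintegral_indicator hB]
  refine lintegral_congr fun x => ?_
  by_cases hxA : x ∈ A <;> by_cases hxB : x ∈ B <;> simp [hxA, hxB]
  · exact h1 x hxA hxB
  · exact (h2 x hxB hxA).symm

lemma setIntegral_eq_of_eq_zero {f : ℝ → ℝ} {A B : Set ℝ} (hA : MeasurableSet A)
    (hB : MeasurableSet B) (h1 : ∀ x ∈ A, x ∉ B → f x = 0) (h2 : ∀ x ∈ B, x ∉ A → f x = 0) :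
    ∫ x in A, f x = ∫ x in B, f x := by
  rw [← integral_indicator hA, ← integral_indicator hB]
  refine integral_congr_ae (ae_of_all _ fun x => ?_)
  by_cases hxA : x ∈ A <;> by_cases hxB : x ∈ B <;> simp [hxA, hxB]
  · exact h1 x hxA hxB
  · exact (h2 x hxB hxA).symm

/-- Since `dK` vanishes unless 0 < s < t < T, variable integration limits can be replaced by [0,T].
The same remark underlies `phi_eq`, `sqNormAbsH_eq` and `Kstar_eq`, and turns every object into an
integral against one fixed measure. -/
lemma phiAbs_eq (r s : ℝ) : phiAbs T K r s = absCov (lebesgue T) (absK T K) r s := by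
  refine setLIntegral_eq_of_eq_zero measurableSet_Ioc measurableSet_Icc (fun x hx hx' => ?_)
    fun x hx hx' => ?_
  · rw [dK_eq_zero (t := r), enorm_zero, zero_mul]
    exact fun h => hx' ⟨h.1.le, by linarith⟩
  · by_cases h1 : 0 < x ∧ x < r ∧ r < T
    · rw [dK_eq_zero (t := s), enorm_zero, mul_zero]
      exact fun h => hx' ⟨h.1, le_min h1.2.1.le h.2.1.le⟩
    · rw [dK_eq_zero h1, enorm_zero, zero_mul]

lemma phi_eq (r s : ℝ) : phi T K r s = ∫ t, dK T K r t * dK T K s t ∂(lebesgue T) := by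
  refine setIntegral_eq_of_eq_zero measurableSet_Ioc measurableSet_Icc (fun x hx hx' => ?_)
    fun x hx hx' => ?_
  · rw [dK_eq_zero (t := r), zero_mul]
    exact fun h => hx' ⟨h.1.le, by linarith⟩
  · by_cases h1 : 0 < x ∧ x < r ∧ r < T
    · rw [dK_eq_zero (t := s), mul_zero]
      exact fun h => hx' ⟨h.1, le_min h1.2.1.le h.2.1.le⟩
    · rw [dK_eq_zero h1, zero_mul]

lemma enorm_phi_le (r s : ℝ) : ‖phi T K r s‖ₑ ≤ absCov (lebesgue T) (absK T K) r s := by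
  rw [phi_eq]
  refine (enorm_integral_le_lintegral_enorm _).trans (le_of_eq ?_)
  simp only [enorm_mul]
  rfl

lemma measurable_phi (hK : IsRegularVolterraKernel T K) :
    Measurable (Function.uncurry (phi T K)) := by
  have h := measurable_dK hK
  have e : Function.uncurry (phi T K) =
      fun p : ℝ × ℝ => ∫ t, dK T K p.1 t * dK T K p.2 t ∂(lebesgue T) := by
    ext p
    exact phi_eq p.1 p.2
  rw [e]
  refine (StronglyMeasurable.integral_prod_right
    (f := fun (p : ℝ × ℝ) t => dK T K p.1 t * dK T K p.2 t) ?_).measurable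
  refine Measurable.stronglyMeasurable ?_
  exact (h.comp (f := fun p : (ℝ × ℝ) × ℝ => (p.1.1, p.2)) (by fun_prop)).mul
    (h.comp (f := fun p : (ℝ × ℝ) × ℝ => (p.1.2, p.2)) (by fun_prop))

lemma sqNormAbsH_eq (σ : ℝ → ℝ) :
    sqNormAbsH T K σ = energy (lebesgue T) (lebesgue T) (absK T K) fun r => ‖σ r‖ₑ := by
  unfold sqNormAbsH energy smear
  refine setLIntegral_congr_fun measurableSet_Icc fun t ht => ?_
  simp only
  congr 1
  refine setLIntegral_eq_of_eq_zero measurableSet_Ioc measurableSet_Icc (fun x hx hx' => ?_)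
    fun x hx hx' => ?_
  · rw [dK_eq_zero, enorm_zero, mul_zero]
    exact fun h => hx' ⟨by linarith, hx.2⟩
  · rw [dK_eq_zero, enorm_zero, mul_zero]
    exact fun h => hx' ⟨h.2.1, hx.2⟩

lemma sqNormAbsHH_eq (hK : IsRegularVolterraKernel T K) {a : ℝ → ℝ → ℝ}
    (ha : Measurable (Function.uncurry a)) :
    sqNormAbsHH T K a = tensorEnergy (lebesgue T) (absK T K) fun z => ‖a z.1 z.2‖ₑ := by
  have := lintegral_tensor_form (μ := lebesgue T) (measurable_absK hK)
    (a := fun z => ‖a z.1 z.2‖ₑ) (b := fun z => ‖a z.1 z.2‖ₑ) ha.enorm ha.enorm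
  unfold sqNormAbsHH tensorEnergy energy
  simp only [phiAbs_eq, pow_two]
  exact this

lemma Kstar_eq (σ : ℝ → ℝ) (u : ℝ) : Kstar T K σ u = ∫ s, σ s * dK T K s u ∂(lebesgue T) := by
  -- For u < 0 the interval (u,T] leaves [0,T], but for every u ≤ 0 the kernel vanishes identically.
  by_cases hu : 0 < u
  · refine setIntegral_eq_of_eq_zero measurableSet_Ioc measurableSet_Icc (fun x hx hx' => ?_)
      fun x hx hx' => ?_
    · exact (hx' ⟨by linarith [hx.1], hx.2⟩).elim
    · rw [dK_eq_zero, mul_zero]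
      exact fun h => hx' ⟨h.2.1, hx.2⟩
  · have : ∀ s, dK T K s u = 0 := fun s => dK_eq_zero fun h => hu h.1
    simp [Kstar, this]

lemma enorm_Kstar_le (σ : ℝ → ℝ) (u : ℝ) :
    ‖Kstar T K σ u‖ₑ ≤ smear (lebesgue T) (absK T K) (fun r => ‖σ r‖ₑ) u := by
  rw [Kstar_eq]
  refine (enorm_integral_le_lintegral_enorm _).trans (le_of_eq ?_)
  simp only [enorm_mul]
  rfl

lemma measurable_Kstar (hK : IsRegularVolterraKernel T K) {Ω : Type*} [MeasurableSpace Ω]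
    {f : Ω → ℝ → ℝ} (hf : Measurable (Function.uncurry f)) :
    Measurable fun p : Ω × ℝ => Kstar T K (f p.1) p.2 := by
  have h := measurable_dK hK
  simp only [Kstar_eq]
  refine (StronglyMeasurable.integral_prod_right
    (f := fun (p : Ω × ℝ) s => f p.1 s * dK T K s p.2) ?_).measurable
  refine Measurable.stronglyMeasurable ?_
  exact (hf.comp (f := fun p : (Ω × ℝ) × ℝ => (p.1.1, p.2)) (by fun_prop)).mul
    (h.comp (f := fun p : (Ω × ℝ) × ℝ => (p.2, p.1.2)) (by fun_prop))

lemma lintegral_Ioo_rpow_lt_top {p : ℝ} (hp : -1 < p) (T : ℝ) :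
    ∫⁻ x in Ioo 0 T, ENNReal.ofReal (x ^ p) < ∞ := by
  rcases le_or_gt T 0 with h | h
  · simp [Ioo_eq_empty (not_lt.2 h)]
  · exact ((intervalIntegral.integrableOn_Ioo_rpow_iff h).2 hp).lintegral_lt_top

/-- In c ∫_u^T (s-u)^(α-1) (s/u)^β ds bound s^β by T^β and extend the remaining integral to (0,T),
where it converges because α > 0. -/
lemma smear_one_le (hK : IsRegularVolterraKernel T K) : ∃ (C : ℝ≥0∞) (β : ℝ), C ≠ ∞ ∧ β < 1 / 2 ∧
    ∀ u, smear (lebesgue T) (absK T K) (fun _ => 1) u ≤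
      C * (Ioo 0 T).indicator (fun u => ENNReal.ofReal (u ^ (-β))) u := by
  obtain ⟨α, β, c, hα, hα', hβ, hβ', hc, hb⟩ := hK.deriv_bound
  set A : ℝ≥0∞ := ∫⁻ x in Ioo 0 T, ENNReal.ofReal (x ^ (α - 1)) with hA
  have hAf : A < ∞ := lintegral_Ioo_rpow_lt_top (by linarith) T
  refine ⟨ENNReal.ofReal (c * T ^ β) * A, β, ENNReal.mul_ne_top ENNReal.ofReal_ne_top hAf.ne, hβ',
    fun u => ?_⟩
  have hsm : smear (lebesgue T) (absK T K) (fun _ => 1) u = ∫⁻ s in Ioo u T, absK T K s u := by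
    simp only [smear, one_mul]
    refine setLIntegral_eq_of_eq_zero measurableSet_Icc measurableSet_Ioo (fun x hx hx' => ?_)
      fun x hx hx' => ?_
    · rw [absK, dK_eq_zero, enorm_zero]
      exact fun h => hx' ⟨h.2.1, h.2.2⟩
    · rw [absK, dK_eq_zero, enorm_zero]
      exact fun h => hx' ⟨by linarith, hx.2.le⟩
  by_cases hu : u ∈ Ioo 0 T
  · rw [hsm, indicator_of_mem hu]
    have hT : 0 < T := hu.1.trans hu.2
    have h1 : ∀ s ∈ Ioo u T, absK T K s u ≤
        ENNReal.ofReal (c * T ^ β * u ^ (-β)) *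
          ((Ioo 0 T).indicator (fun x => ENNReal.ofReal (x ^ (α - 1))) (s - u)) := fun s hs => by
      have hm : s - u ∈ Ioo 0 T := ⟨by linarith [hs.1], by linarith [hs.2, hu.1]⟩
      rw [indicator_of_mem hm, ← ENNReal.ofReal_mul (by
        have := hu.1
        positivity), absK, Real.enorm_eq_ofReal_abs, dK, if_pos ⟨hu.1, hs.1, hs.2⟩]
      refine ENNReal.ofReal_le_ofReal ((hb u s hu.1 hs.1 hs.2).trans ?_)
      have hs0 : 0 < s := hu.1.trans hs.1
      rw [Real.div_rpow hs0.le hu.1.le, Real.rpow_neg hu.1.le]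
      have h2 : s ^ β ≤ T ^ β := Real.rpow_le_rpow hs0.le hs.2.le hβ.le
      have h3 : 0 < u ^ β := Real.rpow_pos_of_pos hu.1 _
      have h4 : 0 ≤ (s - u) ^ (α - 1) := Real.rpow_nonneg hm.1.le _
      calc c * (s - u) ^ (α - 1) * (s ^ β / u ^ β) = c * (s ^ β) * (u ^ β)⁻¹ * (s - u) ^ (α - 1) := by
            ring
        _ ≤ _ := by gcongr
    refine (setLIntegral_mono' measurableSet_Ioo h1).trans ?_
    refine (setLIntegral_le_lintegral _ _).trans ?_
    rw [lintegral_const_mul' _ _ ENNReal.ofReal_ne_top,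
      lintegral_sub_right_eq_self (fun x => (Ioo 0 T).indicator
        (fun x => ENNReal.ofReal (x ^ (α - 1))) x) u, lintegral_indicator measurableSet_Ioo,
      ENNReal.ofReal_mul (by positivity), ← hA]
    exact le_of_eq (by ring)
  · rw [indicator_of_notMem hu, mul_zero, hsm]
    refine le_of_eq (setLIntegral_eq_zero measurableSet_Ioo fun s hs => ?_)
    rw [absK, dK_eq_zero, enorm_zero]
    · rfl
    · exact fun h => hu ⟨h.1, by linarith [hs.1, hs.2]⟩

/-- Here β < 1/2 enters: u^(-2β) is integrable at 0. Consequently all step functions have finite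
|𝓗|-norm. -/
lemma energy_one_lt_top (hK : IsRegularVolterraKernel T K) :
    energy (lebesgue T) (lebesgue T) (absK T K) (fun _ => 1) < ∞ := by
  obtain ⟨C, β, hC, hβ, h⟩ := smear_one_le hK
  have h1 : ∀ u, smear (lebesgue T) (absK T K) (fun _ => 1) u ^ 2 ≤
      C ^ 2 * (Ioo 0 T).indicator (fun u => ENNReal.ofReal (u ^ (-2 * β))) u := fun u => by
    refine (pow_le_pow_left' (h u) 2).trans ?_
    rw [mul_pow]
    gcongr
    by_cases hu : u ∈ Ioo 0 T
    · rw [indicator_of_mem hu, indicator_of_mem hu, ← ENNReal.ofReal_pow (Real.rpow_nonneg hu.1.le _),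
        ← Real.rpow_natCast, ← Real.rpow_mul hu.1.le]
      refine le_of_eq ?_
      congr 2
      push_cast
      ring
    · simp [indicator_of_notMem hu]
  unfold energy
  refine (lintegral_mono h1).trans_lt ?_
  rw [lintegral_const_mul' _ _ (ENNReal.pow_ne_top hC)]
  refine ENNReal.mul_lt_top (ENNReal.pow_lt_top hC.lt_top) ?_
  refine (setLIntegral_le_lintegral _ _).trans_lt ?_
  rw [lintegral_indicator measurableSet_Ioo]
  exact lintegral_Ioo_rpow_lt_top (by linarith) T

end Kernel

/-! ### Functions of finite |𝓗|-norm and their images in 𝓗 -/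

section Kernel

variable {T : ℝ} {K : ℝ → ℝ → ℝ}

lemma sqNormAbsH_add_le (hK : IsRegularVolterraKernel T K) {σ τ : ℝ → ℝ} (hσ : Measurable σ)
    (hτ : Measurable τ) :
    sqNormAbsH T K (σ + τ) ≤ 2 * sqNormAbsH T K σ + 2 * sqNormAbsH T K τ := by
  simp only [sqNormAbsH_eq]
  exact energy_le_add (measurable_absK hK) hσ.enorm hτ.enorm fun z => enorm_add_le _ _

lemma sqNormAbsH_neg (σ : ℝ → ℝ) : sqNormAbsH T K (-σ) = sqNormAbsH T K σ := by
  simp only [sqNormAbsH_eq, Pi.neg_apply, enorm_neg]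

lemma sqNormAbsH_sub_le (hK : IsRegularVolterraKernel T K) {σ τ : ℝ → ℝ} (hσ : Measurable σ)
    (hτ : Measurable τ) :
    sqNormAbsH T K (σ - τ) ≤ 2 * sqNormAbsH T K σ + 2 * sqNormAbsH T K τ := by
  rw [sub_eq_add_neg, ← sqNormAbsH_neg τ]
  exact sqNormAbsH_add_le hK hσ hτ.neg

/-- The measurable functions with finite `|𝓗|`-norm. -/
def finiteEnergy (hK : IsRegularVolterraKernel T K) : Submodule ℝ (ℝ → ℝ) where
  carrier := {σ | Measurable σ ∧ sqNormAbsH T K σ < ∞}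
  zero_mem' := ⟨measurable_const, by simp [sqNormAbsH_eq, energy, smear]⟩
  add_mem' {σ τ} hσ hτ := ⟨hσ.1.add hτ.1, (sqNormAbsH_add_le hK hσ.1 hτ.1).trans_lt
    (ENNReal.add_lt_top.2 ⟨ENNReal.mul_lt_top (by simp) hσ.2, ENNReal.mul_lt_top (by simp) hτ.2⟩)⟩
  smul_mem' c σ hσ := ⟨hσ.1.const_smul c, by
    have h := hσ.2
    rw [sqNormAbsH_eq] at h ⊢
    simp only [Pi.smul_apply, smul_eq_mul, enorm_mul]
    rw [energy_const_mul (measurable_absK hK) hσ.1.enorm]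
    exact ENNReal.mul_lt_top (by simp) h⟩

lemma indicatorUpTo_mem (hK : IsRegularVolterraKernel T K) (t : ℝ) :
    indicatorUpTo t ∈ finiteEnergy hK := by
  refine ⟨measurable_const.indicator measurableSet_Icc, ?_⟩
  rw [sqNormAbsH_eq]
  refine (energy_mono fun z => ?_).trans_lt (energy_one_lt_top hK)
  unfold indicatorUpTo
  by_cases hz : z ∈ Icc 0 t <;> simp [hz]

lemma stepFunctions_le (hK : IsRegularVolterraKernel T K) : stepFunctions T ≤ finiteEnergy hK :=
  Submodule.span_le.2 (by rintro _ ⟨t, -, rfl⟩; exact indicatorUpTo_mem hK t)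

/-- Such a function lies within distance one of a step function, which has finite norm. -/
lemma MemAbsH.mem_finiteEnergy (hK : IsRegularVolterraKernel T K) {σ : ℝ → ℝ}
    (hσ : MemAbsH T K σ) : σ ∈ finiteEnergy hK := by
  obtain ⟨e, he, h⟩ := hσ.2 1 one_pos
  have he' := stepFunctions_le hK he
  have : σ - e ∈ finiteEnergy hK := ⟨hσ.1.sub he'.1, h.trans ENNReal.one_lt_top⟩
  simpa using (finiteEnergy hK).add_mem this he'

lemma eLpNorm_two_sq {α E : Type*} [MeasurableSpace α] {μ : Measure α} [NormedAddCommGroup E]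
    (f : α → E) : eLpNorm f 2 μ ^ 2 = ∫⁻ x, ‖f x‖ₑ ^ 2 ∂μ := by
  have := eLpNorm_nnreal_pow_eq_lintegral (f := f) (μ := μ) (p := 2) (by norm_num)
  simpa using this

lemma enorm_sq_Lp {α E : Type*} [MeasurableSpace α] {μ : Measure α} [NormedAddCommGroup E]
    (f : Lp E 2 μ) : ‖f‖ₑ ^ 2 = ∫⁻ x, ‖f x‖ₑ ^ 2 ∂μ := by
  rw [Lp.enorm_def, eLpNorm_two_sq]

lemma lintegral_enorm_Kstar_sq_le (σ : ℝ → ℝ) :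
    ∫⁻ u, ‖Kstar T K σ u‖ₑ ^ 2 ∂(lebesgue T) ≤ sqNormAbsH T K σ := by
  rw [sqNormAbsH_eq]
  exact lintegral_mono fun u => pow_le_pow_left' (enorm_Kstar_le σ u) 2

lemma memLp_Kstar (hK : IsRegularVolterraKernel T K) {σ : ℝ → ℝ} (hσ : σ ∈ finiteEnergy hK) :
    MemLp (Kstar T K σ) 2 (lebesgue T) := by
  have hm : Measurable (Kstar T K σ) :=
    (measurable_Kstar hK (Ω := Unit) (f := fun _ => σ) (hσ.1.comp measurable_snd)).comp
      (measurable_const (a := ()) |>.prodMk measurable_id)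
  refine ⟨hm.aestronglyMeasurable, ?_⟩
  have h := (lintegral_enorm_Kstar_sq_le (T := T) (K := K) σ).trans_lt hσ.2
  rw [← eLpNorm_two_sq] at h
  by_contra hc
  rw [not_lt, top_le_iff] at hc
  simp [hc] at h

lemma coe_KstarL2 (hK : IsRegularVolterraKernel T K) {σ : ℝ → ℝ} (hσ : σ ∈ finiteEnergy hK) :
    KstarL2 T K σ =ᵐ[lebesgue T] Kstar T K σ := by
  rw [KstarL2, dif_pos (memLp_Kstar hK hσ)]
  exact MemLp.coeFn_toLp _

lemma enorm_KstarL2_sq_le (hK : IsRegularVolterraKernel T K) {σ : ℝ → ℝ}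
    (hσ : σ ∈ finiteEnergy hK) : ‖KstarL2 T K σ‖ₑ ^ 2 ≤ sqNormAbsH T K σ := by
  rw [enorm_sq_Lp]
  refine (lintegral_congr_ae ?_).trans_le (lintegral_enorm_Kstar_sq_le σ)
  filter_upwards [coe_KstarL2 hK hσ] with u hu
  rw [hu]

lemma ae_integrable_mul_dK (hK : IsRegularVolterraKernel T K) {σ : ℝ → ℝ}
    (hσ : σ ∈ finiteEnergy hK) :
    ∀ᵐ u ∂(lebesgue T), Integrable (fun s => σ s * dK T K s u) (lebesgue T) := by
  have h := hσ.2
  rw [sqNormAbsH_eq] at h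
  have hm := measurable_smear (ν := lebesgue T) (measurable_absK hK) hσ.1.enorm
  filter_upwards [ae_lt_top (hm.pow_const 2) h.ne] with u hu
  refine ⟨(hσ.1.mul ((measurable_dK hK).comp
    (f := fun s => (s, u)) (by fun_prop))).aestronglyMeasurable, ?_⟩
  have h2 : smear (lebesgue T) (absK T K) (fun r => ‖σ r‖ₑ) u < ∞ := by
    by_contra hc
    rw [not_lt, top_le_iff] at hc
    simp [hc] at hu
  unfold HasFiniteIntegral
  simp only [enorm_mul]
  exact h2

lemma KstarL2_add (hK : IsRegularVolterraKernel T K) {σ τ : ℝ → ℝ} (hσ : σ ∈ finiteEnergy hK)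
    (hτ : τ ∈ finiteEnergy hK) : KstarL2 T K (σ + τ) = KstarL2 T K σ + KstarL2 T K τ := by
  refine Lp.ext ?_
  filter_upwards [coe_KstarL2 hK hσ, coe_KstarL2 hK hτ,
    coe_KstarL2 hK ((finiteEnergy hK).add_mem hσ hτ), Lp.coeFn_add (KstarL2 T K σ) (KstarL2 T K τ),
    ae_integrable_mul_dK hK hσ, ae_integrable_mul_dK hK hτ] with u h1 h2 h3 h4 h5 h6
  rw [h4, h3, Pi.add_apply, h1, h2]
  simp only [Kstar_eq, Pi.add_apply, add_mul]
  exact integral_add h5 h6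

lemma KstarL2_smul (hK : IsRegularVolterraKernel T K) (c : ℝ) {σ : ℝ → ℝ}
    (hσ : σ ∈ finiteEnergy hK) : KstarL2 T K (c • σ) = c • KstarL2 T K σ := by
  refine Lp.ext ?_
  filter_upwards [coe_KstarL2 hK hσ, coe_KstarL2 hK ((finiteEnergy hK).smul_mem c hσ),
    Lp.coeFn_smul c (KstarL2 T K σ)] with u h1 h2 h3
  rw [h2, h3, Pi.smul_apply, h1]
  simp only [Kstar_eq, Pi.smul_apply, smul_eq_mul, mul_assoc]
  exact integral_const_mul _ _

/-- `K_T^*` as a linear map on the functions with finite `|𝓗|`-norm. -/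
def KstarLin (hK : IsRegularVolterraKernel T K) : finiteEnergy hK →ₗ[ℝ] L2 T where
  toFun σ := KstarL2 T K σ
  map_add' σ τ := KstarL2_add hK σ.2 τ.2
  map_smul' c σ := KstarL2_smul hK c σ.2

lemma KstarL2_sub (hK : IsRegularVolterraKernel T K) {σ τ : ℝ → ℝ} (hσ : σ ∈ finiteEnergy hK)
    (hτ : τ ∈ finiteEnergy hK) : KstarL2 T K (σ - τ) = KstarL2 T K σ - KstarL2 T K τ :=
  (KstarLin hK).map_sub ⟨σ, hσ⟩ ⟨τ, hτ⟩

lemma sum_mul_mem_finiteEnergy (hK : IsRegularVolterraKernel T K) {ι : Type*} [Fintype ι]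
    (c : ι → ℝ) {σ : ι → ℝ → ℝ} (hσ : ∀ i, σ i ∈ finiteEnergy hK) :
    (fun s => ∑ i, c i * σ i s) ∈ finiteEnergy hK := by
  have : (fun s => ∑ i, c i * σ i s) = ∑ i, c i • σ i := by ext s; simp
  rw [this]
  exact Submodule.sum_mem _ fun i _ => (finiteEnergy hK).smul_mem _ (hσ i)

lemma KstarL2_sum_mul (hK : IsRegularVolterraKernel T K) {ι : Type*} [Fintype ι]
    (c : ι → ℝ) {σ : ι → ℝ → ℝ} (hσ : ∀ i, σ i ∈ finiteEnergy hK) :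
    KstarL2 T K (fun s => ∑ i, c i * σ i s) = ∑ i, c i • KstarL2 T K (σ i) := by
  have h := map_sum (KstarLin hK) (fun i => c i • (⟨σ i, hσ i⟩ : finiteEnergy hK)) Finset.univ
  have e : ((∑ i, c i • (⟨σ i, hσ i⟩ : finiteEnergy hK) : finiteEnergy hK) : ℝ → ℝ) =
      fun s => ∑ i, c i * σ i s := by
    ext s
    simp
  rw [← e]
  refine h.trans (Finset.sum_congr rfl fun i _ => ?_)
  rw [map_smul]
  rfl

lemma KstarL2_mem_HSpace_of_step (hK : IsRegularVolterraKernel T K) {e : ℝ → ℝ}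
    (he : e ∈ stepFunctions T) : KstarL2 T K e ∈ HSpace T K := by
  unfold stepFunctions at he
  induction he using Submodule.span_induction with
  | zero =>
    have := KstarL2_smul hK 0 (finiteEnergy hK).zero_mem
    simp only [smul_zero, zero_smul] at this
    rw [this]
    exact Submodule.zero_mem _
  | add x y hx hy h1 h2 =>
    rw [KstarL2_add hK (stepFunctions_le hK hx) (stepFunctions_le hK hy)]
    exact Submodule.add_mem _ h1 h2
  | smul c x hx h1 =>
    rw [KstarL2_smul hK c (stepFunctions_le hK hx)]
    exact Submodule.smul_mem _ c h1
  | mem x hx =>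
    obtain ⟨t, ht, rfl⟩ := hx
    exact Submodule.le_topologicalClosure _ (Submodule.subset_span ⟨t, ht, rfl⟩)

/-- K_T^* is a contraction from the |𝓗|-semi-norm to L² and maps step functions into the closed
subspace 𝓗. -/
lemma MemAbsH.KstarL2_mem (hK : IsRegularVolterraKernel T K) {σ : ℝ → ℝ} (hσ : MemAbsH T K σ) :
    KstarL2 T K σ ∈ HSpace T K := by
  have hcl : IsClosed (HSpace T K : Set (L2 T)) := Submodule.isClosed_topologicalClosure _
  rw [← SetLike.mem_coe, ← hcl.closure_eq, EMetric.mem_closure_iff]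
  intro ε hε
  -- The tolerance is ε² because `MemAbsH` is expressed with the squared semi-norm.
  obtain ⟨e, he, h⟩ := hσ.2 (ε ^ 2) (by positivity)
  refine ⟨_, KstarL2_mem_HSpace_of_step hK he, ?_⟩
  have hσ' := hσ.mem_finiteEnergy hK
  have he' := stepFunctions_le hK he
  rw [edist_eq_enorm_sub, ← KstarL2_sub hK hσ' he']
  have := (enorm_KstarL2_sq_le hK ((finiteEnergy hK).sub_mem hσ' he')).trans_lt h
  exact lt_of_not_ge fun h => (pow_le_pow_left' h 2).not_gt this

/-- An element of `|𝓗|` viewed in `𝓗`. -/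
def toH (hK : IsRegularVolterraKernel T K) (σ : ℝ → ℝ) (hσ : MemAbsH T K σ) : HSpace T K :=
  ⟨KstarL2 T K σ, hσ.KstarL2_mem hK⟩

/-- The scalar product of `𝓗` on functions, as an absolutely convergent double integral. -/
lemma integrable_phi_mul_and_inner (hK : IsRegularVolterraKernel T K) {σ τ : ℝ → ℝ}
    (hσ : σ ∈ finiteEnergy hK) (hτ : τ ∈ finiteEnergy hK) :
    Integrable (fun p : ℝ × ℝ => phi T K p.1 p.2 * σ p.2 * τ p.1)
      ((lebesgue T).prod (lebesgue T)) ∧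
    ∫ p : ℝ × ℝ, phi T K p.1 p.2 * σ p.2 * τ p.1 ∂((lebesgue T).prod (lebesgue T)) =
      inner ℝ (KstarL2 T K σ) (KstarL2 T K τ) := by
  have hk := measurable_dK hK
  set μ := lebesgue T
  -- The integral defining φ is undone. Integrating G first over its last variable gives the φ-form,
  -- first over the pair gives K_T^*τ · K_T^*σ; Cauchy–Schwarz for the images of |σ| and |τ|
  -- justifies Fubini.
  let G : (ℝ × ℝ) × ℝ → ℝ := fun q =>
    (τ q.1.1 * dK T K q.1.1 q.2) * (σ q.1.2 * dK T K q.1.2 q.2)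
  have hGm : Measurable G :=
    ((hτ.1.comp (f := fun q : (ℝ × ℝ) × ℝ => q.1.1) (by fun_prop)).mul
      (hk.comp (f := fun q : (ℝ × ℝ) × ℝ => (q.1.1, q.2)) (by fun_prop))).mul
    ((hσ.1.comp (f := fun q : (ℝ × ℝ) × ℝ => q.1.2) (by fun_prop)).mul
      (hk.comp (f := fun q : (ℝ × ℝ) × ℝ => (q.1.2, q.2)) (by fun_prop)))
  have hκr : ∀ u, Measurable fun s => absK T K s u := fun u =>
    (measurable_absK hK).comp (f := fun s => (s, u)) (by fun_prop)
  have hGi : Integrable G ((μ.prod μ).prod μ) := by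
    refine ⟨hGm.aestronglyMeasurable, ?_⟩
    unfold HasFiniteIntegral
    rw [lintegral_prod_symm _ hGm.enorm.aemeasurable]
    have e : ∀ u, ∫⁻ p : ℝ × ℝ, ‖G (p, u)‖ₑ ∂(μ.prod μ) =
        smear μ (absK T K) (fun r => ‖τ r‖ₑ) u * smear μ (absK T K) (fun r => ‖σ r‖ₑ) u := by
      intro u
      unfold smear
      rw [← lintegral_prod_mul (hτ.1.enorm.fun_mul (hκr u)).aemeasurable
        (hσ.1.enorm.fun_mul (hκr u)).aemeasurable]
      exact lintegral_congr fun p => by simp only [G, enorm_mul, absK]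
    simp only [e]
    refine (lintegral_mul_le_sqrt (measurable_smear (measurable_absK hK) hτ.1.enorm).aemeasurable
      (measurable_smear (measurable_absK hK) hσ.1.enorm).aemeasurable).trans_lt ?_
    have h1 := hσ.2
    have h2 := hτ.2
    rw [sqNormAbsH_eq] at h1 h2
    exact ENNReal.mul_lt_top (ENNReal.rpow_lt_top_of_nonneg (by norm_num) h2.ne)
      (ENNReal.rpow_lt_top_of_nonneg (by norm_num) h1.ne)
  have e1 : ∀ p : ℝ × ℝ, ∫ u, G (p, u) ∂μ = phi T K p.1 p.2 * σ p.2 * τ p.1 := fun p => by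
    rw [phi_eq, mul_assoc, ← integral_mul_const]
    exact integral_congr_ae (ae_of_all _ fun u => by simp only [G]; ring)
  have e2 : ∀ u, ∫ p : ℝ × ℝ, G (p, u) ∂(μ.prod μ) = Kstar T K τ u * Kstar T K σ u := fun u => by
    rw [Kstar_eq, Kstar_eq, ← integral_prod_mul]
  refine ⟨hGi.integral_prod_left.congr (ae_of_all _ e1), ?_⟩
  simp only [← e1]
  rw [← integral_prod _ hGi, integral_prod_symm _ hGi, L2.inner_def]
  refine integral_congr_ae ?_
  filter_upwards [coe_KstarL2 hK hσ, coe_KstarL2 hK hτ] with u h1 h2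
  rw [e2, h1, h2]
  simp

end Kernel

/-! ### Elementary 𝓗-valued processes and their divergence -/

/-- Elementary smooth `H`-valued processes `∑ F_j h_j` with `F_j = f_j(X(φ_{j1}), …)`. -/
structure ElemProcess (H : Type*) where
  m : ℕ
  n : Fin m → ℕ
  f : ∀ j, (Fin (n j) → ℝ) → ℝ
  φ : ∀ j, Fin (n j) → H
  h : Fin m → H
  smooth : ∀ j, IsSmoothBounded (f j)

namespace ElemProcess

lemma measurable_sum_mul_sub {Ω ι : Type*} {_ : MeasurableSpace Ω} [Fintype ι] {a b c : ι → Ω → ℝ}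
    (ha : ∀ j, Measurable (a j)) (hb : ∀ j, Measurable (b j)) (hc : ∀ j, Measurable (c j)) :
    Measurable fun ω => ∑ j, (a j ω * b j ω - c j ω) :=
  Finset.measurable_fun_sum _ fun j _ => ((ha j).mul (hb j)).sub (hc j)

lemma integrable_mul_of_memLp {Ω : Type*} [MeasurableSpace Ω] {P : Measure Ω} {f g : Ω → ℝ}
    (hf : MemLp f 2 P) (hg : MemLp g 2 P) : Integrable (fun ω => f ω * g ω) P :=
  hf.integrable_mul hg

variable {Ω H : Type*} [MeasurableSpace Ω] {P : Measure Ω} [IsProbabilityMeasure P]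
  [NormedAddCommGroup H] [InnerProductSpace ℝ H] {X : H → Lp ℝ 2 P} (p q : ElemProcess H)

/-- The coefficient `F_j`. -/
def coef (X : H → Lp ℝ 2 P) (j : Fin p.m) (ω : Ω) : ℝ := p.f j fun i => X (p.φ j i) ω

/-- The directional derivative `⟨D F_j, k⟩`. -/
def dirDeriv (X : H → Lp ℝ 2 P) (j : Fin p.m) (k : H) (ω : Ω) : ℝ :=
  fderiv ℝ (p.f j) (fun i => X (p.φ j i) ω) fun i => inner ℝ (p.φ j i) k

/-- The process itself. -/
def val (X : H → Lp ℝ 2 P) (ω : Ω) : H := ∑ j, p.coef X j ω • p.h j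

/-- The divergence of the process. -/
def div (X : H → Lp ℝ 2 P) (ω : Ω) : ℝ :=
  ∑ j, (p.coef X j ω * X (p.h j) ω - p.dirDeriv X j (p.h j) ω)

lemma memLp_coef (j : Fin p.m) (r : ℝ≥0∞) : MemLp (p.coef X j) r P :=
  IsIsonormal.memLp_smooth X _ (p.smooth j) r

lemma memLp_dirDeriv (j : Fin p.m) (k : H) (r : ℝ≥0∞) : MemLp (p.dirDeriv X j k) r P :=
  IsIsonormal.memLp_smooth X _ ((p.smooth j).fderiv_apply _) r

lemma measurable_coef (j : Fin p.m) : Measurable (p.coef X j) :=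
  IsIsonormal.measurable_smooth X _ (p.smooth j)

lemma memLp_val : MemLp (p.val X) 2 P := by
  refine memLp_finsetSum _ fun j _ => ?_
  exact (memLp_const (p := 2) (p.h j)).smul (p.memLp_coef j ∞)

lemma memLp_coef_mul (j : Fin p.m) (k : H) : MemLp (fun ω => p.coef X j ω * X k ω) 2 P :=
  (Lp.memLp (X k)).mul (p.memLp_coef j ∞)

lemma memLp_div_term (j : Fin p.m) :
    MemLp (fun ω => p.coef X j ω * X (p.h j) ω - p.dirDeriv X j (p.h j) ω) 2 P :=
  (p.memLp_coef_mul j _).sub (p.memLp_dirDeriv j _ 2)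

lemma memLp_div : MemLp (p.div X) 2 P :=
  memLp_finsetSum _ fun j _ => p.memLp_div_term j

lemma measurable_sigma_coe (X : H → Lp ℝ 2 P) (h : H) : Measurable[IsIsonormal.sigma X] (X h) :=
  Measurable.mono (comap_measurable _) (le_iSup (fun h : H =>
    MeasurableSpace.comap (fun ω => X h ω) inferInstance) h) le_rfl

lemma measurable_sigma_smooth (X : H → Lp ℝ 2 P) {ι : Type*} [Fintype ι] (φ : ι → H)
    {f : (ι → ℝ) → ℝ} (hf : IsSmoothBounded f) :
    Measurable[IsIsonormal.sigma X] fun ω => f fun i => X (φ i) ω :=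
  hf.continuous.measurable.comp
    (@measurable_pi_lambda _ _ _ (IsIsonormal.sigma X) _ _ fun i => measurable_sigma_coe X (φ i))

lemma measurable_sigma_div : Measurable[IsIsonormal.sigma X] (p.div X) := by
  exact measurable_sum_mul_sub (fun j => measurable_sigma_smooth X (p.φ j) (p.smooth j))
    (fun j => measurable_sigma_coe X (p.h j))
    fun j => measurable_sigma_smooth X (p.φ j) ((p.smooth j).fderiv_apply _)

theorem duality (hX : IsIsonormal P X) {ι : Type*} [Fintype ι] (ψ : ι → H) {g : (ι → ℝ) → ℝ}
    (hg : IsSmoothBounded g) :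
    ∫ ω, (g fun i => X (ψ i) ω) * p.div X ω ∂P = ∫ ω, ∑ j, p.coef X j ω *
      (fderiv ℝ g (fun i => X (ψ i) ω) fun i => inner ℝ (ψ i) (p.h j)) ∂P := by
  have h1 := IsIsonormal.memLp_smooth X ψ hg 2
  simp only [div, Finset.mul_sum]
  rw [integral_finsetSum _ fun j _ => integrable_mul_of_memLp h1 (p.memLp_div_term j),
    integral_finsetSum]
  · exact Finset.sum_congr rfl fun j _ => hX.duality_single (p.φ j) ψ (p.h j) (p.smooth j) hg
  · exact fun j _ => integrable_mul_of_memLp (p.memLp_coef j 2)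
      (IsIsonormal.memLp_smooth X ψ (hg.fderiv_apply _) 2)

theorem covariance (hX : IsIsonormal P X) :
    ∫ ω, p.div X ω * q.div X ω ∂P = (∫ ω, inner ℝ (p.val X ω) (q.val X ω) ∂P) +
      ∑ j, ∑ l, ∫ ω, p.dirDeriv X j (q.h l) ω * q.dirDeriv X l (p.h j) ω ∂P := by
  have e1 : ∫ ω, p.div X ω * q.div X ω ∂P = ∑ j, ∑ l,
      ∫ ω, (p.coef X j ω * X (p.h j) ω - p.dirDeriv X j (p.h j) ω) *
        (q.coef X l ω * X (q.h l) ω - q.dirDeriv X l (q.h l) ω) ∂P := by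
    simp only [div, Finset.sum_mul_sum]
    have hi := fun j l =>
      integrable_mul_of_memLp (p.memLp_div_term (X := X) j) (q.memLp_div_term (X := X) l)
    rw [integral_finsetSum _ fun j _ => integrable_finsetSum _ fun l _ => hi j l]
    exact Finset.sum_congr rfl fun j _ => integral_finsetSum _ fun l _ => hi j l
  have e2 : ∫ ω, inner ℝ (p.val X ω) (q.val X ω) ∂P = ∑ j, ∑ l,
      inner ℝ (p.h j) (q.h l) * ∫ ω, p.coef X j ω * q.coef X l ω ∂P := by
    have : ∀ ω, inner ℝ (p.val X ω) (q.val X ω) = ∑ j, ∑ l,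
        inner ℝ (p.h j) (q.h l) * (p.coef X j ω * q.coef X l ω) := fun ω => by
      simp only [val, sum_inner, inner_sum]
      rw [Finset.sum_comm]
      simp only [inner_smul_left, inner_smul_right, conj_trivial]
      exact Finset.sum_congr rfl fun j _ => Finset.sum_congr rfl fun l _ => by ring
    simp only [this]
    have hi := fun j l => (integrable_mul_of_memLp (p.memLp_coef (X := X) j 2)
      (q.memLp_coef (X := X) l 2)).const_mul (inner ℝ (p.h j) (q.h l))
    rw [integral_finsetSum _ fun j _ => integrable_finsetSum _ fun l _ => hi j l]
    refine Finset.sum_congr rfl fun j _ => ?_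
    rw [integral_finsetSum _ fun l _ => hi j l]
    exact Finset.sum_congr rfl fun l _ => integral_const_mul _ _
  rw [e1, e2, ← Finset.sum_add_distrib]
  refine Finset.sum_congr rfl fun j _ => ?_
  rw [← Finset.sum_add_distrib]
  exact Finset.sum_congr rfl fun l _ =>
    hX.covariance_single (p.φ j) (q.φ l) (p.h j) (q.h l) (p.smooth j) (q.smooth l)

end ElemProcess

lemma fderiv_eq_sum_partialDeriv {n : ℕ} (f : (Fin n → ℝ) → ℝ) (x a : Fin n → ℝ) :
    fderiv ℝ f x a = ∑ i, partialDeriv f i x * a i := by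
  conv_lhs => rw [← Finset.univ_sum_single a, map_sum]
  refine Finset.sum_congr rfl fun i _ => ?_
  have : (Pi.single i (a i) : Fin n → ℝ) = a i • Pi.single i 1 := by
    rw [← Pi.single_smul]; simp
  rw [this, map_smul, smul_eq_mul, mul_comm]
  rfl

/-! ### The trace term and its continuity -/

section Trace

variable {Ω : Type*} [MeasurableSpace Ω] {P : Measure Ω} [IsProbabilityMeasure P] {T : ℝ}
  {K : ℝ → ℝ → ℝ}

/-- Lebesgue measure on `[0,T]⁴`. -/
abbrev lebesgue4 (T : ℝ) : Measure (ℝ × ℝ × ℝ × ℝ) :=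
  (lebesgue T).prod ((lebesgue T).prod ((lebesgue T).prod (lebesgue T)))

/-- The integrand of the trace term, with `𝔻` written out. -/
def traceFun (T : ℝ) (K : ℝ → ℝ → ℝ) (A B : Ω → ℝ → ℝ → ℝ) (x : Ω × ℝ × ℝ × ℝ × ℝ) : ℝ :=
  (phi T K x.2.2.1 x.2.2.2.1 * A x.1 x.2.2.2.1 x.2.1) *
    (phi T K x.2.1 x.2.2.2.2 * B x.1 x.2.2.2.2 x.2.2.1)

lemma measurable_traceFun (hK : IsRegularVolterraKernel T K) {A B : Ω → ℝ → ℝ → ℝ}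
    (hA : Measurable fun p : Ω × ℝ × ℝ => A p.1 p.2.1 p.2.2)
    (hB : Measurable fun p : Ω × ℝ × ℝ => B p.1 p.2.1 p.2.2) : Measurable (traceFun T K A B) := by
  have hφ := measurable_phi hK
  exact ((hφ.comp (f := fun x : Ω × ℝ × ℝ × ℝ × ℝ => (x.2.2.1, x.2.2.2.1)) (by fun_prop)).mul
    (hA.comp (f := fun x : Ω × ℝ × ℝ × ℝ × ℝ => (x.1, x.2.2.2.1, x.2.1)) (by fun_prop))).mul
    ((hφ.comp (f := fun x : Ω × ℝ × ℝ × ℝ × ℝ => (x.2.1, x.2.2.2.2)) (by fun_prop)).mul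
    (hB.comp (f := fun x : Ω × ℝ × ℝ × ℝ × ℝ => (x.1, x.2.2.2.2, x.2.2.1)) (by fun_prop)))

lemma lintegral_lebesgue4 {f : ℝ × ℝ × ℝ × ℝ → ℝ≥0∞} (hf : Measurable f) :
    ∫⁻ y, f y ∂(lebesgue4 T) = ∫⁻ s, ∫⁻ t, ∫⁻ r, ∫⁻ r', f (s, t, r, r')
      ∂(lebesgue T) ∂(lebesgue T) ∂(lebesgue T) ∂(lebesgue T) := by
  rw [lintegral_prod _ hf.aemeasurable]
  refine lintegral_congr fun s => ?_
  rw [lintegral_prod _ (by fun_prop)]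
  refine lintegral_congr fun t => ?_
  rw [lintegral_prod _ (by fun_prop)]

lemma measurable_slice {A : Ω → ℝ → ℝ → ℝ}
    (hA : Measurable fun p : Ω × ℝ × ℝ => A p.1 p.2.1 p.2.2) (ω : Ω) :
    Measurable (Function.uncurry (A ω)) :=
  hA.comp (f := fun q : ℝ × ℝ => (ω, q)) (by fun_prop)

lemma measurable_sqNormAbsHH (hK : IsRegularVolterraKernel T K) {A : Ω → ℝ → ℝ → ℝ}
    (hA : Measurable fun p : Ω × ℝ × ℝ => A p.1 p.2.1 p.2.2) :
    Measurable fun ω => sqNormAbsHH T K (A ω) := by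
  simp only [fun ω => sqNormAbsHH_eq hK (measurable_slice hA ω)]
  exact measurable_energy (measurable_tensorKernel (measurable_absK hK)) hA.enorm

/-- The trace pairing is bounded by the product of the `L²(Ω; |𝓗| ⊗ |𝓗|)` norms. -/
lemma lintegral_enorm_traceFun_le (hK : IsRegularVolterraKernel T K) {A B : Ω → ℝ → ℝ → ℝ}
    (hA : Measurable fun p : Ω × ℝ × ℝ => A p.1 p.2.1 p.2.2)
    (hB : Measurable fun p : Ω × ℝ × ℝ => B p.1 p.2.1 p.2.2) :
    ∫⁻ x, ‖traceFun T K A B x‖ₑ ∂(P.prod (lebesgue4 T)) ≤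
      (∫⁻ ω, sqNormAbsHH T K (A ω) ∂P) ^ (1 / 2 : ℝ) *
        (∫⁻ ω, sqNormAbsHH T K (B ω) ∂P) ^ (1 / 2 : ℝ) := by
  have hm := (measurable_traceFun hK hA hB).enorm
  have hκ := measurable_absK hK
  rw [lintegral_prod _ hm.aemeasurable]
  have h1 : ∀ ω, ∫⁻ y, ‖traceFun T K A B (ω, y)‖ₑ ∂(lebesgue4 T) ≤
      ∫⁻ w, smear ((lebesgue T).prod (lebesgue T)) (tensorKernel (absK T K))
        (fun z => ‖A ω z.1 z.2‖ₑ) w * smear ((lebesgue T).prod (lebesgue T))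
          (tensorKernel (absK T K)) (fun z => ‖B ω z.2 z.1‖ₑ) w
          ∂((lebesgue T).prod (lebesgue T)) := by
    intro ω
    refine (lintegral_lebesgue4 (T := T) (f := fun y => ‖traceFun T K A B (ω, y)‖ₑ)
      (hm.comp (f := fun y => (ω, y)) (by fun_prop))).trans_le ?_
    refine le_trans ?_ (lintegral_trace hκ (a := fun z => ‖A ω z.1 z.2‖ₑ)
      (b := fun z => ‖B ω z.1 z.2‖ₑ) (measurable_slice hA ω).enorm
      (measurable_slice hB ω).enorm).le
    refine lintegral_mono fun s => lintegral_mono fun t => lintegral_mono fun r =>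
      lintegral_mono fun r' => ?_
    simp only [traceFun, enorm_mul]
    gcongr <;> exact enorm_phi_le _ _
  refine (lintegral_mono h1).trans ?_
  refine (lintegral_smear_mul_le (measurable_tensorKernel hκ) (a := fun ω z => ‖A ω z.1 z.2‖ₑ)
    (b := fun ω z => ‖B ω z.2 z.1‖ₑ) hA.enorm (hB.enorm.comp
    (f := fun p : Ω × ℝ × ℝ => (p.1, p.2.2, p.2.1)) (by fun_prop))).trans (le_of_eq ?_)
  congr 2
  · exact lintegral_congr fun ω => (sqNormAbsHH_eq hK (measurable_slice hA ω)).symm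
  · refine lintegral_congr fun ω => ?_
    -- The transposition carried by the second factor does not change its norm.
    rw [sqNormAbsHH_eq hK (measurable_slice hB ω), ← tensorEnergy_swap]
    rfl

/-- Random kernels in `L²(Ω; |𝓗| ⊗ |𝓗|)`. -/
def finiteTensorEnergy (P : Measure Ω) (hK : IsRegularVolterraKernel T K) :
    Submodule ℝ (Ω → ℝ → ℝ → ℝ) where
  carrier := {A | Measurable (fun p : Ω × ℝ × ℝ => A p.1 p.2.1 p.2.2) ∧
    ∫⁻ ω, sqNormAbsHH T K (A ω) ∂P < ∞}
  zero_mem' := ⟨measurable_const, by simp [sqNormAbsHH]⟩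
  add_mem' {A B} hA hB := by
    have hm : Measurable fun p : Ω × ℝ × ℝ => (A + B) p.1 p.2.1 p.2.2 := hA.1.add hB.1
    refine ⟨hm, ?_⟩
    have h : ∀ ω, sqNormAbsHH T K ((A + B) ω) ≤
        2 * sqNormAbsHH T K (A ω) + 2 * sqNormAbsHH T K (B ω) := fun ω => by
      rw [sqNormAbsHH_eq hK (measurable_slice hm ω), sqNormAbsHH_eq hK (measurable_slice hA.1 ω),
        sqNormAbsHH_eq hK (measurable_slice hB.1 ω)]
      exact energy_le_add (measurable_tensorKernel (measurable_absK hK))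
        (measurable_slice hA.1 ω).enorm (measurable_slice hB.1 ω).enorm fun z => enorm_add_le _ _
    refine (lintegral_mono h).trans_lt ?_
    rw [lintegral_add_left ((measurable_sqNormAbsHH hK hA.1).const_mul 2),
      lintegral_const_mul' _ _ (by simp), lintegral_const_mul' _ _ (by simp)]
    exact ENNReal.add_lt_top.2 ⟨ENNReal.mul_lt_top (by simp) hA.2,
      ENNReal.mul_lt_top (by simp) hB.2⟩
  smul_mem' c A hA := by
    have hm : Measurable fun p : Ω × ℝ × ℝ => (c • A) p.1 p.2.1 p.2.2 := hA.1.const_smul c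
    refine ⟨hm, ?_⟩
    have h : ∀ ω, sqNormAbsHH T K ((c • A) ω) = ‖c‖ₑ ^ 2 * sqNormAbsHH T K (A ω) := fun ω => by
      rw [sqNormAbsHH_eq hK (measurable_slice hm ω), sqNormAbsHH_eq hK (measurable_slice hA.1 ω)]
      simp only [Pi.smul_apply, smul_eq_mul, enorm_mul]
      exact energy_const_mul (measurable_tensorKernel (measurable_absK hK))
        (measurable_slice hA.1 ω).enorm _
    simp only [h]
    rw [lintegral_const_mul' _ _ (by simp)]
    exact ENNReal.mul_lt_top (by simp) hA.2

lemma integrable_traceFun (hK : IsRegularVolterraKernel T K) {A B : Ω → ℝ → ℝ → ℝ}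
    (hA : A ∈ finiteTensorEnergy P hK) (hB : B ∈ finiteTensorEnergy P hK) :
    Integrable (traceFun T K A B) (P.prod (lebesgue4 T)) :=
  ⟨(measurable_traceFun hK hA.1 hB.1).aestronglyMeasurable,
    (lintegral_enorm_traceFun_le hK hA.1 hB.1).trans_lt (ENNReal.mul_lt_top
      (ENNReal.rpow_lt_top_of_nonneg (by norm_num) hA.2.ne)
      (ENNReal.rpow_lt_top_of_nonneg (by norm_num) hB.2.ne))⟩

/-- The trace pairing `∫ E[𝔻_t A_s 𝔻_s B_t] ds dt`. -/
def tracePairing (T : ℝ) (K : ℝ → ℝ → ℝ) (P : Measure Ω) (A B : Ω → ℝ → ℝ → ℝ) : ℝ :=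
  ∫ x, traceFun T K A B x ∂(P.prod (lebesgue4 T))

lemma enorm_tracePairing_le (hK : IsRegularVolterraKernel T K) {A B : Ω → ℝ → ℝ → ℝ}
    (hA : A ∈ finiteTensorEnergy P hK) (hB : B ∈ finiteTensorEnergy P hK) :
    ‖tracePairing T K P A B‖ₑ ≤ (∫⁻ ω, sqNormAbsHH T K (A ω) ∂P) ^ (1 / 2 : ℝ) *
        (∫⁻ ω, sqNormAbsHH T K (B ω) ∂P) ^ (1 / 2 : ℝ) :=
  (enorm_integral_le_lintegral_enorm _).trans (lintegral_enorm_traceFun_le hK hA.1 hB.1)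

lemma tracePairing_sub_left (hK : IsRegularVolterraKernel T K) {A A' B : Ω → ℝ → ℝ → ℝ}
    (hA : A ∈ finiteTensorEnergy P hK) (hA' : A' ∈ finiteTensorEnergy P hK)
    (hB : B ∈ finiteTensorEnergy P hK) :
    tracePairing T K P (A - A') B = tracePairing T K P A B - tracePairing T K P A' B := by
  unfold tracePairing
  rw [← integral_sub (integrable_traceFun hK hA hB) (integrable_traceFun hK hA' hB)]
  refine integral_congr_ae (ae_of_all _ fun x => ?_)
  simp only [traceFun, Pi.sub_apply]
  ring

lemma tracePairing_sub_right (hK : IsRegularVolterraKernel T K) {A B B' : Ω → ℝ → ℝ → ℝ}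
    (hA : A ∈ finiteTensorEnergy P hK) (hB : B ∈ finiteTensorEnergy P hK)
    (hB' : B' ∈ finiteTensorEnergy P hK) :
    tracePairing T K P A (B - B') = tracePairing T K P A B - tracePairing T K P A B' := by
  unfold tracePairing
  rw [← integral_sub (integrable_traceFun hK hA hB) (integrable_traceFun hK hA hB')]
  refine integral_congr_ae (ae_of_all _ fun x => ?_)
  simp only [traceFun, Pi.sub_apply]
  ring

/-- The pairing is bilinear and bounded by the product of the norms, so the usual three-term
expansion of the difference tends to zero. -/
lemma tendsto_tracePairing (hK : IsRegularVolterraKernel T K) {A B : Ω → ℝ → ℝ → ℝ}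
    {A' B' : ℕ → Ω → ℝ → ℝ → ℝ} (hA : A ∈ finiteTensorEnergy P hK)
    (hB : B ∈ finiteTensorEnergy P hK) (hA' : ∀ n, A' n ∈ finiteTensorEnergy P hK)
    (hB' : ∀ n, B' n ∈ finiteTensorEnergy P hK)
    (h1 : Tendsto (fun n => ∫⁻ ω, sqNormAbsHH T K (A' n ω - A ω) ∂P) atTop (𝓝 0))
    (h2 : Tendsto (fun n => ∫⁻ ω, sqNormAbsHH T K (B' n ω - B ω) ∂P) atTop (𝓝 0)) :
    Tendsto (fun n => tracePairing T K P (A' n) (B' n)) atTop (𝓝 (tracePairing T K P A B)) := by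
  have hsqrt : ∀ {u : ℕ → ℝ≥0∞}, Tendsto u atTop (𝓝 0) →
      Tendsto (fun n => u n ^ (1 / 2 : ℝ)) atTop (𝓝 0) := fun {u} hu => by
    have := hu.ennrpow_const (1 / 2 : ℝ)
    rwa [ENNReal.zero_rpow_of_pos (by norm_num)] at this
  have e : ∀ n, tracePairing T K P (A' n) (B' n) - tracePairing T K P A B =
      tracePairing T K P (A' n - A) (B' n - B) + tracePairing T K P (A' n - A) B +
        tracePairing T K P A (B' n - B) := fun n => by
    rw [tracePairing_sub_left hK (hA' n) hA (Submodule.sub_mem _ (hB' n) hB),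
      tracePairing_sub_left hK (hA' n) hA hB, tracePairing_sub_right hK (hA' n) (hB' n) hB,
      tracePairing_sub_right hK hA (hB' n) hB]
    ring
  set a := fun n => (∫⁻ ω, sqNormAbsHH T K (A' n ω - A ω) ∂P) ^ (1 / 2 : ℝ)
  set b := fun n => (∫⁻ ω, sqNormAbsHH T K (B' n ω - B ω) ∂P) ^ (1 / 2 : ℝ)
  set cA := (∫⁻ ω, sqNormAbsHH T K (A ω) ∂P) ^ (1 / 2 : ℝ)
  set cB := (∫⁻ ω, sqNormAbsHH T K (B ω) ∂P) ^ (1 / 2 : ℝ)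
  have hcA : cA ≠ ∞ := (ENNReal.rpow_lt_top_of_nonneg (by norm_num) hA.2.ne).ne
  have hcB : cB ≠ ∞ := (ENNReal.rpow_lt_top_of_nonneg (by norm_num) hB.2.ne).ne
  have ha : Tendsto a atTop (𝓝 0) := hsqrt h1
  have hb : Tendsto b atTop (𝓝 0) := hsqrt h2
  rw [tendsto_iff_edist_tendsto_0]
  have hlim : Tendsto (fun n => a n * b n + a n * cB + cA * b n) atTop (𝓝 0) := by
    have t1 := ENNReal.Tendsto.mul ha (Or.inr ENNReal.zero_ne_top) hb (Or.inr ENNReal.zero_ne_top)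
    have t2 := ENNReal.Tendsto.mul_const ha (b := cB) (Or.inr hcB)
    have t3 := ENNReal.Tendsto.const_mul hb (a := cA) (Or.inr hcA)
    have := (t1.add t2).add t3
    simpa using this
  refine tendsto_of_tendsto_of_tendsto_of_le_of_le tendsto_const_nhds hlim (fun n => zero_le)
    fun n => ?_
  have hAs := Submodule.sub_mem _ (hA' n) hA
  have hBs := Submodule.sub_mem _ (hB' n) hB
  rw [edist_eq_enorm_sub, e]
  refine (enorm_add_le _ _).trans (add_le_add ((enorm_add_le _ _).trans (add_le_add ?_ ?_)) ?_)
  · exact enorm_tracePairing_le hK hAs hBs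
  · exact enorm_tracePairing_le hK hAs hB
  · exact enorm_tracePairing_le hK hA hBs

/-- Used to peel off s and then t while ω stays the last variable. -/
lemma integrable_prod_assoc_section {α β γ : Type*} [MeasurableSpace α] [MeasurableSpace β]
    [MeasurableSpace γ] {ν₁ : Measure α} {ν₂ : Measure β} {ν₃ : Measure γ} [SFinite ν₁]
    [SFinite ν₂] [SFinite ν₃] {F : (α × β) × γ → ℝ} (hF : Integrable F ((ν₁.prod ν₂).prod ν₃)) :
    ∀ᵐ x ∂ν₁, Integrable (fun q : β × γ => F ((x, q.1), q.2)) (ν₂.prod ν₃) := by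
  have h := (measurePreserving_prodAssoc ν₁ ν₂ ν₃).symm MeasurableEquiv.prodAssoc
  exact (h.integrable_comp_of_integrable hF).prod_right_ae

lemma tracePairing_eq_integral_smoothedD {A B : Ω → ℝ → ℝ → ℝ}
    (hi : Integrable (traceFun T K A B) (P.prod (lebesgue4 T))) :
    tracePairing T K P A B = ∫ s in Icc 0 T, ∫ t in Icc 0 T, ∫ ω,
      smoothedD T K A ω t s * smoothedD T K B ω s t ∂P := by
  have hsw := hi.swap
  have hy := hi.integral_prod_right
  unfold tracePairing
  rw [integral_prod_symm _ hi, integral_prod _ hy]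
  refine integral_congr_ae ?_
  filter_upwards [integrable_prod_assoc_section hsw, hy.prod_right_ae] with s hs hs'
  rw [integral_prod _ hs']
  refine integral_congr_ae ?_
  filter_upwards [integrable_prod_assoc_section hs] with t ht
  rw [integral_integral_swap ht]
  refine integral_congr_ae (ae_of_all _ fun ω => ?_)
  simp only [smoothedD, traceFun]
  -- The (r,r') integrand is a product of functions of separate variables, so it factors without any
  -- integrability condition.
  exact integral_prod_mul (fun r => phi T K t r * A ω r s) (fun r' => phi T K s r' * B ω r' t)

lemma integral_cross_mul {μ : Measure ℝ} [SFinite μ] {f g : ℝ × ℝ → ℝ}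
    (hf : Integrable f (μ.prod μ)) (hg : Integrable g (μ.prod μ))
    (hi : Integrable (fun y : ℝ × ℝ × ℝ × ℝ => f (y.2.1, y.2.2.1) * g (y.1, y.2.2.2))
      (μ.prod (μ.prod (μ.prod μ)))) :
    ∫ y : ℝ × ℝ × ℝ × ℝ, f (y.2.1, y.2.2.1) * g (y.1, y.2.2.2) ∂(μ.prod (μ.prod (μ.prod μ))) =
      (∫ z, f z ∂(μ.prod μ)) * ∫ z, g z ∂(μ.prod μ) := by
  rw [integral_prod _ hi, integral_prod _ hf, integral_prod _ hg, ← integral_const_mul]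
  refine integral_congr_ae ?_
  filter_upwards [hi.prod_right_ae] with s hs
  rw [integral_prod _ hs, ← integral_mul_const]
  refine integral_congr_ae (ae_of_all _ fun t => ?_)
  exact integral_prod_mul (fun r => f (t, r)) (fun r' => g (s, r'))

/-- The trace pairing of elementary tensors. -/
lemma tracePairing_tensor (hK : IsRegularVolterraKernel T K) {a b : Ω → ℝ → ℝ} {h k : ℝ → ℝ}
    (ha : ∀ ω, a ω ∈ finiteEnergy hK) (hb : ∀ ω, b ω ∈ finiteEnergy hK)
    (hh : h ∈ finiteEnergy hK) (hk : k ∈ finiteEnergy hK)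
    (hi : Integrable (traceFun T K (fun ω r s => a ω r * h s) fun ω r s => b ω r * k s)
      (P.prod (lebesgue4 T))) :
    tracePairing T K P (fun ω r s => a ω r * h s) (fun ω r s => b ω r * k s) =
      ∫ ω, inner ℝ (KstarL2 T K (a ω)) (KstarL2 T K k) *
        inner ℝ (KstarL2 T K (b ω)) (KstarL2 T K h) ∂P := by
  unfold tracePairing
  rw [integral_prod _ hi]
  refine integral_congr_ae ?_
  filter_upwards [hi.prod_right_ae] with ω hω
  obtain ⟨i1, e1⟩ := integrable_phi_mul_and_inner hK (ha ω) hk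
  obtain ⟨i2, e2⟩ := integrable_phi_mul_and_inner hK (hb ω) hh
  have e : ∀ y : ℝ × ℝ × ℝ × ℝ, traceFun T K (fun ω r s => a ω r * h s) (fun ω r s => b ω r * k s)
      (ω, y) = (phi T K y.2.1 y.2.2.1 * a ω y.2.2.1 * k y.2.1) *
        (phi T K y.1 y.2.2.2 * b ω y.2.2.2 * h y.1) := fun y => by
    simp only [traceFun]
    ring
  simp only [e] at hω ⊢
  rw [← e1, ← e2]
  exact integral_cross_mul i1 i2 hω

/-- Bounded random multiples of elementary tensors are in `L²(Ω; |𝓗| ⊗ |𝓗|)`. -/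
lemma tensor_mem (hK : IsRegularVolterraKernel T K) {c : Ω → ℝ} (hc : Measurable c) {C : ℝ}
    (hC : ∀ ω, ‖c ω‖ ≤ C) {σ τ : ℝ → ℝ} (hσ : σ ∈ finiteEnergy hK) (hτ : τ ∈ finiteEnergy hK) :
    (fun ω s t => c ω * σ s * τ t) ∈ finiteTensorEnergy P hK := by
  have hm : Measurable fun p : Ω × ℝ × ℝ => c p.1 * σ p.2.1 * τ p.2.2 :=
    ((hc.comp measurable_fst).mul (hσ.1.comp (measurable_fst.comp measurable_snd))).mul
      (hτ.1.comp (measurable_snd.comp measurable_snd))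
  refine ⟨hm, ?_⟩
  have h : ∀ ω, sqNormAbsHH T K (fun s t => c ω * σ s * τ t) ≤
      ENNReal.ofReal C ^ 2 * (sqNormAbsH T K σ * sqNormAbsH T K τ) := fun ω => by
    rw [sqNormAbsHH_eq hK (a := fun s t => c ω * σ s * τ t)
      (hm.comp (f := fun q : ℝ × ℝ => (ω, q)) (by fun_prop)), sqNormAbsH_eq,
      sqNormAbsH_eq, ← tensorEnergy_mul (measurable_absK hK) hσ.1.enorm hτ.1.enorm]
    simp only [enorm_mul, mul_assoc]
    rw [tensorEnergy, energy_const_mul (a := fun z => ‖σ z.1‖ₑ * ‖τ z.2‖ₑ)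
      (measurable_tensorKernel (measurable_absK hK)) ((hσ.1.enorm.comp
        measurable_fst).fun_mul (hτ.1.enorm.comp measurable_snd))]
    refine mul_le_mul' (pow_le_pow_left' ?_ 2) le_rfl
    rw [← ofReal_norm]
    exact ENNReal.ofReal_le_ofReal (hC ω)
  refine (lintegral_mono h).trans_lt ?_
  rw [lintegral_const, measure_univ, mul_one]
  exact ENNReal.mul_lt_top (by simp) (ENNReal.mul_lt_top hσ.2 hτ.2)

end Trace

/-! ### Inner products in L²(Ω;H) -/

section InnerProduct

variable {Ω H : Type*} [MeasurableSpace Ω] {P : Measure Ω} [NormedAddCommGroup H]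
  [InnerProductSpace ℝ H]

lemma continuous_inner_Lp_left (u : Lp H 2 P) :
    Continuous fun q : Lp H 2 P => (inner ℝ q u : ℝ) :=
  continuous_id.inner continuous_const

lemma continuous_inner_Lp_right (u : Lp H 2 P) :
    Continuous fun q : Lp H 2 P => (inner ℝ u q : ℝ) :=
  continuous_const.inner continuous_id

lemma tendsto_inner_Lp {U V : Lp H 2 P} {u v : ℕ → Lp H 2 P} (hu : Tendsto u atTop (𝓝 U))
    (hv : Tendsto v atTop (𝓝 V)) :
    Tendsto (fun n => (inner ℝ (u n) (v n) : ℝ)) atTop (𝓝 (inner ℝ U V)) :=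
  hu.inner hv

lemma norm_sub_sq_Lp (u v : Lp H 2 P) : ‖u - v‖ ^ 2 =
    inner ℝ u u - inner ℝ u v - (inner ℝ v u - inner ℝ v v) := by
  rw [← real_inner_self_eq_norm_sq, inner_sub_left, inner_sub_right, inner_sub_right]

lemma ElemProcess.inner_sum_smul_val (p : ElemProcess H) (X : H → Lp ℝ 2 P) (ω : Ω) {ι : Type*}
    [Fintype ι] (c : ι → ℝ) (ψ : ι → H) : inner ℝ (∑ i, c i • ψ i) (p.val X ω) =
      ∑ j, p.coef X j ω * ∑ i, c i * inner ℝ (ψ i) (p.h j) := by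
  simp only [ElemProcess.val, inner_sum, inner_smul_right, sum_inner, inner_smul_left, conj_trivial]

end InnerProduct

/-! ### The divergence as a closed, single-valued operator -/

section Divergence

variable {Ω : Type*} [MeasurableSpace Ω] {P : Measure Ω} [IsProbabilityMeasure P] {T : ℝ}
  {K : ℝ → ℝ → ℝ} {W : Icc (0 : ℝ) T → Ω → ℝ}

lemma isIsonormal_X (hT : 0 < T) (hW : IsBrownianMotion P W) (K : ℝ → ℝ → ℝ) :
    IsIsonormal P (X K P W) :=
  (isIsonormal_wienerIntegral hT hW).comp_subtype (HSpace T K)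

lemma integral_mul_eq_inner (F ξ : Lp ℝ 2 P) : ∫ ω, F ω * ξ ω ∂P = inner ℝ F ξ := by
  rw [L2.inner_def]
  exact integral_congr_ae (ae_of_all _ fun ω => by simp [mul_comm])

/-- Both sides of the duality are continuous in the pair (F, DF), so it suffices to test it on
smooth functionals. -/
lemma isDivergence_iff {u : Lp (HSpace T K) 2 P} {ξ : Lp ℝ 2 P} : IsDivergence K P W u ξ ↔
    AEStronglyMeasurable[sigmaX K P W] ξ P ∧
      ∀ q ∈ smoothGraph K P W, inner ℝ q.1 ξ = inner ℝ q.2 u := by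
  simp only [IsDivergence, integral_mul_eq_inner, ← L2.inner_def]
  refine and_congr_right fun _ => ⟨fun h q hq => h q.1 q.2 (subset_closure hq), fun h F G hFG => ?_⟩
  have hc : IsClosed {q : Lp ℝ 2 P × Lp (HSpace T K) 2 P | inner ℝ q.1 ξ = inner ℝ q.2 u} :=
    isClosed_eq (continuous_fst.inner continuous_const)
      ((continuous_inner_Lp_left u).comp continuous_snd)
  exact closure_minimal (fun q hq => h q hq) hc hFG

/-- Each duality test is a closed condition on (u, ξ), and σ(X)-measurability up to null sets is
closed in L². This is what identifies limits of divergences. -/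
lemma isClosed_isDivergence :
    IsClosed {q : Lp (HSpace T K) 2 P × Lp ℝ 2 P | IsDivergence K P W q.1 q.2} := by
  simp only [isDivergence_iff, ofPred_and, ofPred_forall]
  refine IsClosed.inter ?_ ?_
  · exact (isClosed_aestronglyMeasurable (F := ℝ) (p := 2) (μ := P)
      (IsIsonormal.sigma_le (X K P W))).preimage continuous_snd
  · exact isClosed_iInter fun q => isClosed_iInter fun _ =>
      isClosed_eq (continuous_const.inner continuous_snd)
        ((continuous_inner_Lp_right q.2).comp continuous_fst)

lemma IsDivergence.inDomDivergence {u : Lp (HSpace T K) 2 P} {ξ : Lp ℝ 2 P}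
    (h : IsDivergence K P W u ξ) : InDomDivergence K P W u := by
  -- Cauchy–Schwarz gives the constant ‖ξ‖; the summand 1 only secures strict positivity.
  refine ⟨‖ξ‖ + 1, by positivity, fun F G hFG => ?_⟩
  rw [← h.2 F G hFG, integral_mul_eq_inner]
  have e : ∫ ω, (F ω) ^ 2 ∂P = ‖F‖ ^ 2 := by
    simp only [sq (F _), integral_mul_eq_inner, real_inner_self_eq_norm_sq]
  rw [e, Real.sqrt_sq (norm_nonneg F)]
  refine (abs_real_inner_le_norm F ξ).trans ?_
  nlinarith [norm_nonneg F, norm_nonneg ξ]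

lemma comp_mem_smoothGraph {g : ℝ → ℝ} (hg : IsSmoothBounded g) (h : HSpace T K) :
    ∃ q ∈ smoothGraph K P W, q.1 =ᵐ[P] fun ω => g (X K P W h ω) := by
  have hf : IsSmoothBounded fun x : Fin 1 → ℝ => g (x 0) :=
    hg.comp_clm (ContinuousLinearMap.proj (R := ℝ) (φ := fun _ : Fin 1 => ℝ) 0)
  have m1 : MemLp (fun ω => g (X K P W h ω)) 2 P :=
    IsIsonormal.memLp_smooth (X K P W) (fun _ : Fin 1 => h) hf 2
  have m2 : MemLp (fun ω => ∑ j : Fin 1, partialDeriv (fun x : Fin 1 → ℝ => g (x 0)) j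
      (fun _ => X K P W h ω) • h) 2 P := memLp_finsetSum _ fun j _ =>
    (memLp_const (p := 2) h).smul
      (IsIsonormal.memLp_smooth (X K P W) (fun _ : Fin 1 => h) (hf.fderiv_apply (Pi.single j 1)) ∞)
  exact ⟨(m1.toLp _, m2.toLp _), ⟨1, fun x => g (x 0), fun _ => h, hf, m1.coeFn_toLp,
    m2.coeFn_toLp⟩, m1.coeFn_toLp⟩

/-- The functionals cos X(h) and sin X(h) are smooth, so the difference of two divergences is
orthogonal to them all. -/
lemma IsDivergence.unique (hX : IsIsonormal P (X K P W)) {u : Lp (HSpace T K) 2 P}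
    {ξ η : Lp ℝ 2 P} (h1 : IsDivergence K P W u ξ) (h2 : IsDivergence K P W u η) : ξ = η := by
  rw [isDivergence_iff] at h1 h2
  have key : ∀ g : ℝ → ℝ, IsSmoothBounded g → ∀ h, ∫ ω, g (X K P W h ω) * (ξ - η) ω ∂P = 0 := by
    intro g hg h
    obtain ⟨q, hq, hqe⟩ := comp_mem_smoothGraph (P := P) (W := W) hg h
    have : ∫ ω, g (X K P W h ω) * (ξ - η) ω ∂P = ∫ ω, q.1 ω * (ξ - η) ω ∂P :=
      integral_congr_ae (by filter_upwards [hqe] with ω hω; rw [hω])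
    rw [this, integral_mul_eq_inner, inner_sub_right, h1.2 q hq, h2.2 q hq, sub_self]
  refine sub_eq_zero.1 (hX.eq_zero_of_integral_trig_eq_zero (ξ - η) ?_
    (key _ isSmoothBounded_cos) (key _ isSmoothBounded_sin))
  exact (h1.1.sub h2.1).congr (Lp.coeFn_sub ξ η).symm

lemma isDivergence_elemProcess (hX : IsIsonormal P (X K P W)) (p : ElemProcess (HSpace T K)) :
    IsDivergence K P W ((p.memLp_val (X := X K P W)).toLp _)
      ((p.memLp_div (X := X K P W)).toLp _) := by
  rw [isDivergence_iff]
  refine ⟨⟨p.div (X K P W), p.measurable_sigma_div.stronglyMeasurable, p.memLp_div.coeFn_toLp⟩, ?_⟩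
  rintro q ⟨n, g, ψ, hg, h1, h2⟩
  rw [← integral_mul_eq_inner, L2.inner_def]
  calc ∫ ω, q.1 ω * (p.memLp_div (X := X K P W)).toLp _ ω ∂P
      = ∫ ω, (g fun i => X K P W (ψ i) ω) * p.div (X K P W) ω ∂P := integral_congr_ae (by
        filter_upwards [h1, (p.memLp_div (X := X K P W)).coeFn_toLp] with ω e1 e2; rw [e1, e2])
    _ = _ := p.duality hX ψ hg
    _ = _ := integral_congr_ae (by
        filter_upwards [h2, (p.memLp_val (X := X K P W)).coeFn_toLp] with ω e1 e2
        rw [e1, e2]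
        simp only [fderiv_eq_sum_partialDeriv]
        exact (p.inner_sum_smul_val _ ω _ ψ).symm)

end Divergence

/-! ### Smooth processes as functions of time and as elementary 𝓗-valued processes -/

section Realization

variable {Ω : Type*} [MeasurableSpace Ω] {P : Measure Ω} [IsProbabilityMeasure P] {T : ℝ}
  {K : ℝ → ℝ → ℝ} {W : Icc (0 : ℝ) T → Ω → ℝ}

/-- The pair `(u, Du)` of function-valued random variables realizes the elementary
process `p`. -/
def Realizes (P : Measure Ω) (W : Icc (0 : ℝ) T → Ω → ℝ) (hK : IsRegularVolterraKernel T K)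
    (p : ElemProcess (HSpace T K)) (u : Ω → ℝ → ℝ) (Du : Ω → ℝ → ℝ → ℝ) : Prop :=
  ∃ (a : Fin p.m → Ω → ℝ → ℝ) (h : Fin p.m → ℝ → ℝ),
    (∀ j ω, a j ω ∈ finiteEnergy hK) ∧ (∀ j, h j ∈ finiteEnergy hK) ∧
    (∀ j, (p.h j : L2 T) = KstarL2 T K (h j)) ∧
    (∀ j ω (k : HSpace T K),
      p.dirDeriv (X K P W) j k ω = inner ℝ (KstarL2 T K (a j ω)) (k : L2 T)) ∧
    (∀ j, (fun ω s t => a j ω s * h j t) ∈ finiteTensorEnergy P hK) ∧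
    (u = fun ω t => ∑ j, p.coef (X K P W) j ω * h j t) ∧
    Du = fun ω s t => ∑ j, a j ω s * h j t

lemma IsSmoothProcess.exists_realizes (hK : IsRegularVolterraKernel T K) {u : Ω → ℝ → ℝ}
    {Du : Ω → ℝ → ℝ → ℝ} (hu : IsSmoothProcess K P W u Du) :
    ∃ p, Realizes P W hK p u Du := by
  obtain ⟨m, F, DF, h, hF, hh, rfl, rfl⟩ := hu
  choose n f φ hf hφ hFe hDFe using hF
  have hφ' := fun j i => (hφ j i).mem_finiteEnergy hK
  have hh' := fun j => (hh j).mem_finiteEnergy hK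
  let p : ElemProcess (HSpace T K) :=
    { m := m, n := n, f := f, φ := fun j i => toH hK (φ j i) (hφ j i),
      h := fun j => toH hK (h j) (hh j),
      -- `IsCbInfty` and `IsSmoothBounded` unfold to the same condition; likewise `X` at `toH`
      -- unfolds to `XFun`, which explains the proofs by `rfl`.
      smooth := hf }
  refine ⟨p, DF, h, fun j ω => ?_, hh', fun j => rfl, fun j ω k => ?_, fun j => ?_, ?_, rfl⟩
  · rw [hDFe]
    exact sum_mul_mem_finiteEnergy hK _ (hφ' j)
  · rw [hDFe, KstarL2_sum_mul hK _ (hφ' j), sum_inner]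
    refine (fderiv_eq_sum_partialDeriv _ _ _).trans (Finset.sum_congr rfl fun i _ => ?_)
    rw [inner_smul_left, conj_trivial]
    rfl
  -- The derivative is a finite sum of bounded random coefficients times deterministic tensors
  -- φ_{ji} ⊗ h_j.
  · have : (fun ω s t => DF j ω s * h j t) = ∑ i, fun ω s t =>
        partialDeriv (f j) i (fun i => XFun K P W (φ j i) ω) * φ j i s * h j t := by
      ext ω s t
      simp [hDFe, Finset.sum_mul]
    rw [this]
    refine Submodule.sum_mem _ fun i _ => ?_
    have hs := IsSmoothBounded.fderiv_apply (hf j) (Pi.single i 1)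
    obtain ⟨C, hC⟩ := hs.exists_bound
    exact tensor_mem hK (IsIsonormal.measurable_smooth (X K P W) (p.φ j) hs) (fun ω => hC _)
      (hφ' j i) (hh' j)
  · simp only [hFe]
    rfl

namespace Realizes

variable {hK : IsRegularVolterraKernel T K} {p q : ElemProcess (HSpace T K)}
  {u v : Ω → ℝ → ℝ} {Du Dv : Ω → ℝ → ℝ → ℝ}

lemma measurable (hp : Realizes P W hK p u Du) : Measurable fun x : Ω × ℝ => u x.1 x.2 := by
  obtain ⟨a, h, -, hh, -, -, -, rfl, -⟩ := hp
  exact Finset.measurable_fun_sum _ fun j _ =>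
    ((p.measurable_coef j).comp measurable_fst).mul ((hh j).1.comp measurable_snd)

lemma mem_finiteEnergy (hp : Realizes P W hK p u Du) (ω : Ω) : u ω ∈ finiteEnergy hK := by
  obtain ⟨a, h, -, hh, -, -, -, rfl, -⟩ := hp
  exact sum_mul_mem_finiteEnergy hK _ hh

lemma coe_val (hp : Realizes P W hK p u Du) (ω : Ω) :
    (p.val (X K P W) ω : L2 T) = KstarL2 T K (u ω) := by
  obtain ⟨a, h, -, hh, hph, -, -, rfl, -⟩ := hp
  rw [KstarL2_sum_mul hK _ hh]
  simp [ElemProcess.val, hph]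

lemma mem_finiteTensorEnergy (hp : Realizes P W hK p u Du) : Du ∈ finiteTensorEnergy P hK := by
  obtain ⟨a, h, -, -, -, -, ht, -, rfl⟩ := hp
  have : (fun ω s t => ∑ j, a j ω s * h j t) = ∑ j, fun ω s t => a j ω s * h j t := by
    ext ω s t
    simp
  rw [this]
  exact Submodule.sum_mem _ fun j _ => ht j

/-- Expand bilinearly into elementary tensors; each one gives the product of the crossed scalar
products ⟨DF_j, k_l⟩ ⟨DG_l, h_j⟩. -/
lemma tracePairing_eq (hp : Realizes P W hK p u Du) (hq : Realizes P W hK q v Dv) :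
    tracePairing T K P Du Dv = ∑ j, ∑ l, ∫ ω, p.dirDeriv (X K P W) j (q.h l) ω *
      q.dirDeriv (X K P W) l (p.h j) ω ∂P := by
  obtain ⟨a, h, ha, hh, hph, hd, ht, -, rfl⟩ := hp
  obtain ⟨b, k, hb, hk, hqk, he, hs, -, rfl⟩ := hq
  have hi := fun j l => integrable_traceFun hK (ht j) (hs l)
  have e : ∀ x, traceFun T K (fun ω s t => ∑ j, a j ω s * h j t)
      (fun ω s t => ∑ l, b l ω s * k l t) x = ∑ j, ∑ l, traceFun T K (fun ω s t => a j ω s * h j t)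
        (fun ω s t => b l ω s * k l t) x := fun x => by
    simp only [traceFun, Finset.mul_sum, Finset.sum_mul]
    rw [Finset.sum_comm]
  rw [tracePairing]
  simp only [e]
  rw [integral_finsetSum _ fun j _ => integrable_finsetSum _ fun l _ => hi j l]
  refine Finset.sum_congr rfl fun j _ => ?_
  rw [integral_finsetSum _ fun l _ => hi j l]
  refine Finset.sum_congr rfl fun l _ => ?_
  refine (tracePairing_tensor hK (ha j) (hb l) (hh j) (hk l) (hi j l)).trans ?_
  simp only [hd, he, hph, hqk]

/-- The covariance formula for smooth processes; what remains is approximation. -/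
lemma inner_div (hX : IsIsonormal P (X K P W)) (hp : Realizes P W hK p u Du)
    (hq : Realizes P W hK q v Dv) :
    inner ℝ ((p.memLp_div (X := X K P W)).toLp _) ((q.memLp_div (X := X K P W)).toLp _) =
      inner ℝ ((p.memLp_val (X := X K P W)).toLp _) ((q.memLp_val (X := X K P W)).toLp _) +
        tracePairing T K P Du Dv := by
  rw [hp.tracePairing_eq hq, ← integral_mul_eq_inner, L2.inner_def]
  refine Eq.trans (integral_congr_ae ?_) ((p.covariance q hX).trans
    (congrArg (· + _) (integral_congr_ae ?_)))
  · filter_upwards [(p.memLp_div (X := X K P W)).coeFn_toLp,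
      (q.memLp_div (X := X K P W)).coeFn_toLp] with ω e1 e2
    rw [e1, e2]
  · filter_upwards [(p.memLp_val (X := X K P W)).coeFn_toLp,
      (q.memLp_val (X := X K P W)).coeFn_toLp] with ω e1 e2
    rw [e1, e2]

end Realizes

end Realization

/-! ### Passage to the limit -/

section Limit

variable {Ω : Type*} [MeasurableSpace Ω] {P : Measure Ω} [IsProbabilityMeasure P] {T : ℝ}
  {K : ℝ → ℝ → ℝ} {W : Icc (0 : ℝ) T → Ω → ℝ} {hK : IsRegularVolterraKernel T K}

lemma exists_tendsto_Lp_of_edist_sq_le {H : Type*} [NormedAddCommGroup H] [CompleteSpace H]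
    {x : ℕ → Lp H 2 P} {e : ℕ → ℝ≥0∞} {C : ℝ≥0∞} (hC : C ≠ ∞) (he : Tendsto e atTop (𝓝 0))
    (h : ∀ n m, edist (x n) (x m) ^ 2 ≤ C * e n + C * e m) : ∃ U, Tendsto x atTop (𝓝 U) := by
  refine cauchySeq_tendsto_of_complete ?_
  rw [EMetric.cauchySeq_iff]
  intro ε hε
  have hlim : Tendsto (fun n => C * e n) atTop (𝓝 0) := by
    simpa using ENNReal.Tendsto.const_mul he (Or.inr hC)
  have hpos : 0 < min 1 (ε ^ 2) / 2 :=
    ENNReal.div_pos (lt_min one_pos (ENNReal.pow_pos hε 2)).ne' (by simp)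
  obtain ⟨N, hN⟩ := eventually_atTop.1 (hlim.eventually_lt_const hpos)
  refine ⟨N, fun m hm n hn => ?_⟩
  have h1 : edist (x m) (x n) ^ 2 < ε ^ 2 := by
    refine ((h m n).trans_lt (ENNReal.add_lt_add (hN m hm) (hN n hn))).trans_le ?_
    rw [ENNReal.add_halves]
    exact min_le_right _ _
  exact lt_of_not_ge fun h2 => (pow_le_pow_left' h2 2).not_gt h1

lemma measurable_sqNormAbsH (hK : IsRegularVolterraKernel T K) {u : Ω → ℝ → ℝ}
    (hu : Measurable fun x : Ω × ℝ => u x.1 x.2) : Measurable fun ω => sqNormAbsH T K (u ω) := by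
  simp only [sqNormAbsH_eq]
  exact measurable_energy (measurable_absK hK) hu.enorm

lemma lintegral_sqNormAbsH_sub_le (hK : IsRegularVolterraKernel T K) {u v f : Ω → ℝ → ℝ}
    (hu : Measurable fun x : Ω × ℝ => u x.1 x.2) (hv : Measurable fun x : Ω × ℝ => v x.1 x.2)
    (hf : Measurable fun x : Ω × ℝ => f x.1 x.2) :
    ∫⁻ ω, sqNormAbsH T K (u ω - v ω) ∂P ≤ 2 * ∫⁻ ω, sqNormAbsH T K (u ω - f ω) ∂P +
      2 * ∫⁻ ω, sqNormAbsH T K (v ω - f ω) ∂P := by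
  rw [← lintegral_const_mul' _ _ (by simp), ← lintegral_const_mul' _ _ (by simp),
    ← lintegral_add_left ((measurable_sqNormAbsH hK (hu.sub hf)).const_mul 2)]
  refine lintegral_mono fun ω => ?_
  have h := sqNormAbsH_sub_le (σ := u ω - f ω) (τ := v ω - f ω) hK
    ((hu.sub hf).comp measurable_prodMk_left) ((hv.sub hf).comp measurable_prodMk_left)
  rwa [sub_sub_sub_cancel_right] at h

lemma lintegral_sqNormAbsHH_sub_le (hK : IsRegularVolterraKernel T K) {A B D : Ω → ℝ → ℝ → ℝ}
    (hA : Measurable fun p : Ω × ℝ × ℝ => A p.1 p.2.1 p.2.2)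
    (hB : Measurable fun p : Ω × ℝ × ℝ => B p.1 p.2.1 p.2.2)
    (hD : Measurable fun p : Ω × ℝ × ℝ => D p.1 p.2.1 p.2.2) :
    ∫⁻ ω, sqNormAbsHH T K (A ω - B ω) ∂P ≤ 2 * ∫⁻ ω, sqNormAbsHH T K (A ω - D ω) ∂P +
      2 * ∫⁻ ω, sqNormAbsHH T K (B ω - D ω) ∂P := by
  have m1 : Measurable fun p : Ω × ℝ × ℝ => (A - B) p.1 p.2.1 p.2.2 := hA.sub hB
  have m2 : Measurable fun p : Ω × ℝ × ℝ => (A - D) p.1 p.2.1 p.2.2 := hA.sub hD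
  have m3 : Measurable fun p : Ω × ℝ × ℝ => (B - D) p.1 p.2.1 p.2.2 := hB.sub hD
  have m4 : Measurable fun ω => sqNormAbsHH T K (A ω - D ω) := measurable_sqNormAbsHH hK m2
  rw [← lintegral_const_mul' _ _ (by simp), ← lintegral_const_mul' _ _ (by simp),
    ← lintegral_add_left (m4.const_mul 2)]
  refine lintegral_mono fun ω => ?_
  have h1 := sqNormAbsHH_eq hK (measurable_slice m1 ω)
  have h2 := sqNormAbsHH_eq hK (measurable_slice m2 ω)
  have h3 := sqNormAbsHH_eq hK (measurable_slice m3 ω)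
  simp only [Pi.sub_apply] at h1 h2 h3
  rw [h1, h2, h3]
  refine energy_le_add (measurable_tensorKernel (measurable_absK hK))
    (measurable_slice m2 ω).enorm (measurable_slice m3 ω).enorm fun z => ?_
  have : A ω z.1 z.2 - B ω z.1 z.2 = (A ω z.1 z.2 - D ω z.1 z.2) - (B ω z.1 z.2 - D ω z.1 z.2) := by
    ring
  rw [this]
  exact enorm_sub_le

lemma edist_sq_Lp_eq_lintegral {H : Type*} [NormedAddCommGroup H] (U V : Lp H 2 P) :
    edist U V ^ 2 = ∫⁻ ω, ‖U ω - V ω‖ₑ ^ 2 ∂P := by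
  rw [edist_eq_enorm_sub, enorm_sq_Lp]
  refine lintegral_congr_ae ?_
  filter_upwards [Lp.coeFn_sub U V] with ω h
  rw [h, Pi.sub_apply]

lemma edist_sq_Lp {H : Type*} [NormedAddCommGroup H] (U V : Lp H 2 P) :
    edist U V ^ 2 = ENNReal.ofReal (‖U - V‖ ^ 2) := by
  rw [edist_eq_enorm_sub, ← ofReal_norm, ← ENNReal.ofReal_pow (norm_nonneg _)]

lemma tendsto_edist_Lp {H : Type*} [NormedAddCommGroup H] {U : Lp H 2 P} {V : ℕ → Lp H 2 P}
    (h : Tendsto V atTop (𝓝 U)) : Tendsto (fun n => edist U (V n)) atTop (𝓝 0) := by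
  simpa only [edist_comm U] using tendsto_iff_edist_tendsto_0.1 h

lemma enorm_sub_coe_eq (a b : HSpace T K) : ‖a - b‖ₑ = ‖(a : L2 T) - (b : L2 T)‖ₑ := rfl

namespace Realizes

variable {p q : ElemProcess (HSpace T K)} {u v f : Ω → ℝ → ℝ} {Du Dv Df : Ω → ℝ → ℝ → ℝ}

lemma edist_val_sq_le (hp : Realizes P W hK p u Du) (hq : Realizes P W hK q v Dv) :
    edist ((p.memLp_val (X := X K P W)).toLp _) ((q.memLp_val (X := X K P W)).toLp _) ^ 2 ≤
      ∫⁻ ω, sqNormAbsH T K (u ω - v ω) ∂P := by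
  rw [edist_sq_Lp_eq_lintegral]
  refine lintegral_mono_ae ?_
  filter_upwards [(p.memLp_val (X := X K P W)).coeFn_toLp,
      (q.memLp_val (X := X K P W)).coeFn_toLp] with ω e1 e2
  rw [e1, e2, enorm_sub_coe_eq, hp.coe_val, hq.coe_val,
    ← KstarL2_sub hK (hp.mem_finiteEnergy ω) (hq.mem_finiteEnergy ω)]
  exact enorm_KstarL2_sq_le hK
    ((finiteEnergy hK).sub_mem (hp.mem_finiteEnergy ω) (hq.mem_finiteEnergy ω))

/-- Expanding the square and applying `inner_div` to the four pairs avoids building an elementary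
process for the difference. -/
lemma norm_div_sub_sq (hX : IsIsonormal P (X K P W)) (hp : Realizes P W hK p u Du)
    (hq : Realizes P W hK q v Dv) :
    ‖(p.memLp_div (X := X K P W)).toLp _ - (q.memLp_div (X := X K P W)).toLp _‖ ^ 2 =
      ‖(p.memLp_val (X := X K P W)).toLp _ - (q.memLp_val (X := X K P W)).toLp _‖ ^ 2 +
        tracePairing T K P (Du - Dv) (Du - Dv) := by
  have hu := hp.mem_finiteTensorEnergy
  have hv := hq.mem_finiteTensorEnergy
  rw [tracePairing_sub_left hK hu hv (Submodule.sub_mem _ hu hv), tracePairing_sub_right hK hu hu hv,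
    tracePairing_sub_right hK hv hu hv, norm_sub_sq_Lp, norm_sub_sq_Lp, hp.inner_div hX hp,
    hp.inner_div hX hq, hq.inner_div hX hp, hq.inner_div hX hq]
  ring

lemma edist_div_sq_le (hX : IsIsonormal P (X K P W)) (hp : Realizes P W hK p u Du)
    (hq : Realizes P W hK q v Dv) :
    edist ((p.memLp_div (X := X K P W)).toLp _) ((q.memLp_div (X := X K P W)).toLp _) ^ 2 ≤
      (∫⁻ ω, sqNormAbsH T K (u ω - v ω) ∂P) + ∫⁻ ω, sqNormAbsHH T K (Du ω - Dv ω) ∂P := by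
  have hD := Submodule.sub_mem _ hp.mem_finiteTensorEnergy hq.mem_finiteTensorEnergy
  have h1 := hp.edist_val_sq_le hq
  have h2 := enorm_tracePairing_le hK hD hD
  -- With both arguments equal, the two square roots in the Cauchy–Schwarz bound combine to exponent
  -- one.
  rw [← ENNReal.rpow_add_of_nonneg _ _ (by norm_num) (by norm_num)] at h2
  norm_num at h2
  have e := norm_div_sub_sq hX hp hq
  rw [edist_sq_Lp] at h1 ⊢
  rw [e]
  refine ENNReal.ofReal_add_le.trans (add_le_add h1 (le_trans ?_ h2))
  rw [← ofReal_norm]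
  exact ENNReal.ofReal_le_ofReal (le_abs_self _)

end Realizes

/-- The data attached to an element of `𝔻_{1,2}(|𝓗|)`. -/
lemma IsD12AbsH.exists_limit (hX : IsIsonormal P (X K P W)) (hK : IsRegularVolterraKernel T K)
    {f : Ω → ℝ → ℝ} {Df : Ω → ℝ → ℝ → ℝ} (hf : IsD12AbsH K P W f Df) :
    Df ∈ finiteTensorEnergy P hK ∧
    ∃ (U : Lp (HSpace T K) 2 P) (ξ : Lp ℝ 2 P) (p : ℕ → ElemProcess (HSpace T K))
      (u : ℕ → Ω → ℝ → ℝ) (Du : ℕ → Ω → ℝ → ℝ → ℝ), (∀ n, Realizes P W hK (p n) (u n) (Du n)) ∧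
      Represents K P f U ∧ IsDivergence K P W U ξ ∧
      Tendsto (fun n => ((p n).memLp_val (X := X K P W)).toLp _) atTop (𝓝 U) ∧
      Tendsto (fun n => ((p n).memLp_div (X := X K P W)).toLp _) atTop (𝓝 ξ) ∧
      Tendsto (fun n => ∫⁻ ω, sqNormAbsHH T K (Du n ω - Df ω) ∂P) atTop (𝓝 0) := by
  obtain ⟨hfm, hDfm, u, Du, hu, hlim⟩ := hf
  choose p hp using fun n => (hu n).exists_realizes hK
  have hlim1 : Tendsto (fun n => ∫⁻ ω, sqNormAbsH T K (u n ω - f ω) ∂P) atTop (𝓝 0) :=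
    tendsto_of_tendsto_of_tendsto_of_le_of_le tendsto_const_nhds hlim (fun _ => zero_le)
      fun _ => le_self_add
  have hlim2 : Tendsto (fun n => ∫⁻ ω, sqNormAbsHH T K (Du n ω - Df ω) ∂P) atTop (𝓝 0) :=
    tendsto_of_tendsto_of_tendsto_of_le_of_le tendsto_const_nhds hlim (fun _ => zero_le)
      fun _ => le_add_self
  have hum := fun n => (hp n).measurable
  have hDum := fun n => (hp n).mem_finiteTensorEnergy
  have b1 := fun n m => lintegral_sqNormAbsH_sub_le (P := P) hK (hum n) (hum m) hfm
  have b2 := fun n m => lintegral_sqNormAbsHH_sub_le (P := P) hK (hDum n).1 (hDum m).1 hDfm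
  have : CompleteSpace (HSpace T K) :=
    (Submodule.isClosed_topologicalClosure _).completeSpace_coe
  obtain ⟨U, hU⟩ : ∃ U, Tendsto (fun n => ((p n).memLp_val (X := X K P W)).toLp _) atTop (𝓝 U) :=
    exists_tendsto_Lp_of_edist_sq_le (C := 2) (by simp) hlim1 fun n m =>
      ((hp n).edist_val_sq_le (hp m)).trans (b1 n m)
  obtain ⟨ξ, hξ⟩ : ∃ ξ, Tendsto (fun n => ((p n).memLp_div (X := X K P W)).toLp _) atTop (𝓝 ξ) :=
    exists_tendsto_Lp_of_edist_sq_le (C := 2) (by simp) hlim fun n m =>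
      ((hp n).edist_div_sq_le hX (hp m)).trans ((add_le_add (b1 n m) (b2 n m)).trans_eq (by ring))
  have hDf : Df ∈ finiteTensorEnergy P hK := by
    obtain ⟨n, hn⟩ := (hlim2.eventually_lt_const one_pos).exists
    have hs : Du n - Df ∈ finiteTensorEnergy P hK :=
      ⟨(hDum n).1.sub hDfm, hn.trans ENNReal.one_lt_top⟩
    simpa using Submodule.sub_mem _ (hDum n) hs
  -- The values and the divergences converge together, so closedness of the operator gives the
  -- divergence of the limit.
  have hdiv : IsDivergence K P W U ξ :=
    isClosed_isDivergence.mem_of_tendsto (hU.prodMk_nhds hξ)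
      (Eventually.of_forall fun n => isDivergence_elemProcess hX (p n))
  refine ⟨hDf, U, ξ, p, u, Du, hp, ?_, hdiv, hU, hξ, hlim2⟩
  have hfE : ∀ᵐ ω ∂P, f ω ∈ finiteEnergy hK := by
    obtain ⟨n, hn⟩ := (hlim1.eventually_lt_const one_pos).exists
    filter_upwards [ae_lt_top (measurable_sqNormAbsH hK ((hum n).sub hfm))
      (hn.trans ENNReal.one_lt_top).ne] with ω hω
    have hs : u n ω - f ω ∈ finiteEnergy hK :=
      ⟨((hum n).sub hfm).comp measurable_prodMk_left, hω⟩
    simpa using Submodule.sub_mem _ ((hp n).mem_finiteEnergy ω) hs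
  let V := fun n => ((p n).memLp_val (X := X K P W)).toLp _
  -- It remains to identify U with K_T^* f. For each n, G n dominates ‖U - K_T^* f‖² almost surely
  -- while its expectation tends to 0; hence the infimum over n vanishes almost surely, and no
  -- subsequence has to be extracted.
  let G := fun n ω => 2 * ‖U ω - V n ω‖ₑ ^ 2 + 2 * sqNormAbsH T K (u n ω - f ω)
  have hGm : ∀ n, Measurable (G n) := fun n =>
    ((((Lp.stronglyMeasurable U).sub (Lp.stronglyMeasurable (V n))).enorm.pow_const 2).const_mul
      2).add ((measurable_sqNormAbsH hK ((hum n).sub hfm)).const_mul 2)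
  have hGle : ∀ᵐ ω ∂P, ∀ n, ‖(U ω : L2 T) - KstarL2 T K (f ω)‖ₑ ^ 2 ≤ G n ω := by
    rw [ae_all_iff]
    intro n
    filter_upwards [hfE, ((p n).memLp_val (X := X K P W)).coeFn_toLp] with ω h1 h2
    have e : (U ω : L2 T) - KstarL2 T K (f ω) =
        ((U ω : L2 T) - (V n ω : L2 T)) + KstarL2 T K (u n ω - f ω) := by
      rw [KstarL2_sub hK ((hp n).mem_finiteEnergy ω) h1, ← (hp n).coe_val, ← h2]
      abel
    rw [e]
    refine (pow_le_pow_left' (enorm_add_le _ _) 2).trans ((ennreal_add_sq_le _ _).trans ?_)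
    refine add_le_add le_rfl (mul_le_mul' le_rfl (enorm_KstarL2_sq_le hK ?_))
    exact (finiteEnergy hK).sub_mem ((hp n).mem_finiteEnergy ω) h1
  have hGlim : Tendsto (fun n => ∫⁻ ω, G n ω ∂P) atTop (𝓝 0) := by
    have e : ∀ n, ∫⁻ ω, G n ω ∂P = 2 * edist U (V n) ^ 2 +
        2 * ∫⁻ ω, sqNormAbsH T K (u n ω - f ω) ∂P := fun n => by
      rw [edist_sq_Lp_eq_lintegral, ← lintegral_const_mul' _ _ (by simp),
        ← lintegral_const_mul' _ _ (by simp), ← lintegral_add_right _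
          ((measurable_sqNormAbsH hK ((hum n).sub hfm)).const_mul 2)]
    simp only [e]
    have h0 : Tendsto (fun n => edist U (V n)) atTop (𝓝 0) := tendsto_edist_Lp hU
    have t1 := ENNReal.Tendsto.const_mul (a := 2) (ENNReal.Tendsto.pow (n := 2) h0)
      (Or.inr (by simp))
    have t2 := ENNReal.Tendsto.const_mul (a := 2) hlim1 (Or.inr (by simp))
    simpa using t1.add t2
  have hinf : ∀ᵐ ω ∂P, ⨅ n, G n ω = 0 := by
    have h0 : ∫⁻ ω, ⨅ n, G n ω ∂P = 0 := by
      refine le_antisymm (ge_of_tendsto' hGlim fun n => lintegral_mono fun ω => iInf_le _ n) zero_le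
    exact (lintegral_eq_zero_iff (Measurable.iInf hGm)).1 h0
  filter_upwards [hfE, hGle, hinf] with ω h1 h2 h3
  have h4 : ‖(U ω : L2 T) - KstarL2 T K (f ω)‖ₑ ^ 2 = 0 :=
    le_antisymm ((le_iInf h2).trans_eq h3) zero_le
  have h5 : (U ω : L2 T) = KstarL2 T K (f ω) := by
    rw [← sub_eq_zero, ← enorm_eq_zero]
    exact pow_eq_zero_iff (two_ne_zero) |>.1 h4
  rw [h5]
  exact coe_KstarL2 hK h1

end Limit

end GaussianVolterra

end

open GaussianVolterra in
theorem proposition2p1 {Ω : Type*} [MeasurableSpace Ω] (P : Measure Ω) [IsProbabilityMeasure P]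
    (T : ℝ) (hT : 0 < T) (W : Icc (0 : ℝ) T → Ω → ℝ) (hW : IsBrownianMotion P W)
    (K : ℝ → ℝ → ℝ) (hK : IsRegularVolterraKernel T K)
    (f g : Ω → ℝ → ℝ) (Df Dg : Ω → ℝ → ℝ → ℝ)
    (hf : IsD12AbsH K P W f Df) (hg : IsD12AbsH K P W g Dg) :
    ∃ u v : Lp (HSpace T K) 2 P,
      -- `f` and `g` are elements of `L²(Ω;𝓗)` that belong to the domain of the divergence
      Represents K P f u ∧ Represents K P g v ∧
      InDomDivergence K P W u ∧ InDomDivergence K P W v ∧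
      (∃! ξ, IsDivergence K P W u ξ) ∧ (∃! η, IsDivergence K P W v η) ∧
      -- the integral of `𝔻_t f_s 𝔻_s g_t`, with `𝔻` written out, converges absolutely
      Integrable (fun x : Ω × ℝ × ℝ × ℝ × ℝ =>
          match x with
          | (ω, s, t, r, r') => (phi T K t r * Df ω r s) * (phi T K s r' * Dg ω r' t))
        (P.prod ((lebesgue T).prod ((lebesgue T).prod ((lebesgue T).prod (lebesgue T))))) ∧
      -- the covariance formula
      ∀ ξ η, IsDivergence K P W u ξ → IsDivergence K P W v η →
        ∫ ω, ξ ω * η ω ∂P = (∫ ω, inner ℝ (u ω) (v ω) ∂P) +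
          ∫ s in Icc 0 T, ∫ t in Icc 0 T, ∫ ω,
            smoothedD T K Df ω t s * smoothedD T K Dg ω s t ∂P := by
  have hX := isIsonormal_X hT hW K
  obtain ⟨hDf, U, ξ, p, u, Du, hp, hfU, hξ, hUlim, hξlim, hDu⟩ := hf.exists_limit hX hK
  obtain ⟨hDg, V, η, q, v, Dv, hq, hgV, hη, hVlim, hηlim, hDv⟩ := hg.exists_limit hX hK
  have hi := integrable_traceFun hK hDf hDg
  refine ⟨U, V, hfU, hgV, hξ.inDomDivergence, hη.inDomDivergence,
    ⟨ξ, hξ, fun ξ' h => h.unique hX hξ⟩, ⟨η, hη, fun η' h => h.unique hX hη⟩, hi, ?_⟩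
  intro ξ' η' hξ' hη'
  rw [hξ'.unique hX hξ, hη'.unique hX hη, ← tracePairing_eq_integral_smoothedD hi,
    integral_mul_eq_inner, ← L2.inner_def]
  -- The covariances of the approximating divergences converge to E[ξη]; by the formula for smooth
  -- processes they also converge to the right-hand side.
  refine tendsto_nhds_unique (hξlim.inner hηlim) ?_
  simp only [(hp _).inner_div hX (hq _)]
  exact (tendsto_inner_Lp hUlim hVlim).add (tendsto_tracePairing hK hDf hDg
    (fun n => (hp n).mem_finiteTensorEnergy) (fun n => (hq n).mem_finiteTensorEnergy) hDu hDv)
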